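/- **Setting.** Let $L_{\rm horiz}=\{x\le 1,\,0\le y\le 1\}$, $L_{\rm vert}=\{y\le 1,\,0\le x\le 1\}$, $L=L_{\rm horiz}\cup L_{\rm vert}$ in $\mathbb R^2$; let $R_t$ be the rotation by the angle $t$, $\mu_t=(\cos t,\sin t)$, $\nu_t=(-\sin t,\cos t)$. A *rotation path* is a continuous $\mathbf x:[0,\pi/2]\to\mathbb R^2$ with $\mathbf x(0)=0$; its *shape* is $$S_{\mathbf x}=L_{\rm horiz}\cap\bigcap_{0\le t\le\pi/2}\big(\mathbf x(t)+R_t(L)\big)\cap\big(\mathbf x(\pi/2)+R_{\pi/2}(L_{\rm vert})\big).$$ The *contact points* at time $t$ are: $\mathbf x(t)$, if it lies in $S_{\mathbf x}$; and the points $\mathbf A(t),\mathbf C(t)$ and $\mathbf B(t),\mathbf D(t)$ where, respectively, the outer walls perpendicular to $\mu_t$ and $\nu_t$ and the inner walls perpendicular to $\mu_t$ and $\nu_t$ (half-lines starting at the corner $\mathbf x(t)$, without the corner) of the placed hallway $\mathbf x(t)+R_t(L)$ touch $S_{\mathbf x}$, together with limits of such points from times in $(0,\pi/2)$ converging to $t$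 (so $\mathbf A(0)=\lim_{t\downarrow0}\mathbf A(t)$, and a tangency point of an inner wall may run into the corner). $\Gamma_{\mathbf x}(t)$ is the set of those of $\mathbf x,\mathbf A,\mathbf B,\mathbf C,\mathbf D$ that exist at time $t$. The path is *well-behaved* at $t\in(0,\pi/2)$ if it is $C^2$ at $t$, the existing contact paths are differentiable at $t$, and: $\langle\mathbf x',\nu_t\rangle\ge0\ge\langle\mathbf x',\mu_t\rangle$ if $\mathbf x\in\Gamma_{\mathbf x}(t)$; $\langle\mathbf A',\nu_t\rangle\ge0$; $\langle\mathbf B',\nu_t\rangle\le0$ if $\mathbf B\in\Gamma_{\mathbf x}(t)$; $\langle\mathbf C',\mu_t\rangle\le0$; $\langle\mathbf D',\mu_t\rangle\ge0$ if $\mathbf D\in\Gamma_{\mathbf x}(t)$ (and likewise for $\mathbf A$, $\mathbf C$ only if they exist). *Assumptions 1–5* on a rotation path $\mathbf x$ and an angle $0<b<\pi/4$: (1) $\mathbf x\in C^1[0,\pi/2]$; (2) for all $t$, $\mathbf x(\pi/2-t)$ is the reflection of $\mathbf x(t)$ in the vertical line through $\mathbf x(\pi/4)$; (3) $\mathbf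 A(0)=(1,1/2)$; (4) each wall has at most one contact point at each $t\in(0,\pi/2)$, and $\Gamma_{\mathbf x}(t)$ is $\{\mathbf A,\mathbf C,\mathbf D\}$ for $0<t<b$, $\{\mathbf x,\mathbf A,\mathbf B,\mathbf C,\mathbf D\}$ for $b\le t\le\pi/2-b$, and $\{\mathbf A,\mathbf B,\mathbf C\}$ for $\pi/2-b<t<\pi/2$; (5) $\mathbf x$ is well-behaved at every $t\in(0,\pi/2)\setminus\{b,\pi/2-b\}$. *Necessary conditions at $t$.* If $\Gamma_{\mathbf x}$ is constant near $t$ and equal to one of the six sets below, then $$\mathbf x''(t)=R_t\left(\begin{pmatrix}v_1\\v_2\end{pmatrix}+\begin{pmatrix}p\sin t&-p\cos t\\q\cos t&q\sin t\end{pmatrix}\mathbf x'(t)\right),$$ where $(v_1,v_2,p,q)$ is $(-1,-\frac12,2,2)$ for $\{\mathbf A,\mathbf C,\mathbf D\}$; $(-1,-\frac12,1,\frac32)$ for $\{\mathbf x,\mathbf A,\mathbf C,\mathbf D\}$; $(-1,-1,1,1)$ for $\{\mathbf x,\mathbf A,\mathbf C\}$; $(-\frac12,-1,\frac32,1)$ for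 $\{\mathbf x,\mathbf A,\mathbf B,\mathbf C\}$; $(-\frac12,-1,2,2)$ for $\{\mathbf A,\mathbf B,\mathbf C\}$; $(-\frac12,-\frac12,\frac32,\frac32)$ for $\{\mathbf x,\mathbf A,\mathbf B,\mathbf C,\mathbf D\}$; moreover $\mathbf A'(t)=0$ in the first case and $\mathbf C'(t)=0$ in the fifth. *The path.* Let $\beta=\arctan\!\big[\frac12\big(\sqrt[3]{\sqrt2+1}-\sqrt[3]{\sqrt2-1}\big)\big]$, $a_1=\frac14\sqrt{4+\sqrt[3]{71+8\sqrt2}+\sqrt[3]{71-8\sqrt2}}$, $f_1=\dfrac{\big(83+\sqrt[3]{420619+15104\sqrt2}+\sqrt[3]{420619-15104\sqrt2}\big)^{1/4}}{3\sqrt{2(2-\sqrt2)}}$, $f_2=-(\sqrt2-1)f_1$, and let $\mathbf x(t)$ be $$\begin{cases}R_t\begin{pmatrix}a_1\cos t-1\\a_1\sin t-\frac12\end{pmatrix}+\begin{pmatrix}1-a_1\\\frac12\end{pmatrix}&0\le t<\beta,\\[2mm]R_t\begin{pmatrix}f_1\cos\frac t2+f_2\sin\frac t2-1\\-f_2\cos\frac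 t2+f_1\sin\frac t2-1\end{pmatrix}+\begin{pmatrix}1-\frac43a_1\\\frac12\end{pmatrix}&\beta\le t\le\frac\pi2-\beta,\\[2mm]R_t\begin{pmatrix}a_1\cos t-\frac12\\a_1\sin t-1\end{pmatrix}+\begin{pmatrix}1-\frac53a_1\\\frac12\end{pmatrix}&\frac\pi2-\beta<t\le\frac\pi2.\end{cases}$$ **Theorem.** Let $\Sigma=S_{\mathbf x}\cap\rho(S_{\mathbf x})$, with $\rho$ the reflection across the line $y=1/2$. Then: (i) $\Sigma$ is compact and connected and can move around corners both to the right and to the left: there is a continuous rigid motion, rotating monotonically by a total angle $\pi/2$ clockwise, that carries $\Sigma$ from $L_{\rm horiz}$ into $L_{\rm vert}$ within $L$, and one rotating counterclockwise that carries $\Sigma$ from $\rho(L_{\rm horiz})$ into $\rho(L_{\rm vert})$ within $\rho(L)$. (ii) $\mathbf x$ satisfies assumptions 1–5 with $b=\beta$ and the necessary conditions at all $t\in(0,\pi/2)\setminus\{\beta,\pi/2-\beta\}$; and it is the unique such path: if $\mathbf y$ satisfies assumptions 1–5 with some $b\in(0,\pi/4)$ and the necessary conditions at all $t\in(0,\pi/2)\setminus\{b,\pi/2-b\}$,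 then $b=\beta$ and $\mathbf y=\mathbf x$ on $[0,\pi/2]$. (iii) The area of $\Sigma$ is $\sqrt[3]{3+2\sqrt2}+\sqrt[3]{3-2\sqrt2}-1+\beta$. (iv) $\Sigma$ has a unique leftmost point and a unique rightmost point, and their distance is $\frac23\sqrt{4+\sqrt[3]{71+8\sqrt2}+\sqrt[3]{71-8\sqrt2}}$. -/

import Mathlib

open Real Set Filter Topology MeasureTheory

noncomputable section

namespace Sofa

/-- The Euclidean plane. -/
abbrev Plane := EuclideanSpace ℝ (Fin 2)

/-- Rotation of the plane by the angle `t` (counterclockwise). -/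
def rot (t : ℝ) (p : Plane) : Plane :=
  !₂[cos t * p 0 - sin t * p 1, sin t * p 0 + cos t * p 1]

/-- The rotating orthonormal frame: `mu t` is the rotated first basis vector. -/
def mu (t : ℝ) : Plane := !₂[cos t, sin t]

/-- The rotating orthonormal frame: `nu t` is the rotated second basis vector. -/
def nu (t : ℝ) : Plane := !₂[-sin t, cos t]

/-- The affine reflection across the line `y = 1/2`. -/
def rho (p : Plane) : Plane := !₂[p 0, 1 - p 1]

/-! ### The hallway and motions around its corner -/

def Lhoriz : Set Plane := {p | p 0 ≤ 1 ∧ 0 ≤ p 1 ∧ p 1 ≤ 1}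

def Lvert : Set Plane := {p | p 1 ≤ 1 ∧ 0 ≤ p 0 ∧ p 0 ≤ 1}

def L : Set Plane := Lhoriz ∪ Lvert

/-- The set `S` can be moved by a continuous rigid motion, rotating monotonically by a total angle
of `π / 2` in the direction given by the sign `ε`, from the arm `H₁` into the arm `H₂`, while
staying within the hallway `H₁ ∪ H₂`. -/
def MovesAround (ε : ℝ) (H₁ H₂ S : Set Plane) : Prop :=
  ∃ (θ : ℝ → ℝ) (c : ℝ → Plane),
    ContinuousOn θ (Icc 0 1) ∧ ContinuousOn c (Icc 0 1) ∧
    MonotoneOn θ (Icc 0 1) ∧ θ 0 = 0 ∧ θ 1 = π / 2 ∧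
    (∀ p ∈ S, c 0 + rot (ε * θ 0) p ∈ H₁) ∧
    (∀ p ∈ S, c 1 + rot (ε * θ 1) p ∈ H₂) ∧
    ∀ s ∈ Icc (0 : ℝ) 1, ∀ p ∈ S, c s + rot (ε * θ s) p ∈ H₁ ∪ H₂

/-- Motion around a corner to the right: from the left along `Lhoriz`, then down along `Lvert`,
turning clockwise. -/
def MovesAroundRight (S : Set Plane) : Prop := MovesAround (-1) Lhoriz Lvert S

/-- Motion around a corner to the left: the hallway is the mirror image, and the shape itself is
not reflected and turns counterclockwise. -/
def MovesAroundLeft (S : Set Plane) : Prop := MovesAround 1 (rho '' Lhoriz) (rho '' Lvert) S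

/-! ### Rotation paths and their shapes -/

/-- A rotation path; only its values on `[0, π/2]` matter. -/
def IsRotationPath (x : ℝ → Plane) : Prop := ContinuousOn x (Icc 0 (π / 2)) ∧ x 0 = 0

/-- The image of the set `H` under the rotation by `t` followed by the translation by `x t`. -/
def placed (x : ℝ → Plane) (t : ℝ) (H : Set Plane) : Set Plane := (fun p => x t + rot t p) '' H

/-- The shape associated with a rotation path. -/
def shape (x : ℝ → Plane) : Set Plane :=
  Lhoriz ∩ (⋂ t ∈ Icc (0 : ℝ) (π / 2), placed x t L) ∩ placed x (π / 2) Lvert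

/-! ### Contact points -/

/-- The five possible types of contact points: the inner corner `x` of the hallway, and tangency
points `A`, `C` with the outer walls and `B`, `D` with the inner walls. -/
inductive Contact
  | x
  | A
  | B
  | C
  | D

/-- The four walls of the hallway placed at time `t`. The inner walls are taken without their
common end point, which is the corner `x t` and is counted separately. -/
def wall (x : ℝ → Plane) : Contact → ℝ → Set Plane
  | .x, t => {x t}
  | .A, t => {p | inner ℝ (p - x t) (mu t) = 1 ∧ inner ℝ (p - x t) (nu t) ≤ 1}
  | .B, t => {p | inner ℝ (p - x t) (mu t) = 0 ∧ inner ℝ (p - x t) (nu t) < 0}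
  | .C, t => {p | inner ℝ (p - x t) (nu t) = 1 ∧ inner ℝ (p - x t) (mu t) ≤ 1}
  | .D, t => {p | inner ℝ (p - x t) (nu t) = 0 ∧ inner ℝ (p - x t) (mu t) < 0}

/-- The contact points of type `k` at time `t`: points where the wall (or corner) touches the
shape at time `t`, and limits of such points at times in `(0, π/2)` converging to `t`.
Passing to limits matters in two places only: when the tangency point of an inner wall
runs into the corner `x t` (it then still counts as the tangency point of that wall), and at the
end points of `[0, π/2]`, where a wall of the hallway is parallel to the arm and may share
a whole segment with the shape. -/
def contactSet (x : ℝ → Plane) (k : Contact) (t : ℝ) : Set Plane :=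
  {p | (t, p) ∈ closure {q : ℝ × Plane |
    q.1 ∈ Ioo 0 (π / 2) ∧ q.2 ∈ shape x ∧ q.2 ∈ wall x k q.1}}

/-- The types of contact points that exist at time `t`. -/
def Gam (x : ℝ → Plane) (t : ℝ) : Set Contact := {k | (contactSet x k t).Nonempty}

/-- The contact path of type `k`; meaningful at times when there is exactly one contact point
of type `k`. -/
def contactPath (x : ℝ → Plane) (k : Contact) (t : ℝ) : Plane :=
  Classical.epsilon fun p => p ∈ contactSet x k t

/-- The rotation path is well-behaved at `t`. -/
def WellBehaved (x : ℝ → Plane) (t : ℝ) : Prop :=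
  ContDiffAt ℝ 2 x t ∧
  (Contact.x ∈ Gam x t →
    0 ≤ inner ℝ (deriv x t) (nu t) ∧ inner ℝ (deriv x t) (mu t) ≤ 0) ∧
  (Contact.A ∈ Gam x t → DifferentiableAt ℝ (contactPath x .A) t ∧
    0 ≤ inner ℝ (deriv (contactPath x .A) t) (nu t)) ∧
  (Contact.B ∈ Gam x t → DifferentiableAt ℝ (contactPath x .B) t ∧
    inner ℝ (deriv (contactPath x .B) t) (nu t) ≤ 0) ∧
  (Contact.C ∈ Gam x t → DifferentiableAt ℝ (contactPath x .C) t ∧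
    inner ℝ (deriv (contactPath x .C) t) (mu t) ≤ 0) ∧
  (Contact.D ∈ Gam x t → DifferentiableAt ℝ (contactPath x .D) t ∧
    0 ≤ inner ℝ (deriv (contactPath x .D) t) (mu t))

/-! ### The six differential equations -/

/-- The equation `x'' = R_t (v + M_t x')`, in which the matrix `M_t` has the rows
`p * (sin t, -cos t)` and `q * (cos t, sin t)`. -/
def OdeAt (v : Plane) (p q : ℝ) (x : ℝ → Plane) (t : ℝ) : Prop :=
  deriv (deriv x) t =
    rot t (v + !₂[p * (sin t * deriv x t 0 - cos t * deriv x t 1),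
                  q * (cos t * deriv x t 0 + sin t * deriv x t 1)])

/-- The necessary conditions for area maximization at time `t`, according to the set of contact
points around `t`. -/
def NecessaryConditions (x : ℝ → Plane) (t : ℝ) : Prop :=
  ((∀ᶠ s in 𝓝 t, Gam x s = {.A, .C, .D}) →
    OdeAt !₂[-1, -1 / 2] 2 2 x t ∧ HasDerivAt (contactPath x .A) 0 t) ∧
  ((∀ᶠ s in 𝓝 t, Gam x s = {.x, .A, .C, .D}) → OdeAt !₂[-1, -1 / 2] 1 (3 / 2) x t) ∧
  ((∀ᶠ s in 𝓝 t, Gam x s = {.x, .A, .C}) → OdeAt !₂[-1, -1] 1 1 x t) ∧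
  ((∀ᶠ s in 𝓝 t, Gam x s = {.x, .A, .B, .C}) → OdeAt !₂[-1 / 2, -1] (3 / 2) 1 x t) ∧
  ((∀ᶠ s in 𝓝 t, Gam x s = {.A, .B, .C}) →
    OdeAt !₂[-1 / 2, -1] 2 2 x t ∧ HasDerivAt (contactPath x .C) 0 t) ∧
  ((∀ᶠ s in 𝓝 t, Gam x s = {.x, .A, .B, .C, .D}) →
    OdeAt !₂[-1 / 2, -1 / 2] (3 / 2) (3 / 2) x t)

/-- The assumptions on a rotation path `x` and a critical angle `b`: smoothness, left-to-right
symmetry, the starting point of the contact path `A`, the three phases of the set of contact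
points (with at most one tangency point for each wall), and well-behavedness inside
each phase. -/
structure AmbiAssumptions (x : ℝ → Plane) (b : ℝ) : Prop where
  rotationPath : IsRotationPath x
  angle_pos : 0 < b
  angle_lt : b < π / 4
  contDiff : ContDiffOn ℝ 1 x (Icc 0 (π / 2))
  symmetric : ∀ t ∈ Icc (0 : ℝ) (π / 2),
    x (π / 2 - t) 0 = 2 * x (π / 4) 0 - x t 0 ∧ x (π / 2 - t) 1 = x t 1
  startA : contactSet x .A 0 = {!₂[1, 1 / 2]}
  unique_contact : ∀ t ∈ Ioo (0 : ℝ) (π / 2), ∀ k, (contactSet x k t).Subsingleton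
  phase_one : ∀ t, 0 < t → t < b → Gam x t = {.A, .C, .D}
  phase_two : ∀ t, b ≤ t → t ≤ π / 2 - b → Gam x t = {.x, .A, .B, .C, .D}
  phase_three : ∀ t, π / 2 - b < t → t < π / 2 → Gam x t = {.A, .B, .C}
  wellBehaved : ∀ t ∈ Ioo (0 : ℝ) (π / 2) \ {b, π / 2 - b}, WellBehaved x t

/-! ### The rotation path given in closed form -/

/-- The critical angle `β`. -/
def beta : ℝ :=
  arctan (1 / 2 * ((√2 + 1) ^ (1 / 3 : ℝ) - (√2 - 1) ^ (1 / 3 : ℝ)))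

/-- The radical that occurs in the parameter `a₁` and in the length. -/
def rad : ℝ := √(4 + (71 + 8 * √2) ^ (1 / 3 : ℝ) + (71 - 8 * √2) ^ (1 / 3 : ℝ))

/-- The parameter `a₁ = e₁` (while `a₂ = e₂ = 0`). -/
def a1 : ℝ := 1 / 4 * rad

def f1 : ℝ :=
  (83 + (420619 + 15104 * √2) ^ (1 / 3 : ℝ) + (420619 - 15104 * √2) ^ (1 / 3 : ℝ)) ^ (1 / 4 : ℝ) /
    (3 * √(2 * (2 - √2)))

def f2 : ℝ := -(√2 - 1) * f1

/-- The piece for angles below `β`. -/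
def x1 (t : ℝ) : Plane :=
  rot t !₂[a1 * cos t - 1, a1 * sin t - 1 / 2] + !₂[1 - a1, 1 / 2]

/-- The piece for angles between `β` and `π/2 - β`. -/
def x6 (t : ℝ) : Plane :=
  rot t !₂[f1 * cos (t / 2) + f2 * sin (t / 2) - 1, -f2 * cos (t / 2) + f1 * sin (t / 2) - 1] +
    !₂[1 - 4 / 3 * a1, 1 / 2]

/-- The piece for angles above `π/2 - β`. -/
def x5 (t : ℝ) : Plane :=
  rot t !₂[a1 * cos t - 1 / 2, a1 * sin t - 1] + !₂[1 - 5 / 3 * a1, 1 / 2]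

/-- The rotation path. -/
def ambiPath (t : ℝ) : Plane :=
  if t < beta then x1 t else if t ≤ π / 2 - beta then x6 t else x5 t

/-- The shape `Σ`. -/
def ambiShape : Set Plane := shape ambiPath ∩ rho '' shape ambiPath

end Sofa

end

open Sofa

noncomputable section

namespace Sofa

section

/-! ### Comparison lemmas on an interval -/

/-! Everything is expressed in the rotating frame. Write x' = u mu + v nu, and let `Kmu` and `Knu`
be the frame coordinates of a fixed point p at time s. Then Kmu' = Knu - u and Knu' = -Kmu - v.
Membership in the shape says that at every time both coordinates are at most 1 and not both are
negative, plus one lower bound at each end of the time interval. A wall touches the shape where its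
coordinate is extremal in time, so the contact points are A = x + mu + u nu, B = x + u nu, C = x - v
mu + nu, D = x - v mu. Moreover Kmu'' + Kmu = -(u' + v), so sign conditions on u' + v and v' - u
make Sturm comparison with g'' + g = 0 available. Through `Framed.Kmu_ge` and its three companions,
tangency at one time then gives an inequality at all times.

Uniqueness: the differential equations become linear systems for (u, v) (`Framed.odeAt_iff`), namely
rotation at speed 1 about (1/2, -1) in the first phase and at speed 1/2 about (1, -1) in the middle
phase. The start of A gives u(0) = 1/2, and the left-right symmetry gives u + v = 0 at π/4. The
missing condition u(b) = 0 is `AmbiAssumptions.velMu_critical`: if u(b) < 0, the corner would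
already touch the shape before b. Together they force 4 T^3 + 3 T = 1 for T = tan b, a cubic with
one real root.

Existence: Cardano's formula identifies β and all radicals with trigonometric functions of β and of
τ = β/2 + π/8. The explicit u and v satisfy the convexity conditions, so comparison places the
contact points in the shape; their signs decide which contacts exist.

The shape is vertically convex and the corner never rises above y = 1/2. Hence vertical slices of Σ
are intervals symmetric about 1/2, which gives connectedness. For the area, a slice is determined by
the corner, by B or by A; with contact time as integration variable the integrals have elementary
antiderivatives, and `area_pieces_sum` reduces their sum to a polynomial identity modulo the cubic.
The extreme points are the positions at which A and C rest in the first and in the last phase. -/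

lemma le_of_hasDerivAt_nonneg_off_finite {f : ℝ → ℝ} (S : Finset ℝ) :
    ∀ {a b : ℝ}, a ≤ b → ContinuousOn f (Icc a b) →
      (∀ x ∈ Ioo a b, x ∉ S → ∃ d, HasDerivAt f d x ∧ 0 ≤ d) → f a ≤ f b := by
  classical
  induction S using Finset.induction_on with
  | empty =>
    intro a b hab hf hd
    have hmono : MonotoneOn f (Icc a b) := by
      refine monotoneOn_of_deriv_nonneg (convex_Icc a b) hf ?_ ?_
      · rw [interior_Icc]
        intro x hx
        obtain ⟨d, h, _⟩ := hd x hx (by simp)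
        exact h.differentiableAt.differentiableWithinAt
      · rw [interior_Icc]
        intro x hx
        obtain ⟨d, h, h0⟩ := hd x hx (by simp)
        rwa [h.deriv]
    exact hmono (left_mem_Icc.2 hab) (right_mem_Icc.2 hab) hab
  | insert c S hc ih =>
    intro a b hab hf hd
    by_cases h : c ∈ Ioo a b
    · refine (ih h.1.le (hf.mono (Icc_subset_Icc_right h.2.le)) ?_).trans
        (ih h.2.le (hf.mono (Icc_subset_Icc_left h.1.le)) ?_)
      · intro x hx hxS
        exact hd x ⟨hx.1, hx.2.trans h.2⟩ (by simp [hxS, hx.2.ne])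
      · intro x hx hxS
        exact hd x ⟨h.1.trans hx.1, hx.2⟩ (by simp [hxS, hx.1.ne'])
    · refine ih hab hf fun x hx hxS => hd x hx ?_
      simp only [Finset.mem_insert, not_or]
      exact ⟨fun e => h (e ▸ hx), hxS⟩

lemma eq_of_hasDerivAt_zero_off_finite {f : ℝ → ℝ} (S : Finset ℝ) {a b : ℝ} (hab : a ≤ b)
    (hf : ContinuousOn f (Icc a b)) (hd : ∀ x ∈ Ioo a b, x ∉ S → HasDerivAt f 0 x) :
    f a = f b := by
  refine le_antisymm
    (le_of_hasDerivAt_nonneg_off_finite S hab hf fun x hx h => ⟨0, hd x hx h, le_rfl⟩) ?_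
  have := le_of_hasDerivAt_nonneg_off_finite (f := fun x => -f x) S hab hf.neg
    fun x hx h => ⟨0, (hd x hx h).neg.congr_deriv neg_zero, le_rfl⟩
  simpa using this

/-- Comparison with the solution of `g'' + g = 0` that has the same initial values. -/
lemma le_of_second_deriv_add_self_nonneg {f f' : ℝ → ℝ} (S : Finset ℝ) {a b : ℝ}
    (hab : b - a ≤ π) (hf : ContinuousOn f (Icc a b)) (hf' : ContinuousOn f' (Icc a b))
    (hd : ∀ x ∈ Ioo a b, HasDerivAt f (f' x) x)
    (hdd : ∀ x ∈ Ioo a b, x ∉ S → ∃ d, HasDerivAt f' d x ∧ 0 ≤ d + f x)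
    {t s : ℝ} (ht : t ∈ Icc a b) (hs : s ∈ Icc a b) :
    f t * cos (s - t) + f' t * sin (s - t) ≤ f s := by
  -- As a function of r, the expression equals the left side at r = t and f s at r = s. Its
  -- derivative is (f'' + f) sin(s - r), and b - a ≤ π fixes the sign of the sine.
  have hder : ∀ x ∈ Ioo a b, x ∉ S → ∃ d, 0 ≤ d ∧
      HasDerivAt (fun r => f r * cos (s - r) + f' r * sin (s - r)) (d * sin (s - x)) x := by
    intro x hx hxS
    obtain ⟨d, h1, h2⟩ := hdd x hx hxS
    refine ⟨d + f x, h2, ?_⟩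
    have hc : HasDerivAt (fun r => cos (s - r)) (sin (s - x)) x := by
      simpa using ((hasDerivAt_id x).const_sub s).cos
    have hsn : HasDerivAt (fun r => sin (s - r)) (-cos (s - x)) x := by
      simpa using ((hasDerivAt_id x).const_sub s).sin
    exact (((hd x hx).mul hc).add (h1.mul hsn)).congr_deriv (by ring)
  have hcont : ContinuousOn (fun r => f r * cos (s - r) + f' r * sin (s - r)) (Icc a b) := by
    fun_prop
  rcases le_total t s with hts | hst
  · have := le_of_hasDerivAt_nonneg_off_finite S hts
      (hcont.mono (Icc_subset_Icc ht.1 hs.2)) (fun x hx hxS => by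
        obtain ⟨d, h0, h⟩ := hder x ⟨ht.1.trans_lt hx.1, hx.2.trans_le hs.2⟩ hxS
        refine ⟨_, h, mul_nonneg h0 (sin_nonneg_of_nonneg_of_le_pi ?_ ?_)⟩ <;>
          linarith [hx.1, hx.2, ht.1, hs.2])
    simpa using this
  · have := le_of_hasDerivAt_nonneg_off_finite
      (f := fun r => -(f r * cos (s - r) + f' r * sin (s - r))) S hst
      ((hcont.mono (Icc_subset_Icc hs.1 ht.2)).neg) (fun x hx hxS => by
        obtain ⟨d, h0, h⟩ := hder x ⟨hs.1.trans_lt hx.1, hx.2.trans_le ht.2⟩ hxS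
        refine ⟨_, h.neg, ?_⟩
        have : sin (s - x) ≤ 0 := by
          apply sin_nonpos_of_nonpos_of_neg_pi_le <;> linarith [hx.1, hx.2, hs.1, ht.2]
        nlinarith)
    simp at this
    linarith

/-! ### Frame coordinates and the shape -/

/-- The coordinate of `p - x s` along `mu s`. -/
def Kmu (x : ℝ → Plane) (p : Plane) (s : ℝ) : ℝ :=
  (p 0 - x s 0) * cos s + (p 1 - x s 1) * sin s

/-- The coordinate of `p - x s` along `nu s`. -/
def Knu (x : ℝ → Plane) (p : Plane) (s : ℝ) : ℝ :=
  -(p 0 - x s 0) * sin s + (p 1 - x s 1) * cos s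

lemma inner_mu (x : ℝ → Plane) (p : Plane) (s : ℝ) : inner ℝ (p - x s) (mu s) = Kmu x p s := by
  simp [Kmu, mu, PiLp.inner_apply, Fin.sum_univ_two]; ring

lemma inner_nu (x : ℝ → Plane) (p : Plane) (s : ℝ) : inner ℝ (p - x s) (nu s) = Knu x p s := by
  simp [Knu, nu, PiLp.inner_apply, Fin.sum_univ_two]; ring

lemma plane_ext {p q : Plane} (h0 : p 0 = q 0) (h1 : p 1 = q 1) : p = q := by
  ext i; fin_cases i <;> assumption

lemma frame_ext {x : ℝ → Plane} {p q : Plane} {s : ℝ} (h0 : Kmu x p s = Kmu x q s)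
    (h1 : Knu x p s = Knu x q s) : p = q := by
  unfold Kmu Knu at *
  have := sin_sq_add_cos_sq s
  apply plane_ext
  · linear_combination cos s * h0 - sin s * h1 + (q 0 - p 0) * this
  · linear_combination sin s * h0 + cos s * h1 + (q 1 - p 1) * this

lemma mem_placed {x : ℝ → Plane} {t : ℝ} {H : Set Plane} {p : Plane} :
    p ∈ placed x t H ↔ !₂[Kmu x p t, Knu x p t] ∈ H := by
  have h := sin_sq_add_cos_sq t
  constructor
  · rintro ⟨q, hq, rfl⟩
    have : !₂[Kmu x (x t + rot t q) t, Knu x (x t + rot t q) t] = q := by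
      apply plane_ext <;> simp [Kmu, Knu, rot]
      · linear_combination q 0 * h
      · linear_combination q 1 * h
    exact (congrArg (· ∈ H) this).mpr hq
  · intro hq
    refine ⟨_, hq, ?_⟩
    apply plane_ext <;> simp [Kmu, Knu, rot]
    · linear_combination (p 0 - x t 0) * h
    · linear_combination (p 1 - x t 1) * h

lemma mem_L {p : Plane} : p ∈ L ↔ p 0 ≤ 1 ∧ p 1 ≤ 1 ∧ (0 ≤ p 0 ∨ 0 ≤ p 1) := by
  simp only [L, Lhoriz, Lvert, mem_union, mem_ofPred_eq]
  constructor
  · rintro (⟨h1, h2, h3⟩ | ⟨h1, h2, h3⟩) <;> tauto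
  · rintro ⟨h1, h2, h3 | h3⟩ <;> tauto

/-- The outer bounds of the two arms are those of the hallway at times 0 and π/2, so each arm adds
just one lower bound. -/
lemma mem_shape {x : ℝ → Plane} (hx : x 0 = 0) {p : Plane} :
    p ∈ shape x ↔ 0 ≤ Knu x p 0 ∧ 0 ≤ Kmu x p (π / 2) ∧ ∀ s ∈ Icc (0 : ℝ) (π / 2),
      Kmu x p s ≤ 1 ∧ Knu x p s ≤ 1 ∧ (0 ≤ Kmu x p s ∨ 0 ≤ Knu x p s) := by
  simp only [shape, mem_inter_iff, mem_iInter, mem_placed, mem_L]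
  simp only [Lhoriz, Lvert, mem_ofPred_eq]
  have e0 : Knu x p 0 = p 1 := by simp [Knu, hx]
  have e1 : Kmu x p 0 = p 0 := by simp [Kmu, hx]
  have hpi := pi_pos
  constructor
  · rintro ⟨⟨⟨a, b, c⟩, h⟩, d, e, f⟩
    refine ⟨e0 ▸ b, e, fun s hs => ?_⟩
    simpa using h s hs
  · rintro ⟨a, b, h⟩
    have h0 := h 0 ⟨le_rfl, by positivity⟩
    have h1 := h (π / 2) ⟨by positivity, le_rfl⟩
    rw [e0] at a h0
    rw [e1] at h0
    refine ⟨⟨⟨h0.1, a, h0.2.1⟩, fun s hs => by simpa using h s hs⟩, ?_, ?_, ?_⟩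
    · simpa using h1.2.1
    · simpa using b
    · simpa using h1.1

lemma continuous_Kmu_left (x : ℝ → Plane) (s : ℝ) : Continuous fun p => Kmu x p s := by
  unfold Kmu; fun_prop

lemma continuous_Knu_left (x : ℝ → Plane) (s : ℝ) : Continuous fun p => Knu x p s := by
  unfold Knu; fun_prop

lemma isClosed_shape {x : ℝ → Plane} (hx : x 0 = 0) : IsClosed (shape x) := by
  have : shape x = {p | 0 ≤ Knu x p 0} ∩ ({p | 0 ≤ Kmu x p (π / 2)} ∩
      ⋂ s ∈ Icc (0 : ℝ) (π / 2), ({p | Kmu x p s ≤ 1} ∩ ({p | Knu x p s ≤ 1} ∩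
        ({p | 0 ≤ Kmu x p s} ∪ {p | 0 ≤ Knu x p s})))) := by
    ext p
    rw [mem_shape hx]
    simp
  rw [this]
  refine (isClosed_le continuous_const (continuous_Knu_left x 0)).inter
    ((isClosed_le continuous_const (continuous_Kmu_left x _)).inter
    (isClosed_biInter fun s _ => ?_))
  exact (isClosed_le (continuous_Kmu_left x s) continuous_const).inter
    ((isClosed_le (continuous_Knu_left x s) continuous_const).inter
    ((isClosed_le continuous_const (continuous_Kmu_left x s)).union
      (isClosed_le continuous_const (continuous_Knu_left x s))))

/-! ### Paths with a continuous derivative given in the rotating frame -/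

/-- The path `x` starts at the origin and has the derivative `u t • mu t + v t • nu t`, with
continuous components `u`, `v`. -/
structure Framed (x : ℝ → Plane) (u v : ℝ → ℝ) : Prop where
  start : x 0 = 0
  cont : ContinuousOn x (Icc 0 (π / 2))
  cont_u : ContinuousOn u (Icc 0 (π / 2))
  cont_v : ContinuousOn v (Icc 0 (π / 2))
  deriv0 : ∀ t ∈ Ioo (0 : ℝ) (π / 2),
    HasDerivAt (fun s => x s 0) (u t * cos t - v t * sin t) t
  deriv1 : ∀ t ∈ Ioo (0 : ℝ) (π / 2),
    HasDerivAt (fun s => x s 1) (u t * sin t + v t * cos t) t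

variable {x : ℝ → Plane} {u v : ℝ → ℝ}

lemma Framed.cont0 (h : Framed x u v) : ContinuousOn (fun s => x s 0) (Icc 0 (π / 2)) := by
  have := h.cont
  fun_prop

lemma Framed.cont1 (h : Framed x u v) : ContinuousOn (fun s => x s 1) (Icc 0 (π / 2)) := by
  have := h.cont
  fun_prop

lemma Framed.continuousOn_Kmu (h : Framed x u v) (p : Plane) :
    ContinuousOn (Kmu x p) (Icc 0 (π / 2)) := by
  have h0 := h.cont0
  have h1 := h.cont1
  unfold Kmu; fun_prop

lemma Framed.continuousOn_Knu (h : Framed x u v) (p : Plane) :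
    ContinuousOn (Knu x p) (Icc 0 (π / 2)) := by
  have h0 := h.cont0
  have h1 := h.cont1
  unfold Knu; fun_prop

/-- The turning of the frame contributes the other coordinate, the motion of the origin contributes
-u. Together with `Framed.hasDerivAt_Knu` this yields Kmu'' + Kmu = -(u' + v). -/
lemma Framed.hasDerivAt_Kmu (h : Framed x u v) (p : Plane) {t : ℝ} (ht : t ∈ Ioo 0 (π / 2)) :
    HasDerivAt (Kmu x p) (Knu x p t - u t) t := by
  have h0 := ((h.deriv0 t ht).const_sub (p 0)).mul (hasDerivAt_cos t)
  have h1 := ((h.deriv1 t ht).const_sub (p 1)).mul (hasDerivAt_sin t)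
  refine (h0.add h1).congr_deriv ?_
  unfold Knu
  linear_combination (-u t) * sin_sq_add_cos_sq t

lemma Framed.hasDerivAt_Knu (h : Framed x u v) (p : Plane) {t : ℝ} (ht : t ∈ Ioo 0 (π / 2)) :
    HasDerivAt (Knu x p) (-Kmu x p t - v t) t := by
  have h0 := ((h.deriv0 t ht).const_sub (p 0)).neg.mul (hasDerivAt_sin t)
  have h1 := ((h.deriv1 t ht).const_sub (p 1)).mul (hasDerivAt_cos t)
  refine (h0.add h1).congr_deriv ?_
  simp only [Kmu, Pi.neg_apply]
  linear_combination (-v t) * sin_sq_add_cos_sq t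

/-- The derivative bounds expressing that the inner walls have convex envelopes. -/
structure InnerConvex (u v : ℝ → ℝ) (S : Finset ℝ) : Prop where
  mu_le : ∀ t ∈ Ioo (0 : ℝ) (π / 2), t ∉ S → ∃ d, HasDerivAt u d t ∧ d + v t ≤ 0
  nu_le : ∀ t ∈ Ioo (0 : ℝ) (π / 2), t ∉ S → ∃ d, HasDerivAt v d t ∧ d - u t ≤ 0

/-- The derivative bounds expressing that the outer walls have convex envelopes. -/
structure OuterConvex (u v : ℝ → ℝ) (S : Finset ℝ) : Prop where
  mu_ge : ∀ t ∈ Ioo (0 : ℝ) (π / 2), t ∉ S → ∃ d, HasDerivAt u d t ∧ -1 ≤ d + v t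
  nu_ge : ∀ t ∈ Ioo (0 : ℝ) (π / 2), t ∉ S → ∃ d, HasDerivAt v d t ∧ -1 ≤ d - u t

/-- `InnerConvex` says Kmu'' + Kmu ≥ 0 off finitely many times, so comparison turns data at one time
t into a bound at every time s. -/
lemma Framed.Kmu_ge (h : Framed x u v) {S : Finset ℝ} (hc : InnerConvex u v S) (p : Plane)
    {t s : ℝ} (ht : t ∈ Icc 0 (π / 2)) (hs : s ∈ Icc 0 (π / 2)) :
    Kmu x p t * cos (s - t) + (Knu x p t - u t) * sin (s - t) ≤ Kmu x p s := by
  refine le_of_second_deriv_add_self_nonneg (f' := fun t => Knu x p t - u t) S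
    (by linarith [pi_pos]) (h.continuousOn_Kmu p)
    ((h.continuousOn_Knu p).sub h.cont_u) (fun r hr => h.hasDerivAt_Kmu p hr) ?_ ht hs
  intro r hr hrS
  obtain ⟨d, hd, hle⟩ := hc.mu_le r hr hrS
  exact ⟨_, (h.hasDerivAt_Knu p hr).sub hd, by linarith⟩

lemma Framed.Knu_ge (h : Framed x u v) {S : Finset ℝ} (hc : InnerConvex u v S) (p : Plane)
    {t s : ℝ} (ht : t ∈ Icc 0 (π / 2)) (hs : s ∈ Icc 0 (π / 2)) :
    Knu x p t * cos (s - t) + (-Kmu x p t - v t) * sin (s - t) ≤ Knu x p s := by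
  refine le_of_second_deriv_add_self_nonneg (f' := fun t => -Kmu x p t - v t) S
    (by linarith [pi_pos]) (h.continuousOn_Knu p)
    ((h.continuousOn_Kmu p).neg.sub h.cont_v) (fun r hr => h.hasDerivAt_Knu p hr) ?_ ht hs
  intro r hr hrS
  obtain ⟨d, hd, hle⟩ := hc.nu_le r hr hrS
  exact ⟨_, (h.hasDerivAt_Kmu p hr).neg.sub hd, by linarith⟩

/-- For the distance 1 - Kmu to the outer wall, second derivative plus value is 1 + u' + v, which is
nonnegative by `OuterConvex`. -/
lemma Framed.Kmu_le (h : Framed x u v) {S : Finset ℝ} (hc : OuterConvex u v S) (p : Plane)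
    {t s : ℝ} (ht : t ∈ Icc 0 (π / 2)) (hs : s ∈ Icc 0 (π / 2)) :
    (1 - Kmu x p t) * cos (s - t) + (u t - Knu x p t) * sin (s - t) ≤ 1 - Kmu x p s := by
  refine le_of_second_deriv_add_self_nonneg (f := fun t => 1 - Kmu x p t)
    (f' := fun t => u t - Knu x p t) S
    (by linarith [pi_pos]) (continuousOn_const.sub (h.continuousOn_Kmu p))
    (h.cont_u.sub (h.continuousOn_Knu p)) (fun r hr => ?_) ?_ ht hs
  · simpa using (h.hasDerivAt_Kmu p hr).const_sub 1
  intro r hr hrS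
  obtain ⟨d, hd, hle⟩ := hc.mu_ge r hr hrS
  exact ⟨_, hd.sub (h.hasDerivAt_Knu p hr), by linarith⟩

lemma Framed.Knu_le (h : Framed x u v) {S : Finset ℝ} (hc : OuterConvex u v S) (p : Plane)
    {t s : ℝ} (ht : t ∈ Icc 0 (π / 2)) (hs : s ∈ Icc 0 (π / 2)) :
    (1 - Knu x p t) * cos (s - t) + (Kmu x p t + v t) * sin (s - t) ≤ 1 - Knu x p s := by
  refine le_of_second_deriv_add_self_nonneg (f := fun t => 1 - Knu x p t)
    (f' := fun t => Kmu x p t + v t) S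
    (by linarith [pi_pos]) (continuousOn_const.sub (h.continuousOn_Knu p))
    ((h.continuousOn_Kmu p).add h.cont_v) (fun r hr => ?_) ?_ ht hs
  · exact ((h.hasDerivAt_Knu p hr).const_sub 1).congr_deriv (by ring)
  intro r hr hrS
  obtain ⟨d, hd, hle⟩ := hc.nu_ge r hr hrS
  exact ⟨_, (h.hasDerivAt_Kmu p hr).add hd, by linarith⟩

/-! ### Contact points -/

/-- The frame coordinate along `mu` of the contact point of a given type. -/
def offMu (v : ℝ → ℝ) : Contact → ℝ → ℝ
  | .x, _ => 0
  | .A, _ => 1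
  | .B, _ => 0
  | .C, t => -v t
  | .D, t => -v t

/-- The frame coordinate along `nu` of the contact point of a given type. -/
def offNu (u : ℝ → ℝ) : Contact → ℝ → ℝ
  | .x, _ => 0
  | .A, t => u t
  | .B, t => u t
  | .C, _ => 1
  | .D, _ => 0

/-- The point at which the walls of the hallway touch their envelope. -/
def touch (x : ℝ → Plane) (u v : ℝ → ℝ) (k : Contact) (t : ℝ) : Plane :=
  !₂[x t 0 + offMu v k t * cos t - offNu u k t * sin t,
    x t 1 + offMu v k t * sin t + offNu u k t * cos t]

lemma Kmu_touch (k : Contact) (t : ℝ) : Kmu x (touch x u v k t) t = offMu v k t := by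
  simp [Kmu, touch]
  linear_combination offMu v k t * sin_sq_add_cos_sq t

lemma Knu_touch (k : Contact) (t : ℝ) : Knu x (touch x u v k t) t = offNu u k t := by
  simp [Knu, touch]
  linear_combination offNu u k t * sin_sq_add_cos_sq t

lemma eq_touch {k : Contact} {t : ℝ} {p : Plane} (h0 : Kmu x p t = offMu v k t)
    (h1 : Knu x p t = offNu u k t) : p = touch x u v k t :=
  frame_ext (x := x) (s := t) (by rw [h0, Kmu_touch]) (by rw [h1, Knu_touch])

lemma touch_x (t : ℝ) : touch x u v .x t = x t := by
  apply plane_ext <;> simp [touch, offMu, offNu]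

lemma mem_wall {k : Contact} {t : ℝ} {p : Plane} : p ∈ wall x k t ↔
    match k with
    | .x => p = x t
    | .A => Kmu x p t = 1 ∧ Knu x p t ≤ 1
    | .B => Kmu x p t = 0 ∧ Knu x p t < 0
    | .C => Knu x p t = 1 ∧ Kmu x p t ≤ 1
    | .D => Knu x p t = 0 ∧ Kmu x p t < 0 := by
  cases k <;> simp [wall, inner_mu, inner_nu]

/-- Fermat's criterion: a point of the shape lying on a wall at time t has an extremal frame
coordinate there, and the vanishing derivative determines the other coordinate. -/
lemma Framed.eq_touch_of_mem (h : Framed x u v) {k : Contact} {t : ℝ} (ht : t ∈ Ioo 0 (π / 2))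
    {p : Plane} (hp : p ∈ shape x) (hw : p ∈ wall x k t) : p = touch x u v k t := by
  obtain ⟨-, -, hS⟩ := (mem_shape h.start).1 hp
  rw [mem_wall] at hw
  have hI : Ioo 0 (π / 2) ∈ 𝓝 t := Ioo_mem_nhds ht.1 ht.2
  have hcm := (h.hasDerivAt_Kmu p ht).continuousAt
  have hcn := (h.hasDerivAt_Knu p ht).continuousAt
  cases k with
  | x => rw [touch_x]; exact hw
  | A =>
    have hmax : IsLocalMax (Kmu x p) t := by
      filter_upwards [hI] with s hs
      rw [hw.1]; exact (hS s (Ioo_subset_Icc_self hs)).1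
    have := hmax.hasDerivAt_eq_zero (h.hasDerivAt_Kmu p ht)
    exact eq_touch hw.1 (by simp [offNu]; linarith)
  | B =>
    have hmin : IsLocalMin (Kmu x p) t := by
      -- Away from the corner `Knu` stays negative for nearby times, so the alternative in the inner
      -- condition is decided in favour of `Kmu`.
      filter_upwards [hI, hcn.eventually_lt continuousAt_const hw.2] with s hs hneg
      rw [hw.1]
      exact (hS s (Ioo_subset_Icc_self hs)).2.2.resolve_right (not_le.2 hneg)
    have := hmin.hasDerivAt_eq_zero (h.hasDerivAt_Kmu p ht)
    exact eq_touch hw.1 (by simp [offNu]; linarith)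
  | C =>
    have hmax : IsLocalMax (Knu x p) t := by
      filter_upwards [hI] with s hs
      rw [hw.1]; exact (hS s (Ioo_subset_Icc_self hs)).2.1
    have := hmax.hasDerivAt_eq_zero (h.hasDerivAt_Knu p ht)
    exact eq_touch (by simp [offMu]; linarith) hw.1
  | D =>
    have hmin : IsLocalMin (Knu x p) t := by
      filter_upwards [hI, hcm.eventually_lt continuousAt_const hw.2] with s hs hneg
      rw [hw.1]
      exact (hS s (Ioo_subset_Icc_self hs)).2.2.resolve_left (not_le.2 hneg)
    have := hmin.hasDerivAt_eq_zero (h.hasDerivAt_Knu p ht)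
    exact eq_touch (by simp [offMu]; linarith) hw.1

lemma Framed.continuousOn_offMu (h : Framed x u v) (k : Contact) :
    ContinuousOn (offMu v k) (Icc 0 (π / 2)) := by
  have := h.cont_v
  cases k
  · exact continuousOn_const
  · exact continuousOn_const
  · exact continuousOn_const
  · exact this.neg
  · exact this.neg

lemma Framed.continuousOn_offNu (h : Framed x u v) (k : Contact) :
    ContinuousOn (offNu u k) (Icc 0 (π / 2)) := by
  have := h.cont_u
  cases k
  · exact continuousOn_const
  · exact this
  · exact this
  · exact continuousOn_const
  · exact continuousOn_const

lemma continuousOn_plane {f : ℝ → Plane} {s : Set ℝ} (h0 : ContinuousOn (fun t => f t 0) s)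
    (h1 : ContinuousOn (fun t => f t 1) s) : ContinuousOn f s := by
  have : f = fun t => WithLp.toLp 2 (fun i => f t i) := by ext; rfl
  rw [this]
  refine (PiLp.continuous_toLp 2 _).comp_continuousOn (continuousOn_pi.2 fun i => ?_)
  fin_cases i
  · exact h0
  · exact h1

lemma Framed.continuousOn_touch (h : Framed x u v) (k : Contact) :
    ContinuousOn (touch x u v k) (Icc 0 (π / 2)) := by
  have h0 := h.cont0
  have h1 := h.cont1
  have h2 := h.continuousOn_offMu k
  have h3 := h.continuousOn_offNu k
  apply continuousOn_plane <;> simp only [touch, PiLp.toLp_apply, Matrix.cons_val_zero,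
    Matrix.cons_val_one] <;> fun_prop

/-- A contact point at time `t` is the limit of touching points at earlier or later times. -/
lemma Framed.contactSet_spec (h : Framed x u v) {k : Contact} {t : ℝ} {p : Plane}
    (hp : p ∈ contactSet x k t) :
    t ∈ Icc 0 (π / 2) ∧ p = touch x u v k t ∧ p ∈ shape x ∧
      ∃ τ : ℕ → ℝ, Tendsto τ atTop (𝓝[Icc 0 (π / 2)] t) ∧ ∀ n, τ n ∈ Ioo 0 (π / 2) ∧
        touch x u v k (τ n) ∈ shape x ∧ touch x u v k (τ n) ∈ wall x k (τ n) := by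
  obtain ⟨q, hq, hlim⟩ := mem_closure_iff_seq_limit.1 hp
  have h1 : Tendsto (fun n => (q n).1) atTop (𝓝 t) := (continuous_fst.tendsto _).comp hlim
  have h2 : Tendsto (fun n => (q n).2) atTop (𝓝 p) := (continuous_snd.tendsto _).comp hlim
  have ht : t ∈ Icc 0 (π / 2) :=
    isClosed_Icc.mem_of_tendsto h1 (Eventually.of_forall fun n => Ioo_subset_Icc_self (hq n).1)
  have h3 : Tendsto (fun n => (q n).1) atTop (𝓝[Icc 0 (π / 2)] t) :=
    tendsto_nhdsWithin_iff.2
      ⟨h1, Eventually.of_forall fun n => Ioo_subset_Icc_self (hq n).1⟩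
  have he : ∀ n, (q n).2 = touch x u v k (q n).1 := fun n =>
    h.eq_touch_of_mem (hq n).1 (hq n).2.1 (hq n).2.2
  refine ⟨ht, ?_, (isClosed_shape h.start).mem_of_tendsto h2
    (Eventually.of_forall fun n => (hq n).2.1), fun n => (q n).1, h3, fun n => ?_⟩
  · refine tendsto_nhds_unique h2 ?_
    simp_rw [he]
    exact (h.continuousOn_touch k t ht).tendsto.comp h3
  · rw [← he]; exact hq n

lemma mem_contactSet {k : Contact} {t : ℝ} {p : Plane} (ht : t ∈ Ioo 0 (π / 2))
    (hp : p ∈ shape x) (hw : p ∈ wall x k t) : p ∈ contactSet x k t :=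
  subset_closure ⟨ht, hp, hw⟩

/-- Contact points at the limit of a sequence of times. -/
lemma Framed.touch_mem_contactSet (h : Framed x u v) {k : Contact} {t : ℝ}
    (ht : t ∈ Icc 0 (π / 2)) {T : Set ℝ} (hT : t ∈ closure T) (hTI : T ⊆ Ioo 0 (π / 2))
    (hmem : ∀ s ∈ T, touch x u v k s ∈ shape x ∧ touch x u v k s ∈ wall x k s) :
    touch x u v k t ∈ contactSet x k t := by
  obtain ⟨τ, hτ, hlim⟩ := mem_closure_iff_seq_limit.1 hT
  refine mem_closure_iff_seq_limit.2 ⟨fun n => (τ n, touch x u v k (τ n)), fun n =>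
    ⟨hTI (hτ n), (hmem _ (hτ n)).1, (hmem _ (hτ n)).2⟩, ?_⟩
  refine hlim.prodMk_nhds ((h.continuousOn_touch k t ht).tendsto.comp ?_)
  exact tendsto_nhdsWithin_iff.2
    ⟨hlim, Eventually.of_forall fun n => Ioo_subset_Icc_self (hTI (hτ n))⟩

lemma Framed.contactSet_subsingleton (h : Framed x u v) (k : Contact) (t : ℝ) :
    (contactSet x k t).Subsingleton := fun p hp q hq => by
  rw [(h.contactSet_spec hp).2.1, (h.contactSet_spec hq).2.1]

lemma Framed.touch_mem_of_gam (h : Framed x u v) {k : Contact} {t : ℝ} (hk : k ∈ Gam x t) :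
    touch x u v k t ∈ contactSet x k t := by
  obtain ⟨p, hp⟩ := hk
  rwa [(h.contactSet_spec hp).2.1] at hp

lemma Framed.touch_mem_shape (h : Framed x u v) {k : Contact} {t : ℝ} (hk : k ∈ Gam x t) :
    touch x u v k t ∈ shape x :=
  (h.contactSet_spec (h.touch_mem_of_gam hk)).2.2.1

lemma Framed.contactPath_eq (h : Framed x u v) {k : Contact} {t : ℝ} (hk : k ∈ Gam x t) :
    contactPath x k t = touch x u v k t :=
  (h.contactSet_spec (Classical.epsilon_spec hk)).2.1

/-- A tangency point of the open inner wall has nu-coordinate u < 0, and limits keep the weak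
inequality. This reads the sign of a velocity off the set of contacts. -/
lemma Framed.u_nonpos_of_gam (h : Framed x u v) {t : ℝ} (hk : Contact.B ∈ Gam x t) : u t ≤ 0 := by
  obtain ⟨ht, -, -, τ, hτ, hmem⟩ := h.contactSet_spec (h.touch_mem_of_gam hk)
  refine le_of_tendsto ((h.cont_u t ht).tendsto.comp hτ) (Eventually.of_forall fun n => ?_)
  have := (mem_wall.1 (hmem n).2.2).2
  rw [Knu_touch] at this
  exact this.le

lemma Framed.v_nonneg_of_gam (h : Framed x u v) {t : ℝ} (hk : Contact.D ∈ Gam x t) : 0 ≤ v t := by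
  obtain ⟨ht, -, -, τ, hτ, hmem⟩ := h.contactSet_spec (h.touch_mem_of_gam hk)
  refine ge_of_tendsto ((h.cont_v t ht).tendsto.comp hτ) (Eventually.of_forall fun n => ?_)
  have := (mem_wall.1 (hmem n).2.2).2
  rw [Kmu_touch] at this
  have : -v (τ n) < 0 := this
  show 0 ≤ v (τ n)
  linarith

end

section

/-! ### Derivatives of paths and contact paths in the rotating frame -/

lemma hasDerivAt_plane {f : ℝ → Plane} {d : Plane} {t : ℝ} : HasDerivAt f d t ↔
    HasDerivAt (fun s => f s 0) (d 0) t ∧ HasDerivAt (fun s => f s 1) (d 1) t := by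
  simp only [hasDerivAt_iff_hasFDerivAt, ← hasFDerivWithinAt_univ, hasFDerivWithinAt_euclidean,
    Fin.forall_fin_two]
  constructor
  · rintro ⟨h0, h1⟩
    exact ⟨h0.congr_fderiv (by ext; simp), h1.congr_fderiv (by ext; simp)⟩
  · rintro ⟨h0, h1⟩
    exact ⟨h0.congr_fderiv (by ext; simp), h1.congr_fderiv (by ext; simp)⟩

variable {x : ℝ → Plane} {u v : ℝ → ℝ}

lemma Framed.hasDerivAt (h : Framed x u v) {t : ℝ} (ht : t ∈ Ioo 0 (π / 2)) :
    HasDerivAt x !₂[u t * cos t - v t * sin t, u t * sin t + v t * cos t] t :=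
  hasDerivAt_plane.2 ⟨by simpa using h.deriv0 t ht, by simpa using h.deriv1 t ht⟩

lemma Framed.deriv_eventuallyEq (h : Framed x u v) {t : ℝ} (ht : t ∈ Ioo 0 (π / 2)) :
    deriv x =ᶠ[𝓝 t] fun t => !₂[u t * cos t - v t * sin t, u t * sin t + v t * cos t] := by
  filter_upwards [Ioo_mem_nhds ht.1 ht.2] with s hs
  exact (h.hasDerivAt hs).deriv

lemma Framed.inner_deriv_mu (h : Framed x u v) {t : ℝ} (ht : t ∈ Ioo 0 (π / 2)) :
    inner ℝ (deriv x t) (mu t) = u t := by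
  rw [(h.hasDerivAt ht).deriv]
  simp [mu, PiLp.inner_apply, Fin.sum_univ_two]
  linear_combination u t * sin_sq_add_cos_sq t

lemma Framed.inner_deriv_nu (h : Framed x u v) {t : ℝ} (ht : t ∈ Ioo 0 (π / 2)) :
    inner ℝ (deriv x t) (nu t) = v t := by
  rw [(h.hasDerivAt ht).deriv]
  simp [nu, PiLp.inner_apply, Fin.sum_univ_two]
  linear_combination v t * sin_sq_add_cos_sq t

lemma Framed.exists_hasDerivAt (h : Framed x u v) {t : ℝ} (ht : t ∈ Ioo 0 (π / 2))
    (hx : ContDiffAt ℝ 2 x t) : ∃ du dv, HasDerivAt u du t ∧ HasDerivAt v dv t := by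
  have hd : DifferentiableAt ℝ (deriv x) t :=
    (hx.derivWithin (m := 1) (by norm_num)).differentiableAt (by norm_num)
  have h01 := hasDerivAt_plane.1 hd.hasDerivAt
  obtain ⟨h0, h1⟩ := h01
  have hu : u =ᶠ[𝓝 t] fun s => deriv x s 0 * cos s + deriv x s 1 * sin s := by
    filter_upwards [Ioo_mem_nhds ht.1 ht.2] with s hs
    rw [(h.hasDerivAt hs).deriv]
    simp
    linear_combination -u s * sin_sq_add_cos_sq s
  have hv : v =ᶠ[𝓝 t] fun s => -deriv x s 0 * sin s + deriv x s 1 * cos s := by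
    filter_upwards [Ioo_mem_nhds ht.1 ht.2] with s hs
    rw [(h.hasDerivAt hs).deriv]
    simp
    linear_combination -v s * sin_sq_add_cos_sq s
  exact ⟨_, _, ((h0.mul (hasDerivAt_cos t)).add (h1.mul (hasDerivAt_sin t))).congr_of_eventuallyEq
    hu, ((h0.neg.mul (hasDerivAt_sin t)).add (h1.mul (hasDerivAt_cos t))).congr_of_eventuallyEq hv⟩

/-- In the frame, x'' has components u' - v and v' + u, while the matrix term has components -p v
and q u. The equation thus becomes a linear system with constant coefficients. -/
lemma Framed.odeAt_iff (h : Framed x u v) {t : ℝ} (ht : t ∈ Ioo 0 (π / 2)) {du dv : ℝ}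
    (hu : HasDerivAt u du t) (hv : HasDerivAt v dv t) {a b p q : ℝ} :
    OdeAt !₂[a, b] p q x t ↔ du = a - (p - 1) * v t ∧ dv = b + (q - 1) * u t := by
  have h0 := (hu.mul (hasDerivAt_cos t)).sub (hv.mul (hasDerivAt_sin t))
  have h1 := (hu.mul (hasDerivAt_sin t)).add (hv.mul (hasDerivAt_cos t))
  have hdd : HasDerivAt (deriv x) !₂[(du - v t) * cos t - (dv + u t) * sin t,
      (du - v t) * sin t + (dv + u t) * cos t] t := by
    refine HasDerivAt.congr_of_eventuallyEq ?_ (h.deriv_eventuallyEq ht)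
    refine hasDerivAt_plane.2 ⟨?_, ?_⟩
    · exact h0.congr_deriv (by simp; ring)
    · exact h1.congr_deriv (by simp; ring)
  have hsc := sin_sq_add_cos_sq t
  unfold OdeAt
  rw [hdd.deriv, (h.hasDerivAt ht).deriv]
  have k1 : sin t * (u t * cos t - v t * sin t) - cos t * (u t * sin t + v t * cos t) = -v t := by
    linear_combination -v t * hsc
  have k2 : cos t * (u t * cos t - v t * sin t) + sin t * (u t * sin t + v t * cos t) = u t := by
    linear_combination u t * hsc
  constructor
  · intro e
    have e0 := congrArg (fun p : Plane => p 0) e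
    have e1 := congrArg (fun p : Plane => p 1) e
    simp [rot, k1, k2] at e0 e1
    constructor
    · linear_combination cos t * e0 + sin t * e1 - (du - v t - a + p * v t) * hsc
    · linear_combination -sin t * e0 + cos t * e1 - (dv + u t - b - q * u t) * hsc
  · rintro ⟨rfl, rfl⟩
    apply plane_ext <;> simp [rot, k1, k2] <;> ring

/-! ### Derivatives of the contact paths -/

/-- A tangency point moves along its wall. Its scalar speed is one of the quantities bounded in
`InnerConvex` and `OuterConvex`, up to sign for C and D, so these structures encode the
well-behavedness of A, B, C, D. -/
lemma Framed.hasDerivAt_touch_A (h : Framed x u v) {t : ℝ} (ht : t ∈ Ioo 0 (π / 2)) {du : ℝ}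
    (hu : HasDerivAt u du t) : HasDerivAt (touch x u v .A) ((1 + du + v t) • nu t) t := by
  refine hasDerivAt_plane.2 ⟨?_, ?_⟩ <;> simp only [touch, offMu, offNu, nu, PiLp.smul_apply,
    PiLp.toLp_apply, Matrix.cons_val_zero, Matrix.cons_val_one, smul_eq_mul]
  · exact (((h.deriv0 t ht).add ((hasDerivAt_cos t).const_mul 1)).sub
      (hu.mul (hasDerivAt_sin t))).congr_deriv (by ring)
  · exact (((h.deriv1 t ht).add ((hasDerivAt_sin t).const_mul 1)).add
      (hu.mul (hasDerivAt_cos t))).congr_deriv (by ring)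

lemma Framed.hasDerivAt_touch_B (h : Framed x u v) {t : ℝ} (ht : t ∈ Ioo 0 (π / 2)) {du : ℝ}
    (hu : HasDerivAt u du t) : HasDerivAt (touch x u v .B) ((du + v t) • nu t) t := by
  refine hasDerivAt_plane.2 ⟨?_, ?_⟩ <;> simp only [touch, offMu, offNu, nu, PiLp.smul_apply,
    PiLp.toLp_apply, Matrix.cons_val_zero, Matrix.cons_val_one, smul_eq_mul]
  · exact (((h.deriv0 t ht).add ((hasDerivAt_cos t).const_mul 0)).sub
      (hu.mul (hasDerivAt_sin t))).congr_deriv (by ring)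
  · exact (((h.deriv1 t ht).add ((hasDerivAt_sin t).const_mul 0)).add
      (hu.mul (hasDerivAt_cos t))).congr_deriv (by ring)

lemma Framed.hasDerivAt_touch_C (h : Framed x u v) {t : ℝ} (ht : t ∈ Ioo 0 (π / 2)) {dv : ℝ}
    (hv : HasDerivAt v dv t) : HasDerivAt (touch x u v .C) ((u t - 1 - dv) • mu t) t := by
  refine hasDerivAt_plane.2 ⟨?_, ?_⟩ <;> simp only [touch, offMu, offNu, mu, PiLp.smul_apply,
    PiLp.toLp_apply, Matrix.cons_val_zero, Matrix.cons_val_one, smul_eq_mul]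
  · exact (((h.deriv0 t ht).add (hv.neg.mul (hasDerivAt_cos t))).sub
      ((hasDerivAt_sin t).const_mul 1)).congr_deriv (by simp; ring)
  · exact (((h.deriv1 t ht).add (hv.neg.mul (hasDerivAt_sin t))).add
      ((hasDerivAt_cos t).const_mul 1)).congr_deriv (by simp; ring)

lemma Framed.hasDerivAt_touch_D (h : Framed x u v) {t : ℝ} (ht : t ∈ Ioo 0 (π / 2)) {dv : ℝ}
    (hv : HasDerivAt v dv t) : HasDerivAt (touch x u v .D) ((u t - dv) • mu t) t := by
  refine hasDerivAt_plane.2 ⟨?_, ?_⟩ <;> simp only [touch, offMu, offNu, mu, PiLp.smul_apply,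
    PiLp.toLp_apply, Matrix.cons_val_zero, Matrix.cons_val_one, smul_eq_mul]
  · exact (((h.deriv0 t ht).add (hv.neg.mul (hasDerivAt_cos t))).sub
      ((hasDerivAt_sin t).const_mul 0)).congr_deriv (by simp; ring)
  · exact (((h.deriv1 t ht).add (hv.neg.mul (hasDerivAt_sin t))).add
      ((hasDerivAt_cos t).const_mul 0)).congr_deriv (by simp; ring)

lemma Framed.contactPath_eventuallyEq (h : Framed x u v) {k : Contact} {t : ℝ}
    (hk : ∀ᶠ s in 𝓝 t, k ∈ Gam x s) : contactPath x k =ᶠ[𝓝 t] touch x u v k := by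
  filter_upwards [hk] with s hs
  exact h.contactPath_eq hs

lemma inner_smul_mu_mu (c t : ℝ) : inner ℝ (c • mu t) (mu t) = c := by
  simp [mu, PiLp.inner_apply, Fin.sum_univ_two]
  linear_combination c * sin_sq_add_cos_sq t

lemma inner_smul_nu_nu (c t : ℝ) : inner ℝ (c • nu t) (nu t) = c := by
  simp [nu, PiLp.inner_apply, Fin.sum_univ_two]
  linear_combination c * sin_sq_add_cos_sq t

/-- Well-behavedness and the frame components of the derivative. -/
lemma Framed.wellBehaved_iff (h : Framed x u v) {t : ℝ} (ht : t ∈ Ioo 0 (π / 2)) {du dv : ℝ}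
    (hu : HasDerivAt u du t) (hv : HasDerivAt v dv t)
    (hG : ∀ᶠ s in 𝓝 t, Gam x s = Gam x t) :
    WellBehaved x t ↔ ContDiffAt ℝ 2 x t ∧ (Contact.x ∈ Gam x t → 0 ≤ v t ∧ u t ≤ 0) ∧
      (Contact.A ∈ Gam x t → 0 ≤ 1 + du + v t) ∧ (Contact.B ∈ Gam x t → du + v t ≤ 0) ∧
      (Contact.C ∈ Gam x t → u t - 1 - dv ≤ 0) ∧ (Contact.D ∈ Gam x t → 0 ≤ u t - dv) := by
  -- Constancy of `Gam` near t lets the chosen contact path be replaced by the explicit touching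
  -- point on a whole neighbourhood, hence inside a derivative.
  have key : ∀ k ∈ Gam x t, contactPath x k =ᶠ[𝓝 t] touch x u v k := fun k hk =>
    h.contactPath_eventuallyEq (hG.mono fun s hs => hs ▸ hk)
  have hA : Contact.A ∈ Gam x t → HasDerivAt (contactPath x .A) ((1 + du + v t) • nu t) t :=
    fun hk => (h.hasDerivAt_touch_A ht hu).congr_of_eventuallyEq (key _ hk)
  have hB : Contact.B ∈ Gam x t → HasDerivAt (contactPath x .B) ((du + v t) • nu t) t :=
    fun hk => (h.hasDerivAt_touch_B ht hu).congr_of_eventuallyEq (key _ hk)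
  have hC : Contact.C ∈ Gam x t → HasDerivAt (contactPath x .C) ((u t - 1 - dv) • mu t) t :=
    fun hk => (h.hasDerivAt_touch_C ht hv).congr_of_eventuallyEq (key _ hk)
  have hD : Contact.D ∈ Gam x t → HasDerivAt (contactPath x .D) ((u t - dv) • mu t) t :=
    fun hk => (h.hasDerivAt_touch_D ht hv).congr_of_eventuallyEq (key _ hk)
  unfold WellBehaved
  rw [h.inner_deriv_mu ht, h.inner_deriv_nu ht]
  refine and_congr Iff.rfl (and_congr Iff.rfl (and_congr ?_ (and_congr ?_ (and_congr ?_ ?_))))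
  · refine imp_congr_right fun hk => ?_
    rw [(hA hk).deriv, inner_smul_nu_nu]
    exact and_iff_right (hA hk).differentiableAt
  · refine imp_congr_right fun hk => ?_
    rw [(hB hk).deriv, inner_smul_nu_nu]
    exact and_iff_right (hB hk).differentiableAt
  · refine imp_congr_right fun hk => ?_
    rw [(hC hk).deriv, inner_smul_mu_mu]
    exact and_iff_right (hC hk).differentiableAt
  · refine imp_congr_right fun hk => ?_
    rw [(hD hk).deriv, inner_smul_mu_mu]
    exact and_iff_right (hD hk).differentiableAt

/-! ### Rotation paths subject to the assumptions -/

/-- The component of the derivative along `mu`. -/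
def velMu (x : ℝ → Plane) (t : ℝ) : ℝ :=
  inner ℝ (derivWithin x (Icc 0 (π / 2)) t) (mu t)

/-- The component of the derivative along `nu`. -/
def velNu (x : ℝ → Plane) (t : ℝ) : ℝ :=
  inner ℝ (derivWithin x (Icc 0 (π / 2)) t) (nu t)

lemma continuous_mu : Continuous mu := by
  unfold mu; fun_prop

lemma continuous_nu : Continuous nu := by
  unfold nu; fun_prop

/-- Derivatives within the closed interval make the velocity components continuous up to 0 and π/2;
the value at 0 carries the starting condition on A. -/
lemma framed_of_contDiffOn (hx : IsRotationPath x) (hc : ContDiffOn ℝ 1 x (Icc 0 (π / 2))) :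
    Framed x (velMu x) (velNu x) := by
  have hpi := pi_pos
  have huniq : UniqueDiffOn ℝ (Icc 0 (π / 2)) := uniqueDiffOn_Icc (by positivity)
  have hd := hc.continuousOn_derivWithin huniq le_rfl
  have key : ∀ t ∈ Ioo (0 : ℝ) (π / 2),
      HasDerivAt x (derivWithin x (Icc 0 (π / 2)) t) t := fun t ht =>
    ((hc.differentiableOn (by norm_num)) t (Ioo_subset_Icc_self ht)).hasDerivWithinAt.hasDerivAt
      (Icc_mem_nhds ht.1 ht.2)
  refine ⟨hx.2, hx.1, hd.inner continuous_mu.continuousOn, hd.inner continuous_nu.continuousOn,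
    fun t ht => ?_, fun t ht => ?_⟩
  · refine (hasDerivAt_plane.1 (key t ht)).1.congr_deriv ?_
    simp [velMu, velNu, mu, nu, PiLp.inner_apply, Fin.sum_univ_two]
    linear_combination -(derivWithin x (Icc 0 (π / 2)) t 0) * sin_sq_add_cos_sq t
  · refine (hasDerivAt_plane.1 (key t ht)).2.congr_deriv ?_
    simp [velMu, velNu, mu, nu, PiLp.inner_apply, Fin.sum_univ_two]
    linear_combination -(derivWithin x (Icc 0 (π / 2)) t 1) * sin_sq_add_cos_sq t

end

section

variable {x : ℝ → Plane} {u v : ℝ → ℝ}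

/-! ### Frame coordinates of a touching point at another time. -/

lemma Kmu_touch_at (k : Contact) (t s : ℝ) : Kmu x (touch x u v k t) s =
    Kmu x (x t) s + offMu v k t * cos (s - t) + offNu u k t * sin (s - t) := by
  simp [Kmu, touch, cos_sub, sin_sub]; ring

lemma Knu_touch_at (k : Contact) (t s : ℝ) : Knu x (touch x u v k t) s =
    Knu x (x t) s - offMu v k t * sin (s - t) + offNu u k t * cos (s - t) := by
  simp [Knu, touch, cos_sub, sin_sub]; ring

lemma Kmu_self (t : ℝ) : Kmu x (x t) t = 0 := by simp [Kmu]

lemma Knu_self (t : ℝ) : Knu x (x t) t = 0 := by simp [Knu]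

/-! ### When the corner lies in the shape -/

lemma Framed.Kmu_corner_nonneg (h : Framed x u v) {S : Finset ℝ} (hc : InnerConvex u v S)
    {t s : ℝ} (ht : t ∈ Icc 0 (π / 2)) (hs : s ∈ Icc 0 (π / 2)) (hu : u t ≤ 0) (hts : t ≤ s) :
    0 ≤ Kmu x (x t) s := by
  have := h.Kmu_ge hc (x t) ht hs
  rw [Kmu_self, Knu_self] at this
  have hsin : 0 ≤ sin (s - t) :=
    sin_nonneg_of_nonneg_of_le_pi (by linarith) (by linarith [ht.1, hs.2, pi_pos])
  nlinarith

lemma Framed.Knu_corner_nonneg (h : Framed x u v) {S : Finset ℝ} (hc : InnerConvex u v S)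
    {t s : ℝ} (ht : t ∈ Icc 0 (π / 2)) (hs : s ∈ Icc 0 (π / 2)) (hv : 0 ≤ v t) (hst : s ≤ t) :
    0 ≤ Knu x (x t) s := by
  have := h.Knu_ge hc (x t) ht hs
  rw [Kmu_self, Knu_self] at this
  have hsin : sin (s - t) ≤ 0 :=
    sin_nonpos_of_nonpos_of_neg_pi_le (by linarith) (by linarith [hs.1, ht.2, pi_pos])
  nlinarith

lemma corner_mem_shape_of (h : Framed x u v) {S : Finset ℝ} (hc : InnerConvex u v S)
    {t : ℝ} (ht : t ∈ Icc 0 (π / 2)) (hu : u t ≤ 0) (hv : 0 ≤ v t)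
    (ho : ∀ s ∈ Icc (0 : ℝ) (π / 2), Kmu x (x t) s ≤ 1 ∧ Knu x (x t) s ≤ 1) :
    x t ∈ shape x := by
  have hpi := pi_pos
  refine (mem_shape h.start).2 ⟨h.Knu_corner_nonneg hc ht ⟨le_rfl, by positivity⟩ hv ht.1,
    h.Kmu_corner_nonneg hc ht ⟨by positivity, le_rfl⟩ hu ht.2, fun s hs =>
    ⟨(ho s hs).1, (ho s hs).2, ?_⟩⟩
  rcases le_total t s with hts | hst
  · exact Or.inl (h.Kmu_corner_nonneg hc ht hs hu hts)
  · exact Or.inr (h.Knu_corner_nonneg hc ht hs hv hst)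

/-- If the corner were beyond an outer wall at time s while A(t) and C(t) are not, then for the wall
perpendicular to mu one gets cos(s - t) < -u sin(s - t) and sin(s - t) < v cos(s - t), hence 1 < -u
v. The other wall is analogous. -/
lemma corner_le_one_of_touch_mem (h : Framed x u v) {t : ℝ} (ht : t ∈ Ioo 0 (π / 2))
    (hA : touch x u v .A t ∈ shape x) (hC : touch x u v .C t ∈ shape x) (hu : u t ≤ 0)
    (hv : 0 ≤ v t) (huv : -u t * v t < 1) :
    ∀ s ∈ Icc (0 : ℝ) (π / 2), Kmu x (x t) s ≤ 1 ∧ Knu x (x t) s ≤ 1 := by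
  intro s hs
  have hA' := ((mem_shape h.start).1 hA).2.2 s hs
  have hC' := ((mem_shape h.start).1 hC).2.2 s hs
  rw [Kmu_touch_at, Knu_touch_at] at hA' hC'
  simp only [offMu, offNu] at hA' hC'
  have hcos : 0 < cos (s - t) :=
    cos_pos_of_mem_Ioo ⟨by linarith [ht.2, hs.1], by linarith [ht.1, hs.2]⟩
  constructor
  · by_contra! hlt
    have h1 : cos (s - t) < -u t * sin (s - t) := by linarith [hA'.1]
    have h2 : sin (s - t) < v t * cos (s - t) := by linarith [hC'.1]
    nlinarith
  · by_contra! hlt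
    have h1 : -sin (s - t) < -u t * cos (s - t) := by linarith [hA'.2.1]
    have h2 : cos (s - t) < v t * (-sin (s - t)) := by linarith [hC'.2.1]
    nlinarith

/-! ### Rotation equations -/

/-- Turning (X, Y) at time r by the remaining angle ω (t - r) gives a vector independent of r;
compare r = a with r = t. -/
lemma rotation_ode {X Y : ℝ → ℝ} {ω a c : ℝ} (hX : ContinuousOn X (Icc a c))
    (hY : ContinuousOn Y (Icc a c)) (dX : ∀ t ∈ Ioo a c, HasDerivAt X (ω * Y t) t)
    (dY : ∀ t ∈ Ioo a c, HasDerivAt Y (-(ω * X t)) t) {t : ℝ} (ht : t ∈ Icc a c) :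
    X t = X a * cos (ω * (t - a)) + Y a * sin (ω * (t - a)) ∧
      Y t = Y a * cos (ω * (t - a)) - X a * sin (ω * (t - a)) := by
  have hsub : Icc a t ⊆ Icc a c := Icc_subset_Icc_right ht.2
  have hc : ∀ r, HasDerivAt (fun r => cos (ω * (t - r))) (ω * sin (ω * (t - r))) r := fun r => by
    have := (((hasDerivAt_id r).const_sub t).const_mul ω).cos
    simpa [mul_comm] using this
  have hs : ∀ r, HasDerivAt (fun r => sin (ω * (t - r))) (-(ω * cos (ω * (t - r)))) r := fun r => by
    have := (((hasDerivAt_id r).const_sub t).const_mul ω).sin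
    simpa [mul_comm] using this
  constructor
  · have := eq_of_hasDerivAt_zero_off_finite
      (f := fun r => X r * cos (ω * (t - r)) + Y r * sin (ω * (t - r))) ∅ ht.1
      (by have := hX.mono hsub; have := hY.mono hsub; fun_prop) fun r hr _ => by
        have hr' : r ∈ Ioo a c := ⟨hr.1, hr.2.trans_le ht.2⟩
        exact (((dX r hr').mul (hc r)).add ((dY r hr').mul (hs r))).congr_deriv (by ring)
    simpa using this.symm
  · have := eq_of_hasDerivAt_zero_off_finite
      (f := fun r => Y r * cos (ω * (t - r)) - X r * sin (ω * (t - r))) ∅ ht.1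
      (by have := hX.mono hsub; have := hY.mono hsub; fun_prop) fun r hr _ => by
        have hr' : r ∈ Ioo a c := ⟨hr.1, hr.2.trans_le ht.2⟩
        exact (((dY r hr').mul (hc r)).sub ((dX r hr').mul (hs r))).congr_deriv (by ring)
    simpa using this.symm

/-! ### Consequences of the assumptions and the necessary conditions -/

section Uniqueness

variable {b : ℝ}

lemma AmbiAssumptions.framed (h : AmbiAssumptions x b) : Framed x (velMu x) (velNu x) :=
  framed_of_contDiffOn h.rotationPath h.contDiff

lemma AmbiAssumptions.gam_one (h : AmbiAssumptions x b) {t : ℝ} (ht : t ∈ Ioo 0 b) :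
    ∀ᶠ s in 𝓝 t, Gam x s = {.A, .C, .D} := by
  filter_upwards [Ioo_mem_nhds ht.1 ht.2] with s hs
  exact h.phase_one s hs.1 hs.2

lemma AmbiAssumptions.gam_two (h : AmbiAssumptions x b) {t : ℝ} (ht : t ∈ Ioo b (π / 2 - b)) :
    ∀ᶠ s in 𝓝 t, Gam x s = {.x, .A, .B, .C, .D} := by
  filter_upwards [Ioo_mem_nhds ht.1 ht.2] with s hs
  exact h.phase_two s hs.1.le hs.2.le

lemma AmbiAssumptions.gam_three (h : AmbiAssumptions x b) {t : ℝ}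
    (ht : t ∈ Ioo (π / 2 - b) (π / 2)) : ∀ᶠ s in 𝓝 t, Gam x s = {.A, .B, .C} := by
  filter_upwards [Ioo_mem_nhds ht.1 ht.2] with s hs
  exact h.phase_three s hs.1 hs.2

lemma AmbiAssumptions.ode_one (h : AmbiAssumptions x b)
    (hn : ∀ t ∈ Ioo (0 : ℝ) (π / 2) \ {b, π / 2 - b}, NecessaryConditions x t) {t : ℝ}
    (ht : t ∈ Ioo 0 b) :
    HasDerivAt (velMu x) (-1 - velNu x t) t ∧ HasDerivAt (velNu x) (-1 / 2 + velMu x t) t := by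
  have hb := h.angle_lt
  have hI : t ∈ Ioo 0 (π / 2) := ⟨ht.1, by linarith [ht.2, pi_pos]⟩
  have hne : t ∈ Ioo (0 : ℝ) (π / 2) \ {b, π / 2 - b} := by
    refine ⟨hI, ?_⟩
    rintro (rfl | rfl)
    · exact lt_irrefl _ ht.2
    · linarith [ht.2]
  obtain ⟨du, dv, hu, hv⟩ := h.framed.exists_hasDerivAt hI (h.wellBehaved t hne).1
  have := (h.framed.odeAt_iff hI hu hv).1 ((hn t hne).1 (h.gam_one ht)).1
  exact ⟨hu.congr_deriv (by rw [this.1]; ring), hv.congr_deriv (by rw [this.2]; ring)⟩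

lemma AmbiAssumptions.ode_three (h : AmbiAssumptions x b)
    (hn : ∀ t ∈ Ioo (0 : ℝ) (π / 2) \ {b, π / 2 - b}, NecessaryConditions x t) {t : ℝ}
    (ht : t ∈ Ioo (π / 2 - b) (π / 2)) :
    HasDerivAt (velMu x) (-1 / 2 - velNu x t) t ∧ HasDerivAt (velNu x) (-1 + velMu x t) t := by
  have hb := h.angle_lt
  have hI : t ∈ Ioo 0 (π / 2) := ⟨by linarith [ht.1, pi_pos], ht.2⟩
  have hne : t ∈ Ioo (0 : ℝ) (π / 2) \ {b, π / 2 - b} := by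
    refine ⟨hI, ?_⟩
    rintro (rfl | rfl)
    · linarith [ht.1]
    · exact lt_irrefl _ ht.1
  obtain ⟨du, dv, hu, hv⟩ := h.framed.exists_hasDerivAt hI (h.wellBehaved t hne).1
  have := (h.framed.odeAt_iff hI hu hv).1 ((hn t hne).2.2.2.2.1 (h.gam_three ht)).1
  exact ⟨hu.congr_deriv (by rw [this.1]; ring), hv.congr_deriv (by rw [this.2]; ring)⟩

/-- With u' and v' taken from the equations, the conditions on B' and D' become v ≤ 1 and -1 ≤ u.
These bounds provide inner convexity in the middle phase. -/
lemma AmbiAssumptions.ode_two (h : AmbiAssumptions x b)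
    (hn : ∀ t ∈ Ioo (0 : ℝ) (π / 2) \ {b, π / 2 - b}, NecessaryConditions x t) {t : ℝ}
    (ht : t ∈ Ioo b (π / 2 - b)) :
    HasDerivAt (velMu x) (-(1 + velNu x t) / 2) t ∧
      HasDerivAt (velNu x) (-(1 - velMu x t) / 2) t ∧ velNu x t ≤ 1 ∧ -1 ≤ velMu x t := by
  have hb := h.angle_lt
  have hb0 := h.angle_pos
  have hI : t ∈ Ioo 0 (π / 2) := ⟨by linarith [ht.1], by linarith [ht.2]⟩
  have hne : t ∈ Ioo (0 : ℝ) (π / 2) \ {b, π / 2 - b} := by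
    refine ⟨hI, ?_⟩
    rintro (rfl | rfl)
    · exact lt_irrefl _ ht.1
    · exact lt_irrefl _ ht.2
  have hw := h.wellBehaved t hne
  obtain ⟨du, dv, hu, hv⟩ := h.framed.exists_hasDerivAt hI hw.1
  have hG := h.gam_two ht
  have he := (h.framed.odeAt_iff hI hu hv).1 ((hn t hne).2.2.2.2.2 hG)
  have hGt := hG.self_of_nhds
  obtain ⟨-, -, -, hB, -, hD⟩ := (h.framed.wellBehaved_iff hI hu hv
    (hG.mono fun s hs => hs.trans hGt.symm)).1 hw
  have hB := hB (by simp [hGt])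
  have hD := hD (by simp [hGt])
  refine ⟨hu.congr_deriv (by rw [he.1]; ring), hv.congr_deriv (by rw [he.2]; ring), ?_, ?_⟩
  · linarith [he.1]
  · linarith [he.2]

lemma AmbiAssumptions.innerConvex (h : AmbiAssumptions x b)
    (hn : ∀ t ∈ Ioo (0 : ℝ) (π / 2) \ {b, π / 2 - b}, NecessaryConditions x t) :
    InnerConvex (velMu x) (velNu x) {b, π / 2 - b} := by
  have tri : ∀ t ∈ Ioo (0 : ℝ) (π / 2), t ∉ ({b, π / 2 - b} : Finset ℝ) →
      t ∈ Ioo 0 b ∨ t ∈ Ioo b (π / 2 - b) ∨ t ∈ Ioo (π / 2 - b) (π / 2) := by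
    intro t ht hS
    simp only [Finset.mem_insert, Finset.mem_singleton, not_or] at hS
    rcases lt_or_gt_of_ne hS.1 with h1 | h1
    · exact Or.inl ⟨ht.1, h1⟩
    · rcases lt_or_gt_of_ne hS.2 with h2 | h2
      · exact Or.inr (Or.inl ⟨h1, h2⟩)
      · exact Or.inr (Or.inr ⟨h2, ht.2⟩)
  constructor
  · intro t ht hS
    rcases tri t ht hS with h1 | h1 | h1
    · exact ⟨_, (h.ode_one hn h1).1, by linarith⟩
    · exact ⟨_, (h.ode_two hn h1).1, by linarith [(h.ode_two hn h1).2.2.1]⟩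
    · exact ⟨_, (h.ode_three hn h1).1, by linarith⟩
  · intro t ht hS
    rcases tri t ht hS with h1 | h1 | h1
    · exact ⟨_, (h.ode_one hn h1).2, by linarith⟩
    · exact ⟨_, (h.ode_two hn h1).2.1, by linarith [(h.ode_two hn h1).2.2.2]⟩
    · exact ⟨_, (h.ode_three hn h1).2, by linarith⟩

/-- Since B exists at b, u(b) ≤ 0. If u(b) < 0, then shortly before b still u < 0 ≤ v, so the inner
bounds hold at the corner by convexity and the outer bounds because A and C are in the shape. The
corner would then be a contact point in the first phase, which is excluded. -/
lemma AmbiAssumptions.velMu_critical (h : AmbiAssumptions x b)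
    (hn : ∀ t ∈ Ioo (0 : ℝ) (π / 2) \ {b, π / 2 - b}, NecessaryConditions x t) :
    velMu x b = 0 := by
  have hb := h.angle_lt
  have hb0 := h.angle_pos
  have hF := h.framed
  have hI : b ∈ Ioo 0 (π / 2) := ⟨hb0, by linarith⟩
  have hGb : Gam x b = {.x, .A, .B, .C, .D} := h.phase_two b le_rfl (by linarith)
  have hle : velMu x b ≤ 0 := hF.u_nonpos_of_gam (by simp [hGb])
  have hv0 : 0 ≤ velNu x b := hF.v_nonneg_of_gam (by simp [hGb])
  by_contra hne
  have hlt : velMu x b < 0 := lt_of_le_of_ne hle hne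
  have hcu := hF.cont_u.continuousAt (Icc_mem_nhds hI.1 hI.2)
  have hcv := hF.cont_v.continuousAt (Icc_mem_nhds hI.1 hI.2)
  have hnhds : ∀ᶠ t in 𝓝[>] b, t ∈ Ioo b (π / 2 - b) :=
    Ioo_mem_nhdsGT (by linarith)
  have hv1 : velNu x b ≤ 1 :=
    le_of_tendsto (hcv.tendsto.mono_left nhdsWithin_le_nhds)
      (hnhds.mono fun t ht => (h.ode_two hn ht).2.2.1)
  -- On [b, π/4] the function u + t/2 has derivative -v/2 ≤ 0, and u(π/4) ≥ -1; hence u(b) ≥ -1 +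
  -- (π/4 - b)/2. Strictness is needed for -u v < 1.
  have hu1 : -1 < velMu x b := by
    have hq : π / 4 ∈ Ioo b (π / 2 - b) := ⟨by linarith, by linarith⟩
    have := le_of_hasDerivAt_nonneg_off_finite (f := fun t => -(velMu x t + t / 2)) ∅ hq.1.le
      (by
        have := hF.cont_u.mono (Icc_subset_Icc hb0.le (by linarith : π / 4 ≤ π / 2))
        fun_prop)
      (fun t ht _ => by
        have ht' : t ∈ Ioo b (π / 2 - b) := ⟨ht.1, by linarith [ht.2]⟩
        have hvt : 0 ≤ velNu x t := hF.v_nonneg_of_gam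
          (by rw [h.phase_two t ht'.1.le ht'.2.le]; simp)
        exact ⟨_, ((h.ode_two hn ht').1.add ((hasDerivAt_id t).div_const 2)).neg,
          by linarith⟩)
    linarith [(h.ode_two hn hq).2.2.2, hq.1]
  have huv : -velMu x b * velNu x b < 1 := by nlinarith
  have hev : ∀ᶠ t in 𝓝 b, velMu x t < 0 ∧ -velMu x t * velNu x t < 1 :=
    (hcu.eventually_lt continuousAt_const hlt).and
      ((hcu.neg.mul hcv).eventually_lt continuousAt_const huv)
  obtain ⟨l, hlb, hl⟩ := exists_Ioc_subset_of_mem_nhds hev ⟨b - 1, by linarith⟩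
  obtain ⟨t, ht1, htb⟩ := exists_between (max_lt hlb hb0)
  have hl1 : l < t := (le_max_left _ _).trans_lt ht1
  have ht0 : 0 < t := (le_max_right _ _).trans_lt ht1
  have htI : t ∈ Ioo 0 (π / 2) := ⟨ht0, by linarith⟩
  obtain ⟨hut, huvt⟩ := hl ⟨hl1, htb.le⟩
  -- Between t and b one has v' = u - 1/2 < 0, and v(b) ≥ 0.
  have hvt : 0 ≤ velNu x t := by
    have := le_of_hasDerivAt_nonneg_off_finite (f := fun s => -velNu x s) ∅ htb.le
      (hF.cont_v.mono (Icc_subset_Icc ht0.le hI.2.le)).neg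
      (fun s hs _ => ⟨_, (h.ode_one hn ⟨ht0.trans hs.1, hs.2⟩).2.neg, by
        linarith [(hl ⟨hl1.trans hs.1, hs.2.le⟩).1]⟩)
    linarith
  have hGt := h.phase_one t ht0 htb
  have hmem : x t ∈ shape x := corner_mem_shape_of hF (h.innerConvex hn)
    (Ioo_subset_Icc_self htI) hut.le hvt
    (corner_le_one_of_touch_mem hF htI (hF.touch_mem_shape (by simp [hGt]))
      (hF.touch_mem_shape (by simp [hGt])) hut.le hvt huvt)
  have : Contact.x ∈ Gam x t := ⟨x t, mem_contactSet htI hmem rfl⟩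
  simp [hGt] at this

/-- The frame components of the derivative in the first two phases, and the equation for the
critical angle. -/
lemma AmbiAssumptions.explicit (h : AmbiAssumptions x b)
    (hn : ∀ t ∈ Ioo (0 : ℝ) (π / 2) \ {b, π / 2 - b}, NecessaryConditions x t) :
    4 * tan b ^ 3 + 3 * tan b = 1 ∧
      (∀ t ∈ Icc 0 b, velMu x t = 1 / 2 - 1 / (2 * sin b) * sin t ∧
        velNu x t = 1 / (2 * sin b) * cos t - 1) ∧
      ∀ t ∈ Icc b (π / 2 - b),
        velMu x t = 1 - (cos (1 / 2 * (t - b)) + cos b / (2 * sin b) * sin (1 / 2 * (t - b))) ∧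
        velNu x t = cos b / (2 * sin b) * cos (1 / 2 * (t - b)) - sin (1 / 2 * (t - b)) - 1 := by
  have hb := h.angle_lt
  have hb0 := h.angle_pos
  have hpi := pi_pos
  have hF := h.framed
  have hsin : 0 < sin b := sin_pos_of_pos_of_lt_pi hb0 (by linarith)
  have hcos : 0 < cos b := cos_pos_of_mem_Ioo ⟨by linarith, by linarith⟩
  -- At time 0 the touching point A is (1, u(0)).
  have hA0 : velMu x 0 = 1 / 2 := by
    have h1 : (!₂[1, 1 / 2] : Plane) ∈ contactSet x .A 0 := by rw [h.startA]; rfl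
    have h2 := congrArg (fun p : Plane => p 1) (hF.contactSet_spec h1).2.1
    simpa [touch, offMu, offNu, hF.start] using h2.symm
  have hub := h.velMu_critical hn
  have c1 := hF.cont_u.mono (Icc_subset_Icc_right (by linarith : b ≤ π / 2))
  have c2 := hF.cont_v.mono (Icc_subset_Icc_right (by linarith : b ≤ π / 2))
  have c3 := hF.cont_u.mono (Icc_subset_Icc hb0.le (by linarith : π / 2 - b ≤ π / 2))
  have c4 := hF.cont_v.mono (Icc_subset_Icc hb0.le (by linarith : π / 2 - b ≤ π / 2))
  have one := fun (t : ℝ) (ht : t ∈ Icc 0 b) => rotation_ode (X := fun t => 1 / 2 - velMu x t)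
    (Y := fun t => velNu x t + 1) (ω := 1) (by fun_prop) (by fun_prop)
    (fun s hs => ((h.ode_one hn hs).1.const_sub (1 / 2)).congr_deriv (by ring))
    (fun s hs => ((h.ode_one hn hs).2.add_const 1).congr_deriv (by ring)) ht
  have two := fun (t : ℝ) (ht : t ∈ Icc b (π / 2 - b)) =>
    rotation_ode (X := fun t => 1 - velMu x t)
    (Y := fun t => velNu x t + 1) (ω := 1 / 2) (by fun_prop) (by fun_prop)
    (fun s hs => ((h.ode_two hn hs).1.const_sub 1).congr_deriv (by ring))
    (fun s hs => ((h.ode_two hn hs).2.1.add_const 1).congr_deriv (by ring)) ht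
  simp only [hA0, sub_self, zero_mul, one_mul, sub_zero, zero_add] at one
  simp only [hub, sub_zero, one_mul] at two
  -- The condition u(b) = 0 fixes the radius of the circle in the first phase.
  have hE : velNu x 0 + 1 = 1 / (2 * sin b) := by
    have := (one b ⟨hb0.le, le_rfl⟩).1
    rw [hub] at this
    field_simp
    linarith
  have hY : velNu x b + 1 = cos b / (2 * sin b) := by
    rw [(one b ⟨hb0.le, le_rfl⟩).2, hE]; ring
  rw [hE] at one
  rw [hY] at two
  -- The height is symmetric about π/4, so the vertical velocity (u + v)/√2 vanishes there.
  have hsym : velMu x (π / 4) + velNu x (π / 4) = 0 := by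
    have hq : π / 4 ∈ Ioo 0 (π / 2) := ⟨by linarith, by linarith⟩
    have h1 := hF.deriv1 (π / 4) hq
    have h2 : HasDerivAt (fun s => x (π / 2 - s) 1)
        (-(velMu x (π / 4) * sin (π / 4) + velNu x (π / 4) * cos (π / 4))) (π / 4) := by
      have e : π / 2 - π / 4 = π / 4 := by ring
      have h3 : HasDerivAt (fun s => x s 1)
        (velMu x (π / 4) * sin (π / 4) + velNu x (π / 4) * cos (π / 4)) (π / 2 - π / 4) := by
        rw [e]; exact h1
      simpa using h3.comp_const_sub (π / 2) (π / 4)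
    have h4 : (fun s => x (π / 2 - s) 1) =ᶠ[𝓝 (π / 4)] fun s => x s 1 := by
      filter_upwards [Ioo_mem_nhds hq.1 hq.2] with s hs
      exact (h.symmetric s (Ioo_subset_Icc_self hs)).2
    have h5 := h2.unique (h1.congr_of_eventuallyEq h4)
    rw [cos_pi_div_four, sin_pi_div_four] at h5
    have : 0 < √2 / 2 := by positivity
    nlinarith
  refine ⟨?_, fun t ht => ⟨by linarith [(one t ht).1], by linarith [(one t ht).2]⟩,
    fun t ht => ⟨by linarith [(two t ht).1], by linarith [(two t ht).2]⟩⟩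
  obtain ⟨q1, q2⟩ := two (π / 4) ⟨by linarith, by linarith⟩
  -- With b = π/4 - 2θ, the symmetry relation and cos b = 2 Y sin b are both expressible by Y and D
  -- = (cos θ - sin θ)^2. Eliminating D leaves 2 Y^3 - 3 Y^2 - 1 = 0, the cubic for tan b = 1/(2Y).
  set θ := 1 / 2 * (π / 4 - b) with hθ
  set Y := cos b / (2 * sin b) with hYdef
  have hrel : cos θ + sin θ = Y * (cos θ - sin θ) := by linarith
  have hb' : b = π / 4 - 2 * θ := by rw [hθ]; ring
  have hs2 : 0 < √2 / 2 := by positivity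
  have hcs := sin_sq_add_cos_sq θ
  have e1 : cos b = √2 / 2 * (cos (2 * θ) + sin (2 * θ)) := by
    rw [hb', cos_sub, cos_pi_div_four, sin_pi_div_four]; ring
  have e2 : sin b = √2 / 2 * (cos (2 * θ) - sin (2 * θ)) := by
    rw [hb', sin_sub, cos_pi_div_four, sin_pi_div_four]; ring
  have e3 : cos b = 2 * Y * sin b := by rw [hYdef]; field_simp
  have e4 : cos (2 * θ) + sin (2 * θ) = 2 * Y * (cos (2 * θ) - sin (2 * θ)) := by
    rw [e1, e2] at e3
    have : √2 / 2 * (cos (2 * θ) + sin (2 * θ) - 2 * Y * (cos (2 * θ) - sin (2 * θ))) = 0 := by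
      linarith
    rcases mul_eq_zero.1 this with h0 | h0 <;> linarith
  set D := (cos θ - sin θ) ^ 2 with hD
  have e5 : cos (2 * θ) = Y * D := by
    rw [cos_two_mul, hD]
    linear_combination (cos θ - sin θ) * hrel + hcs
  have e6 : sin (2 * θ) = 1 - D := by
    rw [sin_two_mul, hD]; linear_combination hcs
  have e7 : D * (1 + Y ^ 2) = 2 := by
    rw [hD]; linear_combination 2 * hcs - (cos θ + sin θ + Y * (cos θ - sin θ)) * hrel
  rw [e5, e6] at e4
  have e8 : 2 * Y ^ 3 - 3 * Y ^ 2 - 1 = 0 := by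
    linear_combination (1 + Y ^ 2) * e4 + (-Y + 1 + 2 * Y * (Y + 1)) * e7
  have hYpos : 0 < Y := by positivity
  have hT : tan b = 1 / (2 * Y) := by
    rw [tan_eq_sin_div_cos, e3]; field_simp
  rw [hT]
  field_simp
  linear_combination -4 * e8

/-- The polynomial 4 T^3 + 3 T is strictly increasing, and tan is injective on the relevant range.
-/
lemma AmbiAssumptions.angle_unique {y : ℝ → Plane} {c : ℝ} (h : AmbiAssumptions x b)
    (hn : ∀ t ∈ Ioo (0 : ℝ) (π / 2) \ {b, π / 2 - b}, NecessaryConditions x t)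
    (h' : AmbiAssumptions y c)
    (hn' : ∀ t ∈ Ioo (0 : ℝ) (π / 2) \ {c, π / 2 - c}, NecessaryConditions y t) : b = c := by
  have e := (h.explicit hn).1
  have e' := (h'.explicit hn').1
  have hfac : (tan b - tan c) * (4 * (tan b ^ 2 + tan b * tan c + tan c ^ 2) + 3) = 0 := by
    linear_combination e - e'
  have hpos : 0 < 4 * (tan b ^ 2 + tan b * tan c + tan c ^ 2) + 3 := by
    nlinarith [sq_nonneg (tan b + tan c), sq_nonneg (tan b), sq_nonneg (tan c)]
  have htan : tan b = tan c := by
    rcases mul_eq_zero.1 hfac with h0 | h0 <;> linarith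
  have hpi := pi_pos
  exact tan_inj_of_lt_of_lt_pi_div_two (by linarith [h.angle_pos]) (by linarith [h.angle_lt])
    (by linarith [h'.angle_pos]) (by linarith [h'.angle_lt]) htan

/-- Up to π/2 - b the velocities agree by the explicit formulas. The last phase is the mirror image
of the first and needs no integration. -/
lemma AmbiAssumptions.path_unique {y : ℝ → Plane} (h : AmbiAssumptions x b)
    (hn : ∀ t ∈ Ioo (0 : ℝ) (π / 2) \ {b, π / 2 - b}, NecessaryConditions x t)
    (h' : AmbiAssumptions y b)
    (hn' : ∀ t ∈ Ioo (0 : ℝ) (π / 2) \ {b, π / 2 - b}, NecessaryConditions y t) :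
    EqOn x y (Icc 0 (π / 2)) := by
  have hb := h.angle_lt
  have hb0 := h.angle_pos
  have hpi := pi_pos
  obtain ⟨-, a1, a2⟩ := h.explicit hn
  obtain ⟨-, a1', a2'⟩ := h'.explicit hn'
  have hu : ∀ t ∈ Icc 0 (π / 2 - b), velMu x t = velMu y t ∧ velNu x t = velNu y t := by
    intro t ht
    rcases le_total t b with hle | hle
    · rw [(a1 t ⟨ht.1, hle⟩).1, (a1 t ⟨ht.1, hle⟩).2, (a1' t ⟨ht.1, hle⟩).1,
        (a1' t ⟨ht.1, hle⟩).2]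
      exact ⟨rfl, rfl⟩
    · rw [(a2 t ⟨hle, ht.2⟩).1, (a2 t ⟨hle, ht.2⟩).2, (a2' t ⟨hle, ht.2⟩).1,
        (a2' t ⟨hle, ht.2⟩).2]
      exact ⟨rfl, rfl⟩
  have key : ∀ t ∈ Icc 0 (π / 2 - b), x t = y t := by
    intro t ht
    have hsub : Icc 0 t ⊆ Icc 0 (π / 2) := Icc_subset_Icc_right (by linarith [ht.2])
    have hx0 := h.framed.cont0.mono hsub
    have hx1 := h.framed.cont1.mono hsub
    have hy0 := h'.framed.cont0.mono hsub
    have hy1 := h'.framed.cont1.mono hsub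
    have d0 := eq_of_hasDerivAt_zero_off_finite (f := fun s => x s 0 - y s 0) ∅ ht.1
      (by fun_prop) (fun s hs _ => by
        have hs' : s ∈ Ioo 0 (π / 2) := ⟨hs.1, by linarith [hs.2, ht.2]⟩
        have e := hu s ⟨hs.1.le, by linarith [hs.2, ht.2]⟩
        exact ((h.framed.deriv0 s hs').sub (h'.framed.deriv0 s hs')).congr_deriv
          (by rw [e.1, e.2]; ring))
    have d1 := eq_of_hasDerivAt_zero_off_finite (f := fun s => x s 1 - y s 1) ∅ ht.1
      (by fun_prop) (fun s hs _ => by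
        have hs' : s ∈ Ioo 0 (π / 2) := ⟨hs.1, by linarith [hs.2, ht.2]⟩
        have e := hu s ⟨hs.1.le, by linarith [hs.2, ht.2]⟩
        exact ((h.framed.deriv1 s hs').sub (h'.framed.deriv1 s hs')).congr_deriv
          (by rw [e.1, e.2]; ring))
    simp only [h.framed.start, h'.framed.start, sub_self] at d0 d1
    apply plane_ext <;> linarith
  intro t ht
  rcases le_total t (π / 2 - b) with hle | hle
  · exact key t ⟨ht.1, hle⟩
  · have hs : π / 2 - t ∈ Icc 0 (π / 2) := ⟨by linarith [ht.2], by linarith [ht.1]⟩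
    have e1 := h.symmetric (π / 2 - t) hs
    have e2 := h'.symmetric (π / 2 - t) hs
    have e3 := key (π / 2 - t) ⟨hs.1, by linarith⟩
    have e4 := key (π / 4) ⟨by linarith, by linarith⟩
    rw [sub_sub_cancel] at e1 e2
    apply plane_ext
    · rw [e1.1, e2.1, e3, e4]
    · rw [e1.2, e2.2, e3]

end Uniqueness

end

/-! ### The constants -/

lemma rpow_third_pow {r : ℝ} (hr : 0 ≤ r) : (r ^ (1 / 3 : ℝ)) ^ 3 = r := by
  have := rpow_inv_natCast_pow hr (n := 3) (by norm_num)
  simpa using this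

lemma rpow_third_eq {r y : ℝ} (hy : 0 ≤ y) (h : y ^ 3 = r) : r ^ (1 / 3 : ℝ) = y := by
  rw [← h]
  have := pow_rpow_inv_natCast hy (n := 3) (by norm_num)
  simpa using this

lemma sqrt_two_sq : √2 ^ 2 = 2 := sq_sqrt (by norm_num)

lemma sqrt_two_gt : 1.414 < √2 := by
  rw [lt_sqrt (by norm_num)]; norm_num

lemma sqrt_two_lt : √2 < 1.415 := by
  rw [sqrt_lt' (by norm_num)]; norm_num

lemma rpow_third_mul_self : (√2 + 1) ^ (1 / 3 : ℝ) * (√2 - 1) ^ (1 / 3 : ℝ) = 1 := by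
  have h := sqrt_two_gt
  rw [← mul_rpow (by linarith) (by linarith)]
  have : (√2 + 1) * (√2 - 1) = 1 := by linear_combination sqrt_two_sq
  rw [this, one_rpow]

lemma tan_beta_eq :
    tan beta = 1 / 2 * ((√2 + 1) ^ (1 / 3 : ℝ) - (√2 - 1) ^ (1 / 3 : ℝ)) := by
  rw [beta, tan_arctan]

/-- Cardano: the two cube roots satisfy p q = 1 and p^3 - q^3 = 2, so d = p - q solves d^3 + 3 d =
2. -/
lemma tan_beta_cubic : 4 * tan beta ^ 3 + 3 * tan beta = 1 := by
  have h := sqrt_two_gt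
  have h1 := rpow_third_pow (r := √2 + 1) (by linarith)
  have h2 := rpow_third_pow (r := √2 - 1) (by linarith)
  have h3 := rpow_third_mul_self
  rw [tan_beta_eq]
  set p := (√2 + 1) ^ (1 / 3 : ℝ)
  set q := (√2 - 1) ^ (1 / 3 : ℝ)
  linear_combination 1 / 2 * h1 - 1 / 2 * h2 - 3 / 2 * (p - q) * h3

lemma tan_beta_gt : 0.29 < tan beta := by
  have h := tan_beta_cubic
  by_contra! hle
  nlinarith [sq_nonneg (tan beta + 0.29), sq_nonneg (tan beta), sq_nonneg (tan beta - 0.29)]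

lemma tan_beta_lt : tan beta < 0.3 := by
  have h := tan_beta_cubic
  by_contra! hle
  nlinarith [sq_nonneg (tan beta + 0.3), sq_nonneg (tan beta), sq_nonneg (tan beta - 0.3)]

lemma beta_pos : 0 < beta := by
  have h := tan_beta_gt
  rw [tan_beta_eq] at h
  unfold beta
  rw [arctan_pos]; linarith

lemma beta_lt : beta < π / 4 := by
  have h := tan_beta_lt
  rw [tan_beta_eq] at h
  unfold beta
  rw [← arctan_one]
  exact arctan_strictMono (by linarith)

lemma cos_beta_pos : 0 < cos beta := cos_arctan_pos _

lemma sin_beta_pos : 0 < sin beta :=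
  sin_pos_of_pos_of_lt_pi beta_pos (by linarith [beta_lt, pi_pos])

lemma sin_beta : sin beta = tan beta * cos beta := (tan_mul_cos cos_beta_pos.ne').symm

lemma cos_beta_sq : cos beta ^ 2 * (1 + tan beta ^ 2) = 1 := by
  have := sin_sq_add_cos_sq beta
  rw [sin_beta] at this
  linear_combination this

/-- The positive root of a depressed cubic in the relevant range. -/
lemma depressed_cubic_unique {p q r s : ℝ} (hr : 0 < r) (hs : p < s ^ 2) (hs0 : 0 < s)
    (h1 : r ^ 3 = p * r + q) (h2 : s ^ 3 = p * s + q) : r = s := by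
  have : (r - s) * (r ^ 2 + r * s + s ^ 2 - p) = 0 := by linear_combination h1 - h2
  rcases mul_eq_zero.1 this with h | h
  · linarith
  · nlinarith [mul_pos hr hs0, sq_nonneg r]

/-- Conjugates m ± n√2 of norm k^3 have cube roots with product k, so cubing the sum of the roots
yields a depressed cubic. This decodes the nested radicals of the theorem. -/
lemma cubes_sum {m n k : ℝ} (hk : 0 ≤ k) (hn : 0 ≤ n) (hlt : 0 < m - n * √2)
    (hN : m ^ 2 - 2 * n ^ 2 = k ^ 3) :
    0 < (m + n * √2) ^ (1 / 3 : ℝ) + (m - n * √2) ^ (1 / 3 : ℝ) ∧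
    ((m + n * √2) ^ (1 / 3 : ℝ) + (m - n * √2) ^ (1 / 3 : ℝ)) ^ 3 =
      3 * k * ((m + n * √2) ^ (1 / 3 : ℝ) + (m - n * √2) ^ (1 / 3 : ℝ)) + 2 * m := by
  have hpos : 0 < m + n * √2 := by
    have : 0 ≤ n * √2 := by positivity
    linarith
  have h1 := rpow_third_pow hpos.le
  have h2 := rpow_third_pow hlt.le
  have h3 : (m + n * √2) ^ (1 / 3 : ℝ) * (m - n * √2) ^ (1 / 3 : ℝ) = k := by
    rw [← mul_rpow hpos.le hlt.le]
    refine rpow_third_eq hk ?_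
    linear_combination -hN + n ^ 2 * sqrt_two_sq
  have h4 := rpow_pos_of_pos hpos (1 / 3 : ℝ)
  have h5 := rpow_pos_of_pos hlt (1 / 3 : ℝ)
  set p := (m + n * √2) ^ (1 / 3 : ℝ)
  set q := (m - n * √2) ^ (1 / 3 : ℝ)
  exact ⟨by positivity, by linear_combination h1 + h2 + 3 * (p + q) * h3⟩

/-- Dividing the cubic by tan^3 gives z^3 = 3 z^2 + 4 for z = 1/tan β; squaring leaves an equation
in w = z^2. -/
lemma inv_tan_beta_sq : ∃ w : ℝ, w * tan beta ^ 2 = 1 ∧ 11 < w ∧ w ^ 3 = (3 * w + 4) ^ 2 := by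
  have h0 := tan_beta_gt
  have h1 := tan_beta_lt
  have h := tan_beta_cubic
  have hT : 0 < tan beta := by linarith
  refine ⟨1 / tan beta ^ 2, by field_simp, ?_, ?_⟩
  · rw [lt_div_iff₀ (by positivity)]; nlinarith
  · field_simp
    linear_combination -(4 * tan beta ^ 3 + 3 * tan beta + 1) * h

/-- As 71^2 - 2·8^2 = 17^3, the sum of cube roots solves r^3 = 51 r + 142. So does w - 3, and w > 11
makes it the only positive solution. -/
lemma cubes_sum_rad : ∀ w : ℝ, w * tan beta ^ 2 = 1 →
    4 + (71 + 8 * √2) ^ (1 / 3 : ℝ) + (71 - 8 * √2) ^ (1 / 3 : ℝ) = 1 + w := by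
  intro w hw
  obtain ⟨w', hw', hgt, hcub⟩ := inv_tan_beta_sq
  have hT : 0 < tan beta ^ 2 := by have := tan_beta_gt; positivity
  have : w = w' := by
    have : (w - w') * tan beta ^ 2 = 0 := by linarith
    rcases mul_eq_zero.1 this with h | h <;> linarith
  subst this
  obtain ⟨h1, h2⟩ := cubes_sum (m := 71) (n := 8) (k := 17) (by norm_num) (by norm_num)
    (by linarith [sqrt_two_lt]) (by norm_num)
  have := depressed_cubic_unique (p := 51) (q := 142) (s := w - 3) h1 (by nlinarith)
    (by linarith) (by linarith) (by linear_combination hcub)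
  linarith

/-- The square of `rad` is 1 + cot^2 β. -/
lemma rad_mul_sin_beta : rad * sin beta = 1 := by
  obtain ⟨w, hw, hgt, -⟩ := inv_tan_beta_sq
  have e : rad = √(1 + w) := by rw [rad, cubes_sum_rad w hw]
  have hs := sin_beta_pos
  have hsq : (√(1 + w) * sin beta) ^ 2 = 1 := by
    rw [mul_pow, sq_sqrt (by linarith), sin_beta]
    linear_combination cos beta ^ 2 * hw + cos_beta_sq
  rw [e]
  exact (pow_eq_one_iff_of_nonneg (by positivity) (by norm_num)).1 hsq

lemma a1_mul_sin_beta : 4 * a1 * sin beta = 1 := by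
  rw [a1]; linear_combination rad_mul_sin_beta

/-- The value of `t / 2 + π / 8` at the critical angle. -/
def tau : ℝ := beta / 2 + π / 8

lemma tau_pos : 0 < tau := by have := beta_pos; have := pi_pos; unfold tau; positivity

lemma tau_lt : tau < π / 4 := by have := beta_lt; unfold tau; linarith

lemma sin_tau_pos : 0 < sin tau := sin_pos_of_pos_of_lt_pi tau_pos (by linarith [tau_lt, pi_pos])

lemma cos_tau_pos : 0 < cos tau :=
  cos_pos_of_mem_Ioo ⟨by linarith [tau_pos, pi_pos], by linarith [tau_lt, pi_pos]⟩

/-- From 2τ = β + π/4 one gets tan 2τ = (1 + T)/(1 - T) with T = tan β. By the cubic, the two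
possible values of tan τ are 2T and -1/(2T), and the sign decides. -/
lemma sin_tau : sin tau = 2 * tan beta * cos tau := by
  have hT := tan_beta_gt
  have hT' := tan_beta_lt
  have hcub := tan_beta_cubic
  have hS := sin_tau_pos
  have hC := cos_tau_pos
  have hb := cos_beta_pos
  have h2 : 2 * tau = beta + π / 4 := by unfold tau; ring
  have e1 : sin (2 * tau) = √2 / 2 * (sin beta + cos beta) := by
    rw [h2, sin_add, cos_pi_div_four, sin_pi_div_four]; ring
  have e2 : cos (2 * tau) = √2 / 2 * (cos beta - sin beta) := by
    rw [h2, cos_add, cos_pi_div_four, sin_pi_div_four]; ring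
  rw [sin_two_mul, sin_beta] at e1
  rw [cos_two_mul', sin_beta] at e2
  set T := tan beta
  have e3 : 2 * sin tau * cos tau * (1 - T) = (cos tau ^ 2 - sin tau ^ 2) * (1 + T) := by
    linear_combination (1 - T) * e1 - (1 + T) * e2
  have e4 : (sin tau - 2 * T * cos tau) * (2 * T * sin tau + cos tau) * (1 + T) = 0 := by
    linear_combination (2 * T) * e3 - sin tau * cos tau * hcub
  have h5 : 0 < (2 * T * sin tau + cos tau) * (1 + T) := by positivity
  rw [mul_assoc] at e4
  rcases mul_eq_zero.1 e4 with h | h <;> linarith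

lemma cos_tau_sq : cos tau ^ 2 * (1 + 4 * tan beta ^ 2) = 1 := by
  have := sin_sq_add_cos_sq tau
  rw [sin_tau] at this
  linear_combination this

lemma sin_tau_mul_cos_beta : sin tau * cos beta = 2 * sin beta * cos tau := by
  rw [sin_tau, sin_beta]; ring

/-- With w = 1/tan^2 β, (2/sin τ)^2 = 4 + w. The norm of 420619 + 15104√2 is 5609^3, and the cubic
for w makes (4 + w)^2 - 83 a root of the corresponding depressed cubic. -/
lemma rpow_quarter : (83 + (420619 + 15104 * √2) ^ (1 / 3 : ℝ) +
    (420619 - 15104 * √2) ^ (1 / 3 : ℝ)) ^ (1 / 4 : ℝ) = 2 / sin tau := by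
  obtain ⟨w, hw, hgt, hcub⟩ := inv_tan_beta_sq
  obtain ⟨h1, h2⟩ := cubes_sum (m := 420619) (n := 15104) (k := 5609) (by norm_num) (by norm_num)
    (by linarith [sqrt_two_lt]) (by norm_num)
  have e := depressed_cubic_unique (p := 3 * 5609) (q := 841238) (s := (4 + w) ^ 2 - 83) h1
    (by nlinarith [sq_nonneg ((4 + w) ^ 2 - 83 - 142)]) (by nlinarith) (by linarith)
    (by linear_combination (w ^ 3 + 33 * w ^ 2 + 312 * w + 912) * hcub)
  have hS := sin_tau_pos
  have hq : (2 / sin tau) ^ 4 = (4 + w) ^ 2 := by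
    have : (2 / sin tau) ^ 2 = 4 + w := by
      have hs2 : sin tau ^ 2 * (4 + w) = 4 := by
        rw [sin_tau]
        linear_combination 4 * cos_tau_sq + 4 * cos tau ^ 2 * hw
      field_simp
      linarith
    calc (2 / sin tau) ^ 4 = ((2 / sin tau) ^ 2) ^ 2 := by ring
      _ = _ := by rw [this]
  have : 83 + (420619 + 15104 * √2) ^ (1 / 3 : ℝ) + (420619 - 15104 * √2) ^ (1 / 3 : ℝ) =
      (2 / sin tau) ^ 4 := by rw [hq]; linarith
  rw [this]
  have := pow_rpow_inv_natCast (x := 2 / sin tau) (by positivity) (n := 4) (by norm_num)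
  simpa using this

/-- The factor √(2(2 - √2)) is 1/cos(π/8). With `f2_eq`, the vector (f1, f2) has length 2/(3 sin τ)
and direction -π/8, so the middle piece is a sinusoid in t/2 + π/8. -/
lemma f1_eq : f1 = 2 / (3 * sin tau) * cos (π / 8) := by
  have hc : 0 < cos (π / 8) :=
    cos_pos_of_mem_Ioo ⟨by linarith [pi_pos], by linarith [pi_pos]⟩
  have hS := sin_tau_pos
  have h2 := sqrt_two_lt
  have h3 := sqrt_two_sq
  have hsq : √(2 * (2 - √2)) * cos (π / 8) = 1 := by
    have : (√(2 * (2 - √2)) * cos (π / 8)) ^ 2 = 1 := by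
      rw [mul_pow, sq_sqrt (by linarith), cos_pi_div_eight, div_pow, sq_sqrt (by positivity)]
      linear_combination (-1 / 2) * h3
    exact (pow_eq_one_iff_of_nonneg (by positivity) (by norm_num)).1 this
  have hne : √(2 * (2 - √2)) ≠ 0 := by
    intro h0; rw [h0] at hsq; simp at hsq
  rw [f1, rpow_quarter]
  field_simp
  linarith

lemma sin_pi_div_eight_eq : sin (π / 8) = (√2 - 1) * cos (π / 8) := by
  have h2 := sqrt_two_lt
  have h1 := sqrt_two_gt
  have h3 := sqrt_two_sq
  rw [cos_pi_div_eight, sin_pi_div_eight]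
  have : √(2 - √2) = (√2 - 1) * √(2 + √2) := by
    rw [sqrt_eq_iff_eq_sq (by linarith) (mul_nonneg (by linarith) (sqrt_nonneg _)), mul_pow,
      sq_sqrt (by positivity)]
    linear_combination (-√2) * h3
  rw [this]; ring

lemma f2_eq : f2 = -(2 / (3 * sin tau) * sin (π / 8)) := by
  rw [f2, f1_eq, sin_pi_div_eight_eq]; ring

/-- The amplitude of the derivative in the middle phase. -/
def amp : ℝ := 1 / sin tau

lemma amp_mul_sin_tau : amp * sin tau = 1 := one_div_mul_cancel sin_tau_pos.ne'

lemma amp_pos : 0 < amp := one_div_pos.2 sin_tau_pos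

lemma a1_pos : 0 < a1 := by
  have := a1_mul_sin_beta
  have := sin_beta_pos
  by_contra! h
  nlinarith

/-- This is continuity of v at β; `amp_mul_sin_tau` says that the middle piece has u(β) = 0. -/
lemma amp_mul_cos_tau : amp * cos tau = 2 * a1 * cos beta := by
  have h1 := amp_mul_sin_tau
  have h2 := a1_mul_sin_beta
  have h3 := sin_tau_mul_cos_beta
  have h4 := sin_beta_pos
  have : (amp * cos tau - 2 * a1 * cos beta) * (2 * sin beta) = 0 := by
    linear_combination -cos beta * h2 - amp * h3 + cos beta * h1
  rcases mul_eq_zero.1 this with h | h <;> linarith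

lemma a1_cos_beta_mul : 4 * a1 * cos beta * tan beta = 1 := by
  have h2 := a1_mul_sin_beta
  rw [sin_beta] at h2
  linear_combination h2

/-- The quantity equals 1/(2 tan β), so the decimal bounds on tan β control it. It is v(β) + 1 and
governs all later sign estimates. -/
lemma a1_cos_beta_gt : 1.66 < 2 * a1 * cos beta := by
  have h1 := a1_cos_beta_mul
  have h2 := tan_beta_lt
  have h3 := tan_beta_gt
  by_contra! h
  have : 0 < a1 * cos beta := mul_pos a1_pos cos_beta_pos
  nlinarith

lemma a1_cos_beta_lt : 2 * a1 * cos beta < 1.73 := by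
  have h1 := a1_cos_beta_mul
  have h2 := tan_beta_lt
  have h3 := tan_beta_gt
  by_contra! h
  nlinarith

lemma a1_lt : a1 < 0.91 := by
  have h1 := a1_cos_beta_lt
  have h2 := a1_mul_sin_beta
  have h3 := sin_sq_add_cos_sq beta
  have h4 : 4 * a1 ^ 2 = (2 * a1 * cos beta) ^ 2 + 1 / 4 := by
    linear_combination -4 * a1 ^ 2 * h3 + (1 / 4) * (4 * a1 * sin beta + 1) * h2
  have h5 : 0 < 2 * a1 * cos beta := by have := a1_pos; have := cos_beta_pos; positivity
  by_contra! h
  nlinarith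

/-! ### The frame components of the derivative -/

/-- The component along `mu` of the derivative of the path. -/
def ambiU (t : ℝ) : ℝ :=
  if t < beta then 1 / 2 - 2 * a1 * sin t
  else if t ≤ π / 2 - beta then 1 - amp * sin (t / 2 + π / 8) else 1 - 2 * a1 * sin t

/-- The component along `nu` of the derivative of the path. -/
def ambiV (t : ℝ) : ℝ :=
  if t < beta then 2 * a1 * cos t - 1
  else if t ≤ π / 2 - beta then amp * cos (t / 2 + π / 8) - 1 else 2 * a1 * cos t - 1 / 2

/-- Twice the horizontal coordinate of the axis of symmetry. -/
def axis2 : ℝ := 2 - 8 / 3 * a1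

/-- The reflection across the axis of symmetry. -/
def mirror (p : Plane) : Plane := !₂[axis2 - p 0, p 1]

lemma mirror_zero (p : Plane) : mirror p 0 = axis2 - p 0 := by simp [mirror]

lemma mirror_one (p : Plane) : mirror p 1 = p 1 := by simp [mirror]

lemma mirror_mirror (p : Plane) : mirror (mirror p) = p := by
  apply plane_ext <;> simp [mirror]

/-! ### Coordinates, symmetry and gluing of the three pieces. -/

lemma x1_zero (t : ℝ) :
    x1 t 0 = cos t * (a1 * cos t - 1) - sin t * (a1 * sin t - 1 / 2) + (1 - a1) := by
  simp [x1, rot]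

lemma x1_one (t : ℝ) :
    x1 t 1 = sin t * (a1 * cos t - 1) + cos t * (a1 * sin t - 1 / 2) + 1 / 2 := by
  simp [x1, rot]

lemma x5_zero (t : ℝ) :
    x5 t 0 = cos t * (a1 * cos t - 1 / 2) - sin t * (a1 * sin t - 1) + (1 - 5 / 3 * a1) := by
  simp [x5, rot]

lemma x5_one (t : ℝ) :
    x5 t 1 = sin t * (a1 * cos t - 1 / 2) + cos t * (a1 * sin t - 1) + 1 / 2 := by
  simp [x5, rot]

lemma x6_cos (t : ℝ) :
    f1 * cos (t / 2) + f2 * sin (t / 2) = 2 / 3 * amp * cos (t / 2 + π / 8) := by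
  rw [f1_eq, f2_eq, cos_add, amp]
  field_simp [sin_tau_pos.ne']
  ring

lemma x6_sin (t : ℝ) :
    -f2 * cos (t / 2) + f1 * sin (t / 2) = 2 / 3 * amp * sin (t / 2 + π / 8) := by
  rw [f1_eq, f2_eq, sin_add, amp]
  field_simp [sin_tau_pos.ne']
  ring

lemma x6_zero (t : ℝ) : x6 t 0 = cos t * (2 / 3 * amp * cos (t / 2 + π / 8) - 1) -
    sin t * (2 / 3 * amp * sin (t / 2 + π / 8) - 1) + (1 - 4 / 3 * a1) := by
  rw [← x6_cos, ← x6_sin]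
  simp [x6, rot]

lemma x6_one (t : ℝ) : x6 t 1 = sin t * (2 / 3 * amp * cos (t / 2 + π / 8) - 1) +
    cos t * (2 / 3 * amp * sin (t / 2 + π / 8) - 1) + 1 / 2 := by
  rw [← x6_cos, ← x6_sin]
  simp [x6, rot]

lemma cos_half_reflect (t : ℝ) : cos ((π / 2 - t) / 2 + π / 8) = sin (t / 2 + π / 8) := by
  rw [← cos_pi_div_two_sub]; ring_nf

lemma sin_half_reflect (t : ℝ) : sin ((π / 2 - t) / 2 + π / 8) = cos (t / 2 + π / 8) := by
  rw [← sin_pi_div_two_sub]; ring_nf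

/-- Under t ↦ π/2 - t the outer pieces are exchanged and the middle one, defined on a closed
interval, goes to itself, so the case distinctions match at the break points too. Through this
symmetry, facts about A and B give those about C and D. -/
lemma ambiPath_reflect (t : ℝ) : ambiPath (π / 2 - t) = mirror (ambiPath t) := by
  have hb := beta_lt
  unfold ambiPath
  split_ifs <;> try (exfalso; linarith)
  all_goals apply plane_ext
  all_goals simp only [mirror_zero, mirror_one, x1_zero, x1_one, x5_zero, x5_one, x6_zero, x6_one,
    cos_half_reflect, sin_half_reflect, cos_pi_div_two_sub, sin_pi_div_two_sub, axis2]
  all_goals ring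

lemma ambiU_reflect (t : ℝ) : ambiU (π / 2 - t) = -ambiV t := by
  have hb := beta_lt
  unfold ambiU ambiV
  split_ifs <;> try (exfalso; linarith)
  all_goals simp only [sin_half_reflect, sin_pi_div_two_sub]
  all_goals ring

lemma ambiV_reflect (t : ℝ) : ambiV (π / 2 - t) = -ambiU t := by
  have := ambiU_reflect (π / 2 - t)
  rw [sub_sub_cancel] at this
  linarith

lemma x1_beta : x1 beta = x6 beta := by
  have e : beta / 2 + π / 8 = tau := rfl
  have h1 := amp_mul_sin_tau
  have h2 := amp_mul_cos_tau
  have h3 := a1_mul_sin_beta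
  have hsc := sin_sq_add_cos_sq beta
  apply plane_ext
  · rw [x1_zero, x6_zero, e, mul_assoc _ amp, mul_assoc _ amp, h1, h2]
    linear_combination (-1 / 3) * a1 * hsc - sin beta / 6 * h3
  · rw [x1_one, x6_one, e, mul_assoc _ amp, mul_assoc _ amp, h1, h2]
    linear_combination cos beta / 6 * h3

lemma hasDerivAt_x1_zero (t : ℝ) : HasDerivAt (fun s => x1 s 0)
    ((1 / 2 - 2 * a1 * sin t) * cos t - (2 * a1 * cos t - 1) * sin t) t := by
  simp only [x1_zero]
  have hc := hasDerivAt_cos t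
  have hs := hasDerivAt_sin t
  exact (((hc.mul ((hc.const_mul a1).sub_const 1)).sub
    (hs.mul ((hs.const_mul a1).sub_const (1 / 2)))).add_const _).congr_deriv (by ring)

lemma hasDerivAt_x1_one (t : ℝ) : HasDerivAt (fun s => x1 s 1)
    ((1 / 2 - 2 * a1 * sin t) * sin t + (2 * a1 * cos t - 1) * cos t) t := by
  simp only [x1_one]
  have hc := hasDerivAt_cos t
  have hs := hasDerivAt_sin t
  exact (((hs.mul ((hc.const_mul a1).sub_const 1)).add
    (hc.mul ((hs.const_mul a1).sub_const (1 / 2)))).add_const _).congr_deriv (by ring)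

lemma hasDerivAt_cos_half (t : ℝ) : HasDerivAt (fun s => cos (s / 2 + π / 8))
    (-sin (t / 2 + π / 8) / 2) t :=
  (((hasDerivAt_id t).div_const 2).add_const (π / 8)).cos.congr_deriv (by simp; ring)

lemma hasDerivAt_sin_half (t : ℝ) : HasDerivAt (fun s => sin (s / 2 + π / 8))
    (cos (t / 2 + π / 8) / 2) t :=
  (((hasDerivAt_id t).div_const 2).add_const (π / 8)).sin.congr_deriv (by simp; ring)

lemma hasDerivAt_x6_zero (t : ℝ) : HasDerivAt (fun s => x6 s 0)
    ((1 - amp * sin (t / 2 + π / 8)) * cos t - (amp * cos (t / 2 + π / 8) - 1) * sin t) t := by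
  simp only [x6_zero]
  have hc := hasDerivAt_cos t
  have hs := hasDerivAt_sin t
  exact (((hc.mul (((hasDerivAt_cos_half t).const_mul (2 / 3 * amp)).sub_const 1)).sub
    (hs.mul (((hasDerivAt_sin_half t).const_mul (2 / 3 * amp)).sub_const 1))).add_const
    _).congr_deriv (by ring)

lemma hasDerivAt_x6_one (t : ℝ) : HasDerivAt (fun s => x6 s 1)
    ((1 - amp * sin (t / 2 + π / 8)) * sin t + (amp * cos (t / 2 + π / 8) - 1) * cos t) t := by
  simp only [x6_one]
  have hc := hasDerivAt_cos t
  have hs := hasDerivAt_sin t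
  exact (((hs.mul (((hasDerivAt_cos_half t).const_mul (2 / 3 * amp)).sub_const 1)).add
    (hc.mul (((hasDerivAt_sin_half t).const_mul (2 / 3 * amp)).sub_const 1))).add_const
    _).congr_deriv (by ring)

lemma hasDerivAt_of_eq_left_right {f g k : ℝ → ℝ} {c d : ℝ} (hf : HasDerivAt f d c)
    (hg : HasDerivAt g d c) (hl : k =ᶠ[𝓝[≤] c] f) (hr : k =ᶠ[𝓝[≥] c] g) :
    HasDerivAt k d c := by
  have h1 : HasDerivWithinAt k d (Iic c) c :=
    hf.hasDerivWithinAt.congr_of_eventuallyEq hl (hl.self_of_nhdsWithin self_mem_Iic)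
  have h2 : HasDerivWithinAt k d (Ici c) c :=
    hg.hasDerivWithinAt.congr_of_eventuallyEq hr (hr.self_of_nhdsWithin self_mem_Ici)
  have := h1.union h2
  rwa [Iic_union_Ici, hasDerivWithinAt_univ] at this

lemma ambiPath_of_lt {t : ℝ} (ht : t < beta) : ambiPath t = x1 t := if_pos ht

lemma ambiPath_of_mem {t : ℝ} (ht : t ∈ Icc beta (π / 2 - beta)) : ambiPath t = x6 t := by
  rw [ambiPath, if_neg (not_lt.2 ht.1), if_pos ht.2]

lemma ambiPath_of_le {t : ℝ} (ht : t ≤ beta) : ambiPath t = x1 t := by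
  rcases ht.eq_or_lt with rfl | h
  · rw [x1_beta]; exact ambiPath_of_mem ⟨le_rfl, by linarith [beta_lt]⟩
  · exact ambiPath_of_lt h

lemma ambiU_of_lt {t : ℝ} (ht : t < beta) : ambiU t = 1 / 2 - 2 * a1 * sin t := if_pos ht

lemma ambiU_of_mem {t : ℝ} (ht : t ∈ Icc beta (π / 2 - beta)) :
    ambiU t = 1 - amp * sin (t / 2 + π / 8) := by
  rw [ambiU, if_neg (not_lt.2 ht.1), if_pos ht.2]

lemma ambiU_of_gt {t : ℝ} (ht : π / 2 - beta < t) : ambiU t = 1 - 2 * a1 * sin t := by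
  rw [ambiU, if_neg (not_lt.2 (by linarith [beta_lt])), if_neg (not_le.2 ht)]

lemma ambiV_of_lt {t : ℝ} (ht : t < beta) : ambiV t = 2 * a1 * cos t - 1 := if_pos ht

lemma ambiV_of_mem {t : ℝ} (ht : t ∈ Icc beta (π / 2 - beta)) :
    ambiV t = amp * cos (t / 2 + π / 8) - 1 := by
  rw [ambiV, if_neg (not_lt.2 ht.1), if_pos ht.2]

lemma ambiV_of_gt {t : ℝ} (ht : π / 2 - beta < t) : ambiV t = 2 * a1 * cos t - 1 / 2 := by
  rw [ambiV, if_neg (not_lt.2 (by linarith [beta_lt])), if_neg (not_le.2 ht)]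

lemma beta_mem : beta ∈ Icc beta (π / 2 - beta) := ⟨le_rfl, by linarith [beta_lt]⟩

lemma ambiU_beta : ambiU beta = 0 := by
  rw [ambiU_of_mem beta_mem]
  have := amp_mul_sin_tau
  rw [tau] at this; linarith

lemma ambiV_beta : ambiV beta = 2 * a1 * cos beta - 1 := by
  rw [ambiV_of_mem beta_mem]
  have := amp_mul_cos_tau
  rw [tau] at this; linarith

lemma ambiU_of_le {t : ℝ} (ht : t ≤ beta) : ambiU t = 1 / 2 - 2 * a1 * sin t := by
  rcases ht.eq_or_lt with rfl | h
  · rw [ambiU_beta]; linarith [a1_mul_sin_beta]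
  · exact ambiU_of_lt h

lemma ambiV_of_le {t : ℝ} (ht : t ≤ beta) : ambiV t = 2 * a1 * cos t - 1 := by
  rcases ht.eq_or_lt with rfl | h
  · exact ambiV_beta
  · exact ambiV_of_lt h

lemma hasDerivAt_ambiPath_zero_aux {t : ℝ} (ht : t < π / 2 - beta) :
    HasDerivAt (fun s => ambiPath s 0) (ambiU t * cos t - ambiV t * sin t) t := by
  have hb := beta_lt
  rcases lt_trichotomy t beta with h | rfl | h
  · rw [ambiU_of_lt h, ambiV_of_lt h]
    refine (hasDerivAt_x1_zero t).congr_of_eventuallyEq ?_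
    filter_upwards [Iio_mem_nhds h] with s hs
    rw [ambiPath_of_lt hs]
  · refine hasDerivAt_of_eq_left_right (f := fun s => x1 s 0) (g := fun s => x6 s 0) ?_ ?_ ?_ ?_
    · rw [ambiU_of_le le_rfl, ambiV_of_le le_rfl]; exact hasDerivAt_x1_zero _
    · rw [ambiU_of_mem beta_mem, ambiV_of_mem beta_mem]; exact hasDerivAt_x6_zero _
    · filter_upwards [self_mem_nhdsWithin] with s hs
      rw [ambiPath_of_le hs]
    · filter_upwards [Icc_mem_nhdsGE ht] with s hs
      rw [ambiPath_of_mem hs]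
  · rw [ambiU_of_mem ⟨h.le, ht.le⟩, ambiV_of_mem ⟨h.le, ht.le⟩]
    refine (hasDerivAt_x6_zero t).congr_of_eventuallyEq ?_
    filter_upwards [Ioo_mem_nhds h ht] with s hs
    rw [ambiPath_of_mem (Ioo_subset_Icc_self hs)]

lemma hasDerivAt_ambiPath_one_aux {t : ℝ} (ht : t < π / 2 - beta) :
    HasDerivAt (fun s => ambiPath s 1) (ambiU t * sin t + ambiV t * cos t) t := by
  have hb := beta_lt
  rcases lt_trichotomy t beta with h | rfl | h
  · rw [ambiU_of_lt h, ambiV_of_lt h]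
    refine (hasDerivAt_x1_one t).congr_of_eventuallyEq ?_
    filter_upwards [Iio_mem_nhds h] with s hs
    rw [ambiPath_of_lt hs]
  · refine hasDerivAt_of_eq_left_right (f := fun s => x1 s 1) (g := fun s => x6 s 1) ?_ ?_ ?_ ?_
    · rw [ambiU_of_le le_rfl, ambiV_of_le le_rfl]; exact hasDerivAt_x1_one _
    · rw [ambiU_of_mem beta_mem, ambiV_of_mem beta_mem]; exact hasDerivAt_x6_one _
    · filter_upwards [self_mem_nhdsWithin] with s hs
      rw [ambiPath_of_le hs]
    · filter_upwards [Icc_mem_nhdsGE ht] with s hs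
      rw [ambiPath_of_mem hs]
  · rw [ambiU_of_mem ⟨h.le, ht.le⟩, ambiV_of_mem ⟨h.le, ht.le⟩]
    refine (hasDerivAt_x6_one t).congr_of_eventuallyEq ?_
    filter_upwards [Ioo_mem_nhds h ht] with s hs
    rw [ambiPath_of_mem (Ioo_subset_Icc_self hs)]

/-- Only the junction at β is examined directly; the one at π/2 - β is its mirror image. -/
lemma hasDerivAt_ambiPath_zero (t : ℝ) :
    HasDerivAt (fun s => ambiPath s 0) (ambiU t * cos t - ambiV t * sin t) t := by
  have hb := beta_lt
  rcases lt_or_ge t (π / 2 - beta) with h | h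
  · exact hasDerivAt_ambiPath_zero_aux h
  · have h1 := (hasDerivAt_ambiPath_zero_aux (t := π / 2 - t) (by linarith)).comp_const_sub
      (π / 2) t
    have e : (fun s => ambiPath s 0) = fun s => axis2 - ambiPath (π / 2 - s) 0 := by
      ext s; rw [ambiPath_reflect, mirror_zero]; ring
    rw [e]
    refine (h1.const_sub axis2).congr_deriv ?_
    rw [ambiU_reflect, ambiV_reflect, cos_pi_div_two_sub, sin_pi_div_two_sub]; ring

lemma hasDerivAt_ambiPath_one (t : ℝ) :
    HasDerivAt (fun s => ambiPath s 1) (ambiU t * sin t + ambiV t * cos t) t := by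
  have hb := beta_lt
  rcases lt_or_ge t (π / 2 - beta) with h | h
  · exact hasDerivAt_ambiPath_one_aux h
  · have h1 := (hasDerivAt_ambiPath_one_aux (t := π / 2 - t) (by linarith)).comp_const_sub
      (π / 2) t
    have e : (fun s => ambiPath s 1) = fun s => ambiPath (π / 2 - s) 1 := by
      ext s; rw [ambiPath_reflect, mirror_one]
    rw [e]
    refine h1.congr_deriv ?_
    rw [ambiU_reflect, ambiV_reflect, cos_pi_div_two_sub, sin_pi_div_two_sub]; ring

lemma continuous_ambiU : Continuous ambiU := by
  have hb := beta_lt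
  have e : ambiU = fun t => if beta ≤ t then
      (if t ≤ π / 2 - beta then 1 - amp * sin (t / 2 + π / 8) else 1 - 2 * a1 * sin t)
      else 1 / 2 - 2 * a1 * sin t := by
    ext t
    unfold ambiU
    by_cases h : t < beta
    · rw [if_pos h, if_neg (not_le.2 h)]
    · rw [if_neg h, if_pos (not_lt.1 h)]
  rw [e]
  refine Continuous.if_le (Continuous.if_le (by fun_prop) (by fun_prop) continuous_id
    continuous_const ?_) (by fun_prop) continuous_const continuous_id ?_
  · rintro t rfl
    rw [sin_half_reflect, sin_pi_div_two_sub, ← amp_mul_cos_tau, tau]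
  · rintro t rfl
    rw [if_pos beta_mem.2]
    have := amp_mul_sin_tau
    rw [tau] at this
    linarith [a1_mul_sin_beta]

lemma continuous_ambiV : Continuous ambiV := by
  have e : ambiV = fun t => -ambiU (π / 2 - t) := by
    ext t; rw [ambiU_reflect, neg_neg]
  rw [e]
  exact (continuous_ambiU.comp (by fun_prop)).neg

lemma hasDerivAt_ambiPath (t : ℝ) : HasDerivAt ambiPath
    !₂[ambiU t * cos t - ambiV t * sin t, ambiU t * sin t + ambiV t * cos t] t :=
  hasDerivAt_plane.2 ⟨by simpa using hasDerivAt_ambiPath_zero t,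
    by simpa using hasDerivAt_ambiPath_one t⟩

lemma ambiPath_start : ambiPath 0 = 0 := by
  rw [ambiPath_of_lt beta_pos]
  apply plane_ext
  · rw [x1_zero]; simp
  · rw [x1_one]; simp

lemma framed_ambiPath : Framed ambiPath ambiU ambiV where
  start := ambiPath_start
  cont := fun t _ => (hasDerivAt_ambiPath t).continuousAt.continuousWithinAt
  cont_u := continuous_ambiU.continuousOn
  cont_v := continuous_ambiV.continuousOn
  deriv0 := fun t _ => hasDerivAt_ambiPath_zero t
  deriv1 := fun t _ => hasDerivAt_ambiPath_one t

lemma contDiff_ambiPath : ContDiff ℝ 1 ambiPath := by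
  rw [contDiff_one_iff_deriv]
  refine ⟨fun t => (hasDerivAt_ambiPath t).differentiableAt, ?_⟩
  have : deriv ambiPath = fun t =>
      !₂[ambiU t * cos t - ambiV t * sin t, ambiU t * sin t + ambiV t * cos t] := by
    ext1 t; exact (hasDerivAt_ambiPath t).deriv
  rw [this]
  have := continuous_ambiU
  have := continuous_ambiV
  fun_prop

/-! ### Derivatives of the frame components -/

lemma hasDerivAt_one_phase {t : ℝ} (ht : t < beta) :
    HasDerivAt ambiU (-1 - ambiV t) t ∧ HasDerivAt ambiV (-1 / 2 + ambiU t) t := by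
  rw [ambiU_of_lt ht, ambiV_of_lt ht]
  constructor
  · refine HasDerivAt.congr_of_eventuallyEq (f := fun t => 1 / 2 - 2 * a1 * sin t) ?_ ?_
    · exact (((hasDerivAt_sin t).const_mul (2 * a1)).const_sub (1 / 2)).congr_deriv (by ring)
    · filter_upwards [Iio_mem_nhds ht] with s hs using ambiU_of_lt hs
  · refine HasDerivAt.congr_of_eventuallyEq (f := fun t => 2 * a1 * cos t - 1) ?_ ?_
    · exact (((hasDerivAt_cos t).const_mul (2 * a1)).sub_const 1).congr_deriv (by ring)
    · filter_upwards [Iio_mem_nhds ht] with s hs using ambiV_of_lt hs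

lemma hasDerivAt_two_phase {t : ℝ} (ht : t ∈ Ioo beta (π / 2 - beta)) :
    HasDerivAt ambiU (-(1 + ambiV t) / 2) t ∧ HasDerivAt ambiV (-(1 - ambiU t) / 2) t := by
  rw [ambiU_of_mem (Ioo_subset_Icc_self ht), ambiV_of_mem (Ioo_subset_Icc_self ht)]
  constructor
  · refine HasDerivAt.congr_of_eventuallyEq (f := fun t => 1 - amp * sin (t / 2 + π / 8)) ?_ ?_
    · exact (((hasDerivAt_sin_half t).const_mul amp).const_sub 1).congr_deriv (by ring)
    · filter_upwards [Ioo_mem_nhds ht.1 ht.2] with s hs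
        using ambiU_of_mem (Ioo_subset_Icc_self hs)
  · refine HasDerivAt.congr_of_eventuallyEq (f := fun t => amp * cos (t / 2 + π / 8) - 1) ?_ ?_
    · exact (((hasDerivAt_cos_half t).const_mul amp).sub_const 1).congr_deriv (by ring)
    · filter_upwards [Ioo_mem_nhds ht.1 ht.2] with s hs
        using ambiV_of_mem (Ioo_subset_Icc_self hs)

lemma hasDerivAt_three_phase {t : ℝ} (ht : π / 2 - beta < t) :
    HasDerivAt ambiU (-1 / 2 - ambiV t) t ∧ HasDerivAt ambiV (-1 + ambiU t) t := by
  rw [ambiU_of_gt ht, ambiV_of_gt ht]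
  constructor
  · refine HasDerivAt.congr_of_eventuallyEq (f := fun t => 1 - 2 * a1 * sin t) ?_ ?_
    · exact (((hasDerivAt_sin t).const_mul (2 * a1)).const_sub 1).congr_deriv (by ring)
    · filter_upwards [Ioi_mem_nhds ht] with s hs using ambiU_of_gt hs
  · refine HasDerivAt.congr_of_eventuallyEq (f := fun t => 2 * a1 * cos t - 1 / 2) ?_ ?_
    · exact (((hasDerivAt_cos t).const_mul (2 * a1)).sub_const (1 / 2)).congr_deriv (by ring)
    · filter_upwards [Ioi_mem_nhds ht] with s hs using ambiV_of_gt hs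

/-! ### Signs and bounds of the frame components -/

lemma ambiU_mid_nonpos {t : ℝ} (ht : t ∈ Icc beta (π / 2 - beta)) : ambiU t ≤ 0 := by
  have h1 := ht.1
  have h2 := ht.2
  have hpi := pi_pos
  have hb := beta_pos
  have : sin tau ≤ sin (t / 2 + π / 8) :=
    sin_le_sin_of_le_of_le_pi_div_two (by linarith [tau_pos]) (by linarith) (by unfold tau; linarith)
  rw [ambiU_of_mem ht]
  nlinarith [amp_mul_sin_tau, amp_pos]

lemma ambiU_mid_neg {t : ℝ} (ht : t ∈ Ioc beta (π / 2 - beta)) : ambiU t < 0 := by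
  have h1 := ht.1
  have h2 := ht.2
  have hpi := pi_pos
  have hb := beta_pos
  have : sin tau < sin (t / 2 + π / 8) :=
    sin_lt_sin_of_lt_of_le_pi_div_two (by linarith [tau_pos]) (by linarith) (by unfold tau; linarith)
  rw [ambiU_of_mem ⟨h1.le, h2⟩]
  nlinarith [amp_mul_sin_tau, amp_pos]

/-- In the middle phase t/2 + π/8 runs from τ to π/2 - τ, so the sine is at most cos τ and
`amp_mul_cos_tau` applies. -/
lemma ambiU_mid_gt {t : ℝ} (ht : t ∈ Icc beta (π / 2 - beta)) : -0.73 < ambiU t := by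
  have h1 := ht.1
  have h2 := ht.2
  have hpi := pi_pos
  have hb := beta_pos
  have : sin (t / 2 + π / 8) ≤ cos tau := by
    rw [← sin_pi_div_two_sub]
    exact sin_le_sin_of_le_of_le_pi_div_two (by linarith) (by linarith [tau_pos])
      (by unfold tau; linarith)
  rw [ambiU_of_mem ht]
  nlinarith [amp_mul_cos_tau, amp_pos, a1_cos_beta_lt]

lemma reflect_mem {t : ℝ} (ht : t ∈ Icc beta (π / 2 - beta)) :
    π / 2 - t ∈ Icc beta (π / 2 - beta) := ⟨by linarith [ht.2], by linarith [ht.1]⟩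

lemma ambiV_mid_nonneg {t : ℝ} (ht : t ∈ Icc beta (π / 2 - beta)) : 0 ≤ ambiV t := by
  have := ambiU_mid_nonpos (reflect_mem ht)
  rw [ambiU_reflect] at this
  linarith

lemma ambiV_mid_pos {t : ℝ} (ht : t ∈ Ico beta (π / 2 - beta)) : 0 < ambiV t := by
  have := ambiU_mid_neg (t := π / 2 - t) ⟨by linarith [ht.2], by linarith [ht.1]⟩
  rw [ambiU_reflect] at this
  linarith

lemma ambiV_mid_lt {t : ℝ} (ht : t ∈ Icc beta (π / 2 - beta)) : ambiV t < 0.73 := by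
  have := ambiU_mid_gt (reflect_mem ht)
  rw [ambiU_reflect] at this
  linarith

lemma ambiU_first_pos {t : ℝ} (ht : t ∈ Ico 0 beta) : 0 < ambiU t := by
  rw [ambiU_of_lt ht.2]
  have : sin t < sin beta := sin_lt_sin_of_lt_of_le_pi_div_two
    (by linarith [ht.1, pi_pos]) (by linarith [beta_lt, pi_pos]) ht.2
  nlinarith [a1_mul_sin_beta, a1_pos]

lemma ambiU_first_le {t : ℝ} (ht : t ∈ Icc 0 beta) : ambiU t ≤ 1 / 2 := by
  rw [ambiU_of_le ht.2]
  have : 0 ≤ sin t := sin_nonneg_of_nonneg_of_le_pi ht.1 (by linarith [ht.2, beta_lt, pi_pos])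
  nlinarith [a1_pos]

lemma ambiV_first_gt {t : ℝ} (ht : t ∈ Icc 0 beta) : 0.66 < ambiV t := by
  rw [ambiV_of_le ht.2]
  have : cos beta ≤ cos t :=
    cos_le_cos_of_nonneg_of_le_pi ht.1 (by linarith [beta_lt, pi_pos]) ht.2
  nlinarith [a1_cos_beta_gt, a1_pos]

lemma ambi_cases {t : ℝ} (ht : t ∈ Icc 0 (π / 2)) :
    t ∈ Ico 0 beta ∨ t ∈ Icc beta (π / 2 - beta) ∨ t ∈ Ioc (π / 2 - beta) (π / 2) := by
  rcases lt_or_ge t beta with h | h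
  · exact Or.inl ⟨ht.1, h⟩
  · rcases le_or_gt t (π / 2 - beta) with h' | h'
    · exact Or.inr (Or.inl ⟨h, h'⟩)
    · exact Or.inr (Or.inr ⟨h', ht.2⟩)

lemma reflect_first {t : ℝ} (ht : t ∈ Ioc (π / 2 - beta) (π / 2)) : π / 2 - t ∈ Ico 0 beta :=
  ⟨by linarith [ht.2], by linarith [ht.1]⟩

lemma reflect_Icc {t : ℝ} (ht : t ∈ Icc 0 (π / 2)) : π / 2 - t ∈ Icc 0 (π / 2) :=
  ⟨by linarith [ht.2], by linarith [ht.1]⟩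

lemma ambiU_neg {t : ℝ} (ht : t ∈ Ioc beta (π / 2)) : ambiU t < 0 := by
  rcases le_or_gt t (π / 2 - beta) with h | h
  · exact ambiU_mid_neg ⟨ht.1, h⟩
  · have := ambiV_first_gt (Ico_subset_Icc_self (reflect_first ⟨h, ht.2⟩))
    rw [ambiV_reflect] at this
    linarith

lemma ambiU_nonpos {t : ℝ} (ht : t ∈ Icc beta (π / 2)) : ambiU t ≤ 0 := by
  rcases ht.1.eq_or_lt with rfl | h
  · exact ambiU_beta.le
  · exact (ambiU_neg ⟨h, ht.2⟩).le

lemma ambiV_pos {t : ℝ} (ht : t ∈ Ico 0 (π / 2 - beta)) : 0 < ambiV t := by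
  have := ambiU_neg (t := π / 2 - t) ⟨by linarith [ht.2], by linarith [ht.1]⟩
  rw [ambiU_reflect] at this
  linarith

lemma ambiU_lt_one {t : ℝ} (ht : t ∈ Icc 0 (π / 2)) : ambiU t < 1 := by
  rcases lt_or_ge t beta with h | h
  · linarith [ambiU_first_le ⟨ht.1, h.le⟩]
  · linarith [ambiU_nonpos ⟨h, ht.2⟩]

lemma neg_one_lt_ambiV {t : ℝ} (ht : t ∈ Icc 0 (π / 2)) : -1 < ambiV t := by
  have := ambiU_lt_one (reflect_Icc ht)
  rw [ambiU_reflect] at this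
  linarith

lemma off_finset_cases {t : ℝ} (ht : t ∈ Ioo 0 (π / 2))
    (hS : t ∉ ({beta, π / 2 - beta} : Finset ℝ)) :
    t ∈ Ioo 0 beta ∨ t ∈ Ioo beta (π / 2 - beta) ∨ t ∈ Ioo (π / 2 - beta) (π / 2) := by
  simp only [Finset.mem_insert, Finset.mem_singleton, not_or] at hS
  rcases lt_or_gt_of_ne hS.1 with h1 | h1
  · exact Or.inl ⟨ht.1, h1⟩
  · rcases lt_or_gt_of_ne hS.2 with h2 | h2
    · exact Or.inr (Or.inl ⟨h1, h2⟩)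
    · exact Or.inr (Or.inr ⟨h2, ht.2⟩)

lemma innerConvex_ambi : InnerConvex ambiU ambiV {beta, π / 2 - beta} := by
  constructor
  · intro t ht hS
    rcases off_finset_cases ht hS with h | h | h
    · exact ⟨_, (hasDerivAt_one_phase h.2).1, by linarith⟩
    · exact ⟨_, (hasDerivAt_two_phase h).1, by linarith [ambiV_mid_lt (Ioo_subset_Icc_self h)]⟩
    · exact ⟨_, (hasDerivAt_three_phase h.1).1, by linarith⟩
  · intro t ht hS
    rcases off_finset_cases ht hS with h | h | h
    · exact ⟨_, (hasDerivAt_one_phase h.2).2, by linarith⟩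
    · exact ⟨_, (hasDerivAt_two_phase h).2, by linarith [ambiU_mid_gt (Ioo_subset_Icc_self h)]⟩
    · exact ⟨_, (hasDerivAt_three_phase h.1).2, by linarith⟩

lemma outerConvex_ambi : OuterConvex ambiU ambiV {beta, π / 2 - beta} := by
  constructor
  · intro t ht hS
    rcases off_finset_cases ht hS with h | h | h
    · exact ⟨_, (hasDerivAt_one_phase h.2).1, by linarith⟩
    · exact ⟨_, (hasDerivAt_two_phase h).1,
        by linarith [ambiV_mid_nonneg (Ioo_subset_Icc_self h)]⟩
    · exact ⟨_, (hasDerivAt_three_phase h.1).1, by linarith⟩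
  · intro t ht hS
    rcases off_finset_cases ht hS with h | h | h
    · exact ⟨_, (hasDerivAt_one_phase h.2).2, by linarith⟩
    · exact ⟨_, (hasDerivAt_two_phase h).2,
        by linarith [ambiU_mid_nonpos (Ioo_subset_Icc_self h)]⟩
    · exact ⟨_, (hasDerivAt_three_phase h.1).2, by linarith⟩

/-! ### Symmetry of the shape and of the contact points -/

lemma Kmu_mirror (p : Plane) (t : ℝ) : Kmu ambiPath (mirror p) (π / 2 - t) = Knu ambiPath p t := by
  simp only [Kmu, Knu, ambiPath_reflect, mirror_zero, mirror_one, cos_pi_div_two_sub,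
    sin_pi_div_two_sub]
  ring

lemma Knu_mirror (p : Plane) (t : ℝ) : Knu ambiPath (mirror p) (π / 2 - t) = Kmu ambiPath p t := by
  simp only [Kmu, Knu, ambiPath_reflect, mirror_zero, mirror_one, cos_pi_div_two_sub,
    sin_pi_div_two_sub]
  ring

lemma mirror_mem_shape {p : Plane} (hp : p ∈ shape ambiPath) : mirror p ∈ shape ambiPath := by
  rw [mem_shape ambiPath_start] at hp ⊢
  obtain ⟨h1, h2, h3⟩ := hp
  refine ⟨?_, ?_, fun s hs => ?_⟩
  · have := Knu_mirror p (π / 2)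
    rw [sub_self] at this
    rwa [this]
  · have := Kmu_mirror p 0
    rw [sub_zero] at this
    rwa [this]
  · obtain ⟨a, b, c⟩ := h3 _ (reflect_Icc hs)
    have e1 := Kmu_mirror p (π / 2 - s)
    have e2 := Knu_mirror p (π / 2 - s)
    rw [sub_sub_cancel] at e1 e2
    rw [e1, e2]
    exact ⟨b, a, c.symm⟩

/-- The touching points of the path. -/
abbrev ambiTouch (k : Contact) (t : ℝ) : Plane := touch ambiPath ambiU ambiV k t

/-- The effect of the reflection on the types of contact points. -/
def swap : Contact → Contact
  | .x => .x
  | .A => .C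
  | .B => .D
  | .C => .A
  | .D => .B

lemma ambiTouch_reflect (k : Contact) (t : ℝ) :
    ambiTouch (swap k) (π / 2 - t) = mirror (ambiTouch k t) := by
  cases k <;> apply plane_ext <;> simp only [ambiTouch, swap, touch, offMu, offNu,
    mirror_zero, mirror_one, PiLp.toLp_apply, Matrix.cons_val_zero, Matrix.cons_val_one,
    ambiU_reflect, ambiV_reflect, cos_pi_div_two_sub, sin_pi_div_two_sub, ambiPath_reflect] <;> ring

section

/-! ### Monotonicity of contact points -/

lemma continuousOn_coord {f : ℝ → Plane} {s : Set ℝ} (hf : ContinuousOn f s) (i : Fin 2) :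
    ContinuousOn (fun t => f t i) s := by fun_prop

section Monotone

variable {x : ℝ → Plane} {u v : ℝ → ℝ} {S : Finset ℝ}

/-- The velocity of A is a nonnegative multiple of nu, which points left and up. -/
lemma Framed.touch_A_monotone (h : Framed x u v) (hc : OuterConvex u v S) {s t : ℝ}
    (hs : 0 ≤ s) (hst : s ≤ t) (ht : t ≤ π / 2) :
    touch x u v .A t 0 ≤ touch x u v .A s 0 ∧ touch x u v .A s 1 ≤ touch x u v .A t 1 := by
  have hcont := (h.continuousOn_touch .A).mono (Icc_subset_Icc hs ht)
  have c0 : ContinuousOn (fun r => touch x u v .A r 0) (Icc s t) := continuousOn_coord hcont 0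
  have c1 : ContinuousOn (fun r => touch x u v .A r 1) (Icc s t) := continuousOn_coord hcont 1
  have hd : ∀ r ∈ Ioo s t, r ∉ S → ∃ d, 0 ≤ d ∧
      HasDerivAt (fun r => touch x u v .A r 0) (d * -sin r) r ∧
      HasDerivAt (fun r => touch x u v .A r 1) (d * cos r) r ∧ 0 ≤ sin r ∧ 0 ≤ cos r := by
    intro r hr hrS
    have hr' : r ∈ Ioo 0 (π / 2) := ⟨hs.trans_lt hr.1, hr.2.trans_le ht⟩
    obtain ⟨d, hd, hle⟩ := hc.mu_ge r hr' hrS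
    have := hasDerivAt_plane.1 (h.hasDerivAt_touch_A hr' hd)
    exact ⟨1 + d + v r, by linarith, by simpa [nu] using this.1, by simpa [nu] using this.2,
      sin_nonneg_of_nonneg_of_le_pi hr'.1.le (by linarith [hr'.2, pi_pos]),
      cos_nonneg_of_mem_Icc ⟨by linarith [hr'.1, pi_pos], hr'.2.le⟩⟩
  constructor
  · have := le_of_hasDerivAt_nonneg_off_finite S hst c0.neg fun r hr hrS => by
      obtain ⟨d, h0, h1, -, h3, -⟩ := hd r hr hrS
      exact ⟨_, h1.neg, by nlinarith⟩
    simp only [Pi.neg_apply] at this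
    linarith
  · exact le_of_hasDerivAt_nonneg_off_finite S hst c1 fun r hr hrS => by
      obtain ⟨d, h0, -, h2, -, h4⟩ := hd r hr hrS
      exact ⟨_, h2, mul_nonneg h0 h4⟩

lemma Framed.touch_B_monotone (h : Framed x u v) (hc : InnerConvex u v S) {s t : ℝ}
    (hs : 0 ≤ s) (hst : s ≤ t) (ht : t ≤ π / 2) :
    touch x u v .B s 0 ≤ touch x u v .B t 0 ∧ touch x u v .B t 1 ≤ touch x u v .B s 1 := by
  have hcont := (h.continuousOn_touch .B).mono (Icc_subset_Icc hs ht)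
  have c0 : ContinuousOn (fun r => touch x u v .B r 0) (Icc s t) := continuousOn_coord hcont 0
  have c1 : ContinuousOn (fun r => touch x u v .B r 1) (Icc s t) := continuousOn_coord hcont 1
  have hd : ∀ r ∈ Ioo s t, r ∉ S → ∃ d, d ≤ 0 ∧
      HasDerivAt (fun r => touch x u v .B r 0) (d * -sin r) r ∧
      HasDerivAt (fun r => touch x u v .B r 1) (d * cos r) r ∧ 0 ≤ sin r ∧ 0 ≤ cos r := by
    intro r hr hrS
    have hr' : r ∈ Ioo 0 (π / 2) := ⟨hs.trans_lt hr.1, hr.2.trans_le ht⟩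
    obtain ⟨d, hd, hle⟩ := hc.mu_le r hr' hrS
    have := hasDerivAt_plane.1 (h.hasDerivAt_touch_B hr' hd)
    exact ⟨_, hle, by simpa [nu] using this.1, by simpa [nu] using this.2,
      sin_nonneg_of_nonneg_of_le_pi hr'.1.le (by linarith [hr'.2, pi_pos]),
      cos_nonneg_of_mem_Icc ⟨by linarith [hr'.1, pi_pos], hr'.2.le⟩⟩
  constructor
  · exact le_of_hasDerivAt_nonneg_off_finite S hst c0 fun r hr hrS => by
      obtain ⟨d, h0, h1, -, h3, -⟩ := hd r hr hrS
      exact ⟨_, h1, by nlinarith⟩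
  · have := le_of_hasDerivAt_nonneg_off_finite S hst c1.neg fun r hr hrS => by
      obtain ⟨d, h0, -, h2, -, h4⟩ := hd r hr hrS
      exact ⟨_, h2.neg, by nlinarith⟩
    simp only [Pi.neg_apply] at this
    linarith

/-- All mu s lie in the first quadrant and all nu s in the second, so a single extreme touching
point controls every point of a quadrant with that vertex. -/
lemma Kmu_mono {p q : Plane} (h0 : p 0 ≤ q 0) (h1 : p 1 ≤ q 1) {s : ℝ}
    (hs : s ∈ Icc 0 (π / 2)) : Kmu x p s ≤ Kmu x q s := by
  have hsin : 0 ≤ sin s := sin_nonneg_of_nonneg_of_le_pi hs.1 (by linarith [hs.2, pi_pos])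
  have hcos : 0 ≤ cos s := cos_nonneg_of_mem_Icc ⟨by linarith [hs.1, pi_pos], hs.2⟩
  unfold Kmu
  gcongr

lemma Knu_mono {p q : Plane} (h0 : q 0 ≤ p 0) (h1 : p 1 ≤ q 1) {s : ℝ}
    (hs : s ∈ Icc 0 (π / 2)) : Knu x p s ≤ Knu x q s := by
  have hsin : 0 ≤ sin s := sin_nonneg_of_nonneg_of_le_pi hs.1 (by linarith [hs.2, pi_pos])
  have hcos : 0 ≤ cos s := cos_nonneg_of_mem_Icc ⟨by linarith [hs.1, pi_pos], hs.2⟩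
  unfold Knu
  gcongr

/-- At time t both 1 - Kmu and its derivative vanish for A(t), so the comparison solution is zero.
-/
lemma Framed.Kmu_touch_A_le (h : Framed x u v) (hc : OuterConvex u v S) {s t : ℝ}
    (ht : t ∈ Icc 0 (π / 2)) (hs : s ∈ Icc 0 (π / 2)) : Kmu x (touch x u v .A t) s ≤ 1 := by
  have := h.Kmu_le hc (touch x u v .A t) ht hs
  rw [Kmu_touch, Knu_touch] at this
  simp only [offMu, offNu, sub_self, zero_mul, add_zero] at this
  linarith

lemma Framed.Knu_touch_C_le (h : Framed x u v) (hc : OuterConvex u v S) {s t : ℝ}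
    (ht : t ∈ Icc 0 (π / 2)) (hs : s ∈ Icc 0 (π / 2)) : Knu x (touch x u v .C t) s ≤ 1 := by
  have := h.Knu_le hc (touch x u v .C t) ht hs
  rw [Kmu_touch, Knu_touch] at this
  simp only [offMu, offNu, sub_self, zero_mul, neg_add_cancel, add_zero] at this
  linarith

lemma Framed.Kmu_touch_B_nonneg (h : Framed x u v) (hc : InnerConvex u v S) {s t : ℝ}
    (ht : t ∈ Icc 0 (π / 2)) (hs : s ∈ Icc 0 (π / 2)) : 0 ≤ Kmu x (touch x u v .B t) s := by
  have := h.Kmu_ge hc (touch x u v .B t) ht hs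
  rw [Kmu_touch, Knu_touch] at this
  simpa only [offMu, offNu, sub_self, zero_mul, add_zero] using this

/-! ### When the corner is not in the shape. -/

lemma eventually_neg_of_deriv_neg {f : ℝ → ℝ} {d t : ℝ} (hf : HasDerivAt f d t) (h0 : f t = 0)
    (hd : d < 0) : ∀ᶠ s in 𝓝[>] t, f s < 0 := by
  have h1 := (hasDerivAt_iff_tendsto_slope.1 hf).eventually_lt_const hd
  have h2 := h1.filter_mono (nhdsWithin_mono t (fun s (hs : t < s) => hs.ne'))
  filter_upwards [h2, self_mem_nhdsWithin] with s hs hts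
  rw [slope_def_field, h0, sub_zero, div_neg_iff] at hs
  have : 0 < s - t := sub_pos.2 hts
  rcases hs with hs | hs <;> linarith

lemma eventually_neg_of_deriv_pos {f : ℝ → ℝ} {d t : ℝ} (hf : HasDerivAt f d t) (h0 : f t = 0)
    (hd : 0 < d) : ∀ᶠ s in 𝓝[<] t, f s < 0 := by
  have h1 := (hasDerivAt_iff_tendsto_slope.1 hf).eventually_const_lt hd
  have h2 := h1.filter_mono (nhdsWithin_mono t (fun s (hs : s < t) => hs.ne))
  filter_upwards [h2, self_mem_nhdsWithin] with s hs hts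
  rw [slope_def_field, h0, sub_zero, div_pos_iff] at hs
  have : s - t < 0 := sub_neg.2 hts
  rcases hs with hs | hs <;> linarith

/-- The coordinates of the fixed point x t have derivatives -u and -v at time t; if both are
negative, the hallway leaves the point behind immediately afterwards. -/
lemma Framed.corner_notMem_of_pos (h : Framed x u v) {t : ℝ} (ht : t ∈ Ioo 0 (π / 2))
    (hu : 0 < u t) (hv : 0 < v t) : x t ∉ shape x := by
  intro hmem
  have h1 := eventually_neg_of_deriv_neg (h.hasDerivAt_Kmu (x t) ht) (Kmu_self t)
    (by rw [Knu_self]; linarith)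
  have h2 := eventually_neg_of_deriv_neg (h.hasDerivAt_Knu (x t) ht) (Knu_self t)
    (by rw [Kmu_self]; linarith)
  obtain ⟨s, ⟨h3, h4⟩, h5⟩ := ((h1.and h2).and (Ioo_mem_nhdsGT ht.2)).exists
  have := (((mem_shape h.start).1 hmem).2.2 s ⟨by linarith [ht.1, h5.1], h5.2.le⟩).2.2
  rcases this with h6 | h6 <;> linarith

lemma Framed.corner_notMem_of_neg (h : Framed x u v) {t : ℝ} (ht : t ∈ Ioo 0 (π / 2))
    (hu : u t < 0) (hv : v t < 0) : x t ∉ shape x := by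
  intro hmem
  have h1 := eventually_neg_of_deriv_pos (h.hasDerivAt_Kmu (x t) ht) (Kmu_self t)
    (by rw [Knu_self]; linarith)
  have h2 := eventually_neg_of_deriv_pos (h.hasDerivAt_Knu (x t) ht) (Knu_self t)
    (by rw [Kmu_self]; linarith)
  obtain ⟨s, ⟨h3, h4⟩, h5⟩ := ((h1.and h2).and (Ioo_mem_nhdsLT ht.1)).exists
  have := (((mem_shape h.start).1 hmem).2.2 s ⟨h5.1.le, by linarith [ht.2, h5.2]⟩).2.2
  rcases this with h6 | h6 <;> linarith

end Monotone

/-! ### Position of the contact points of the explicit path -/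

lemma zero_mem_I : (0 : ℝ) ∈ Icc 0 (π / 2) := ⟨le_rfl, by positivity⟩

lemma half_mem_I : π / 2 ∈ Icc 0 (π / 2) := ⟨by positivity, le_rfl⟩

/-- The abscissa of the left end of the flat part of the boundary. -/
def flatL : ℝ := 1 - 2 * a1

/-- The abscissa of the right end of the flat part of the boundary. -/
def flatR : ℝ := 1 - 2 / 3 * a1

lemma flatL_le_flatR : flatL ≤ flatR := by
  unfold flatL flatR; linarith [a1_pos]

lemma axis2_sub_flatR : axis2 - flatR = flatL := by unfold axis2 flatL flatR; ring

lemma axis2_sub_flatL : axis2 - flatL = flatR := by unfold axis2 flatL flatR; ring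

lemma ambiU_zero : ambiU 0 = 1 / 2 := by rw [ambiU_of_lt beta_pos]; simp

lemma ambiV_zero : ambiV 0 = 2 * a1 - 1 := by rw [ambiV_of_lt beta_pos]; simp

lemma touch_A_zero : ambiTouch .A 0 = !₂[1, 1 / 2] := by
  apply plane_ext <;> simp [touch, ambiPath_start, offMu, offNu, ambiU_zero]

lemma touch_C_zero : ambiTouch .C 0 = !₂[flatL, 1] := by
  apply plane_ext <;> simp [touch, ambiPath_start, offMu, offNu, ambiV_zero, flatL]

lemma touch_D_zero : ambiTouch .D 0 = !₂[flatL, 0] := by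
  apply plane_ext <;> simp [touch, ambiPath_start, offMu, offNu, ambiV_zero, flatL]

lemma touch_A_end : ambiTouch .A (π / 2) = !₂[flatR, 1] := by
  have := ambiTouch_reflect .C 0
  rw [sub_zero, touch_C_zero] at this
  rw [show Contact.A = swap .C from rfl, this]
  apply plane_ext <;> simp [mirror, axis2_sub_flatL]

lemma touch_B_end : ambiTouch .B (π / 2) = !₂[flatR, 0] := by
  have := ambiTouch_reflect .D 0
  rw [sub_zero, touch_D_zero] at this
  rw [show Contact.B = swap .D from rfl, this]
  apply plane_ext <;> simp [mirror, axis2_sub_flatL]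

/-- Such a point is left of and below A(π/2), which satisfies every mu-bound. -/
lemma Kmu_le_one_of_le_flatR {p : Plane} (h0 : p 0 ≤ flatR) (h1 : p 1 ≤ 1) {s : ℝ}
    (hs : s ∈ Icc 0 (π / 2)) : Kmu ambiPath p s ≤ 1 := by
  refine le_trans (Kmu_mono ?_ ?_ hs)
    (framed_ambiPath.Kmu_touch_A_le outerConvex_ambi half_mem_I hs)
  · change p 0 ≤ ambiTouch .A (π / 2) 0
    rw [touch_A_end]; simpa using h0
  · change p 1 ≤ ambiTouch .A (π / 2) 1
    rw [touch_A_end]; simpa using h1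

lemma Knu_le_one_of_flatL_le {p : Plane} (h0 : flatL ≤ p 0) (h1 : p 1 ≤ 1) {s : ℝ}
    (hs : s ∈ Icc 0 (π / 2)) : Knu ambiPath p s ≤ 1 := by
  refine le_trans (Knu_mono ?_ ?_ hs)
    (framed_ambiPath.Knu_touch_C_le outerConvex_ambi zero_mem_I hs)
  · change ambiTouch .C 0 0 ≤ p 0
    rw [touch_C_zero]; simpa using h0
  · change p 1 ≤ ambiTouch .C 0 1
    rw [touch_C_zero]; simpa using h1

lemma Kmu_nonneg_of_flatR_le {p : Plane} (h0 : flatR ≤ p 0) (h1 : 0 ≤ p 1) {s : ℝ}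
    (hs : s ∈ Icc 0 (π / 2)) : 0 ≤ Kmu ambiPath p s := by
  refine le_trans (framed_ambiPath.Kmu_touch_B_nonneg innerConvex_ambi half_mem_I hs)
    (Kmu_mono ?_ ?_ hs)
  · change ambiTouch .B (π / 2) 0 ≤ p 0
    rw [touch_B_end]; simpa using h0
  · change ambiTouch .B (π / 2) 1 ≤ p 1
    rw [touch_B_end]; simpa using h1

lemma ambiPath_end : ambiPath (π / 2) 1 = 0 := by
  have := ambiPath_reflect 0
  rw [sub_zero, ambiPath_start] at this
  rw [this, mirror_one]; simp

lemma mem_ambi {p : Plane} : p ∈ shape ambiPath ↔ 0 ≤ p 1 ∧ ∀ s ∈ Icc (0 : ℝ) (π / 2),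
    Kmu ambiPath p s ≤ 1 ∧ Knu ambiPath p s ≤ 1 ∧
      (0 ≤ Kmu ambiPath p s ∨ 0 ≤ Knu ambiPath p s) := by
  rw [mem_shape ambiPath_start]
  have e1 : Knu ambiPath p 0 = p 1 := by simp [Knu, ambiPath_start]
  have e2 : Kmu ambiPath p (π / 2) = p 1 := by simp [Kmu, ambiPath_end]
  rw [e1, e2]
  tauto

lemma touch_A_bounds {t : ℝ} (ht : t ∈ Icc 0 (π / 2)) :
    flatR ≤ ambiTouch .A t 0 ∧ ambiTouch .A t 0 ≤ 1 ∧ 1 / 2 ≤ ambiTouch .A t 1 ∧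
      ambiTouch .A t 1 ≤ 1 := by
  have h1 := framed_ambiPath.touch_A_monotone outerConvex_ambi le_rfl ht.1 ht.2
  have h2 := framed_ambiPath.touch_A_monotone outerConvex_ambi ht.1 ht.2 le_rfl
  change ambiTouch .A t 0 ≤ ambiTouch .A 0 0 ∧ ambiTouch .A 0 1 ≤ ambiTouch .A t 1 at h1
  change ambiTouch .A (π / 2) 0 ≤ ambiTouch .A t 0 ∧
    ambiTouch .A t 1 ≤ ambiTouch .A (π / 2) 1 at h2
  rw [touch_A_zero] at h1
  rw [touch_A_end] at h2
  simp only [Matrix.cons_val_zero, Matrix.cons_val_one] at h1 h2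
  exact ⟨h2.1, h1.1, h1.2, h2.2⟩

lemma touch_B_bounds {t : ℝ} (ht : t ∈ Icc 0 (π / 2)) :
    ambiTouch .B t 0 ≤ flatR ∧ 0 ≤ ambiTouch .B t 1 := by
  have h2 := framed_ambiPath.touch_B_monotone innerConvex_ambi ht.1 ht.2 le_rfl
  change ambiTouch .B t 0 ≤ ambiTouch .B (π / 2) 0 ∧
    ambiTouch .B (π / 2) 1 ≤ ambiTouch .B t 1 at h2
  rw [touch_B_end] at h2
  simpa using h2

lemma touch_B_beta : ambiTouch .B beta = ambiPath beta := by
  apply plane_ext <;> simp [touch, offMu, offNu, ambiU_beta]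

lemma ambiPath_zero_antitone {s t : ℝ} (hs : beta ≤ s) (hst : s ≤ t) (ht : t ≤ π / 2 - beta) :
    ambiPath t 0 ≤ ambiPath s 0 := by
  have := le_of_hasDerivAt_nonneg_off_finite (f := fun r => -ambiPath r 0) ∅ hst
    (fun r _ => (hasDerivAt_ambiPath_zero r).neg.continuousAt.continuousWithinAt)
    (fun r hr _ => ⟨_, (hasDerivAt_ambiPath_zero r).neg, by
      have hr' : r ∈ Icc beta (π / 2 - beta) := ⟨hs.trans hr.1.le, hr.2.le.trans ht⟩
      have h1 := ambiU_mid_nonpos hr'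
      have h2 := ambiV_mid_nonneg hr'
      have hb := beta_pos
      have hpi := pi_pos
      have h3 : 0 ≤ sin r := sin_nonneg_of_nonneg_of_le_pi (hb.le.trans hr'.1)
        (by linarith [hr'.2])
      have h4 : 0 ≤ cos r := cos_nonneg_of_mem_Icc ⟨by linarith [hr'.1], by linarith [hr'.2]⟩
      nlinarith⟩)
  linarith

lemma ambiPath_mid_le_flatR {t : ℝ} (ht : t ∈ Icc beta (π / 2 - beta)) :
    ambiPath t 0 ≤ flatR := by
  have h1 := ambiPath_zero_antitone le_rfl ht.1 ht.2
  have h2 := (touch_B_bounds (t := beta) ⟨beta_pos.le, by linarith [beta_lt, pi_pos]⟩).1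
  rw [touch_B_beta] at h2
  linarith

lemma ambiPath_mid_flatL_le {t : ℝ} (ht : t ∈ Icc beta (π / 2 - beta)) :
    flatL ≤ ambiPath t 0 := by
  have h1 := ambiPath_mid_le_flatR (reflect_mem ht)
  rw [ambiPath_reflect, mirror_zero] at h1
  linarith [axis2_sub_flatR]

lemma amp_lt : amp < 2 := by
  have h1 := amp_mul_sin_tau
  have h2 := amp_mul_cos_tau
  have h3 := sin_sq_add_cos_sq tau
  have h4 := a1_cos_beta_lt
  have h5 : amp ^ 2 = 1 + (2 * a1 * cos beta) ^ 2 := by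
    rw [← h2]
    linear_combination -amp ^ 2 * h3 + (amp * sin tau + 1) * h1
  have h6 : 0 < 2 * a1 * cos beta := by have := a1_pos; have := cos_beta_pos; positivity
  by_contra! h
  nlinarith

/-- With θ = |t/2 - π/8| the height is (2/3) amp cos 3θ - √2 cos 2θ + 1/2. Here cos 3θ ≤ cos 2θ and
(2/3) amp < 4/3 < √2. -/
lemma x6_height {t : ℝ} (ht : t ∈ Icc 0 (π / 2)) : x6 t 1 ≤ 1 / 2 := by
  have hpi := pi_pos
  set θ := |t / 2 - π / 8| with hθ
  have h0 : 0 ≤ θ := abs_nonneg _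
  have h1 : θ ≤ π / 8 := abs_le.2 ⟨by linarith [ht.1], by linarith [ht.2]⟩
  have e1 : sin t + cos t = √2 * cos (2 * θ) := by
    have : cos (2 * θ) = cos (t - π / 4) := by
      rw [hθ, ← cos_abs (t - π / 4)]
      congr 1
      rw [show t - π / 4 = 2 * (t / 2 - π / 8) by ring, abs_mul]; norm_num
    rw [this, cos_sub, cos_pi_div_four, sin_pi_div_four]
    linear_combination -(cos t + sin t) / 2 * sqrt_two_sq
  have e2 : sin t * cos (t / 2 + π / 8) + cos t * sin (t / 2 + π / 8) = cos (3 * θ) := by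
    have : cos (3 * θ) = cos (3 * (t / 2 - π / 8)) := by
      rw [hθ, ← cos_abs (3 * (t / 2 - π / 8)), abs_mul]; norm_num
    rw [this, ← sin_add, ← cos_pi_div_two_sub, ← cos_neg]
    congr 1; ring
  have h2 : cos (3 * θ) ≤ cos (2 * θ) :=
    cos_le_cos_of_nonneg_of_le_pi (by linarith) (by linarith) (by linarith)
  have h3 : 0 ≤ cos (2 * θ) := cos_nonneg_of_mem_Icc ⟨by linarith, by linarith⟩
  have h4 : x6 t 1 = 2 / 3 * amp * cos (3 * θ) - √2 * cos (2 * θ) + 1 / 2 := by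
    rw [x6_one, ← e1, ← e2]; ring
  rw [h4]
  have := amp_lt
  have := amp_pos
  have := sqrt_two_gt
  nlinarith

/-- In the first phase u, v > 0, so the corner rises towards its height at β. The bound keeps the
inner boundary below the axis of `rho`, so that the cut and its reflection do not separate Σ. -/
lemma ambiPath_height {t : ℝ} (ht : t ∈ Icc 0 (π / 2)) : ambiPath t 1 ≤ 1 / 2 := by
  have hpi := pi_pos
  have hb := beta_lt
  have first : ∀ t ∈ Ico 0 beta, ambiPath t 1 ≤ 1 / 2 := by
    intro t ht
    have h1 : ambiPath t 1 ≤ ambiPath beta 1 :=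
      le_of_hasDerivAt_nonneg_off_finite (f := fun r => ambiPath r 1) ∅ ht.2.le
        (fun r _ => (hasDerivAt_ambiPath_one r).continuousAt.continuousWithinAt)
        (fun r hr _ => ⟨_, hasDerivAt_ambiPath_one r, by
          have hr' : r ∈ Ico 0 beta := ⟨ht.1.trans hr.1.le, hr.2⟩
          have h1 := ambiU_first_pos hr'
          have h2 := ambiV_first_gt (Ico_subset_Icc_self hr')
          have h3 : 0 ≤ sin r := sin_nonneg_of_nonneg_of_le_pi hr'.1 (by linarith [hr'.2])
          have h4 : 0 ≤ cos r := cos_nonneg_of_mem_Icc ⟨by linarith [hr'.1], by linarith [hr'.2]⟩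
          have : 0 ≤ ambiV r := by linarith
          positivity⟩)
    have h2 := x6_height (t := beta) ⟨beta_pos.le, by linarith⟩
    rw [← ambiPath_of_mem beta_mem] at h2
    linarith
  rcases ambi_cases ht with h | h | h
  · exact first t h
  · rw [ambiPath_of_mem h]; exact x6_height ht
  · have := first _ (reflect_first h)
    rwa [ambiPath_reflect, mirror_one] at this

/-! ### Contact points in the shape -/

lemma touch_A_mem {t : ℝ} (ht : t ∈ Icc 0 (π / 2)) : ambiTouch .A t ∈ shape ambiPath := by
  obtain ⟨h1, h2, h3, h4⟩ := touch_A_bounds ht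
  refine mem_ambi.2 ⟨by linarith, fun s hs =>
    ⟨framed_ambiPath.Kmu_touch_A_le outerConvex_ambi ht hs, ?_, Or.inl ?_⟩⟩
  · exact Knu_le_one_of_flatL_le (flatL_le_flatR.trans h1) h4 hs
  · exact Kmu_nonneg_of_flatR_le h1 (by linarith) hs

lemma swap_mem {k : Contact} {t : ℝ} (h : ambiTouch k (π / 2 - t) ∈ shape ambiPath) :
    ambiTouch (swap k) t ∈ shape ambiPath := by
  have := mirror_mem_shape h
  rwa [← ambiTouch_reflect, sub_sub_cancel] at this

lemma touch_C_mem {t : ℝ} (ht : t ∈ Icc 0 (π / 2)) : ambiTouch .C t ∈ shape ambiPath :=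
  swap_mem (k := .A) (touch_A_mem (reflect_Icc ht))

lemma beta_mem_I : beta ∈ Icc 0 (π / 2) := ⟨beta_pos.le, by linarith [beta_lt, pi_pos]⟩

lemma touch_B_bounds' {t : ℝ} (ht : t ∈ Icc beta (π / 2)) :
    flatL ≤ ambiTouch .B t 0 ∧ ambiTouch .B t 1 ≤ 1 / 2 := by
  have h := framed_ambiPath.touch_B_monotone innerConvex_ambi beta_pos.le ht.1 ht.2
  change ambiTouch .B beta 0 ≤ ambiTouch .B t 0 ∧
    ambiTouch .B t 1 ≤ ambiTouch .B beta 1 at h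
  rw [touch_B_beta] at h
  exact ⟨(ambiPath_mid_flatL_le beta_mem).trans h.1, h.2.trans (ambiPath_height beta_mem_I)⟩

lemma touch_B_mem {t : ℝ} (ht : t ∈ Icc beta (π / 2)) : ambiTouch .B t ∈ shape ambiPath := by
  have ht' : t ∈ Icc 0 (π / 2) := ⟨beta_pos.le.trans ht.1, ht.2⟩
  obtain ⟨h1, h2⟩ := touch_B_bounds ht'
  obtain ⟨h3, h4⟩ := touch_B_bounds' ht
  exact mem_ambi.2 ⟨h2, fun s hs => ⟨Kmu_le_one_of_le_flatR h1 (by linarith) hs,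
    Knu_le_one_of_flatL_le h3 (by linarith) hs,
    Or.inl (framed_ambiPath.Kmu_touch_B_nonneg innerConvex_ambi ht' hs)⟩⟩

lemma touch_D_mem {t : ℝ} (ht : t ∈ Icc 0 (π / 2 - beta)) : ambiTouch .D t ∈ shape ambiPath :=
  swap_mem (k := .B) (touch_B_mem ⟨by linarith [ht.2], by linarith [ht.1]⟩)

lemma corner_mem {t : ℝ} (ht : t ∈ Icc beta (π / 2 - beta)) : ambiPath t ∈ shape ambiPath := by
  have hb := beta_pos
  have ht' : t ∈ Icc 0 (π / 2) := ⟨hb.le.trans ht.1, by linarith [ht.2]⟩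
  refine corner_mem_shape_of framed_ambiPath innerConvex_ambi ht' (ambiU_mid_nonpos ht)
    (ambiV_mid_nonneg ht) fun s hs => ?_
  have h := ambiPath_height ht'
  exact ⟨Kmu_le_one_of_le_flatR (ambiPath_mid_le_flatR ht) (by linarith) hs,
    Knu_le_one_of_flatL_le (ambiPath_mid_flatL_le ht) (by linarith) hs⟩

/-! ### The types of contact points in the three phases -/

lemma A_mem_gam {t : ℝ} (ht : t ∈ Ioo 0 (π / 2)) : Contact.A ∈ Gam ambiPath t :=
  ⟨ambiTouch .A t, mem_contactSet ht (touch_A_mem (Ioo_subset_Icc_self ht))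
    (mem_wall.2 ⟨Kmu_touch _ _, by
      rw [Knu_touch]; exact (ambiU_lt_one (Ioo_subset_Icc_self ht)).le⟩)⟩

lemma C_mem_gam {t : ℝ} (ht : t ∈ Ioo 0 (π / 2)) : Contact.C ∈ Gam ambiPath t :=
  ⟨ambiTouch .C t, mem_contactSet ht (touch_C_mem (Ioo_subset_Icc_self ht))
    (mem_wall.2 ⟨Knu_touch _ _, by
      rw [Kmu_touch]
      simp only [offMu]
      linarith [neg_one_lt_ambiV (Ioo_subset_Icc_self ht)]⟩)⟩

/-- At t = β the tangency point is the corner, which the open wall omits; it is a contact only as a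
limit from times with u < 0. -/
lemma B_mem_gam {t : ℝ} (ht : t ∈ Ico beta (π / 2)) : Contact.B ∈ Gam ambiPath t := by
  have hb := beta_pos
  refine ⟨ambiTouch .B t, framed_ambiPath.touch_mem_contactSet ⟨hb.le.trans ht.1, ht.2.le⟩
    (T := Ioo beta (π / 2)) ?_ (Ioo_subset_Ioo_left hb.le) fun s hs =>
    ⟨touch_B_mem (Ioo_subset_Icc_self hs), mem_wall.2 ⟨Kmu_touch _ _, ?_⟩⟩⟩
  · rw [closure_Ioo (by linarith [beta_lt, pi_pos])]
    exact Ico_subset_Icc_self ht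
  · rw [Knu_touch]
    exact ambiU_neg ⟨hs.1, hs.2.le⟩

lemma D_mem_gam {t : ℝ} (ht : t ∈ Ioc 0 (π / 2 - beta)) : Contact.D ∈ Gam ambiPath t := by
  have hb := beta_pos
  refine ⟨ambiTouch .D t, framed_ambiPath.touch_mem_contactSet ⟨ht.1.le, by linarith [ht.2]⟩
    (T := Ioo 0 (π / 2 - beta)) ?_ (Ioo_subset_Ioo_right (by linarith)) fun s hs =>
    ⟨touch_D_mem (Ioo_subset_Icc_self hs), mem_wall.2 ⟨Knu_touch _ _, ?_⟩⟩⟩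
  · rw [closure_Ioo (by linarith [beta_lt, pi_pos])]
    exact Ioc_subset_Icc_self ht
  · rw [Kmu_touch]
    simp only [offMu]
    linarith [ambiV_pos ⟨hs.1.le, hs.2⟩]

lemma x_mem_gam {t : ℝ} (ht : t ∈ Icc beta (π / 2 - beta)) : Contact.x ∈ Gam ambiPath t :=
  ⟨ambiPath t, mem_contactSet ⟨beta_pos.trans_le ht.1, by linarith [ht.2, beta_pos]⟩
    (corner_mem ht) rfl⟩

/-- Here u, v > 0: the corner is expelled, and a contact B would require u ≤ 0. -/
lemma gam_phase_one {t : ℝ} (ht : t ∈ Ioo 0 beta) : Gam ambiPath t = {.A, .C, .D} := by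
  have hb := beta_lt
  have hI : t ∈ Ioo 0 (π / 2) := ⟨ht.1, by linarith [ht.2, pi_pos]⟩
  have hu := ambiU_first_pos (Ioo_subset_Ico_self ht)
  have hv := ambiV_first_gt (Ioo_subset_Icc_self ht)
  ext k
  simp only [mem_insert_iff, mem_singleton_iff]
  cases k with
  | x =>
    simp only [reduceCtorEq, or_self, iff_false]
    intro h
    have := framed_ambiPath.touch_mem_shape h
    rw [touch_x] at this
    exact framed_ambiPath.corner_notMem_of_pos hI hu (by linarith) this
  | A => simpa using A_mem_gam hI
  | B =>
    simp only [reduceCtorEq, or_self, iff_false]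
    intro h
    linarith [framed_ambiPath.u_nonpos_of_gam h]
  | C => simpa using C_mem_gam hI
  | D => simpa using D_mem_gam ⟨ht.1, by linarith [ht.2]⟩

lemma gam_phase_two {t : ℝ} (ht : t ∈ Icc beta (π / 2 - beta)) :
    Gam ambiPath t = {.x, .A, .B, .C, .D} := by
  have hb := beta_pos
  have hI : t ∈ Ioo 0 (π / 2) := ⟨hb.trans_le ht.1, by linarith [ht.2]⟩
  ext k
  simp only [mem_insert_iff, mem_singleton_iff]
  cases k with
  | x => simpa using x_mem_gam ht
  | A => simpa using A_mem_gam hI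
  | B => simpa using B_mem_gam ⟨ht.1, hI.2⟩
  | C => simpa using C_mem_gam hI
  | D => simpa using D_mem_gam ⟨hI.1, ht.2⟩

lemma gam_phase_three {t : ℝ} (ht : t ∈ Ioo (π / 2 - beta) (π / 2)) :
    Gam ambiPath t = {.A, .B, .C} := by
  have hb := beta_lt
  have hI : t ∈ Ioo 0 (π / 2) := ⟨by linarith [ht.1, pi_pos], ht.2⟩
  have hr : π / 2 - t ∈ Ioo 0 beta := ⟨by linarith [ht.2], by linarith [ht.1]⟩
  have hu := ambiU_first_pos (Ioo_subset_Ico_self hr)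
  have hv := ambiV_first_gt (Ioo_subset_Icc_self hr)
  rw [ambiU_reflect] at hu
  rw [ambiV_reflect] at hv
  ext k
  simp only [mem_insert_iff, mem_singleton_iff]
  cases k with
  | x =>
    simp only [reduceCtorEq, or_self, iff_false]
    intro h
    have := framed_ambiPath.touch_mem_shape h
    rw [touch_x] at this
    exact framed_ambiPath.corner_notMem_of_neg hI (by linarith) (by linarith) this
  | A => simpa using A_mem_gam hI
  | B => simpa using B_mem_gam ⟨by linarith [ht.1], ht.2⟩
  | C => simpa using C_mem_gam hI
  | D =>
    simp only [reduceCtorEq, or_self, iff_false]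
    intro h
    linarith [framed_ambiPath.v_nonneg_of_gam h]

/-! ### The assumptions and the necessary conditions -/

lemma contDiff_x1 : ContDiff ℝ 2 x1 := by
  rw [contDiff_euclidean]
  intro i
  fin_cases i
  · simp only [Fin.zero_eta, x1_zero]; fun_prop
  · simp only [Fin.mk_one, x1_one]; fun_prop

lemma contDiff_x5 : ContDiff ℝ 2 x5 := by
  rw [contDiff_euclidean]
  intro i
  fin_cases i
  · simp only [Fin.zero_eta, x5_zero]; fun_prop
  · simp only [Fin.mk_one, x5_one]; fun_prop

lemma contDiff_x6 : ContDiff ℝ 2 x6 := by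
  rw [contDiff_euclidean]
  intro i
  fin_cases i
  · simp only [Fin.zero_eta, x6_zero]; fun_prop
  · simp only [Fin.mk_one, x6_one]; fun_prop

lemma three_phases {t : ℝ} (ht : t ∈ Ioo (0 : ℝ) (π / 2) \ {beta, π / 2 - beta}) :
    t ∈ Ioo 0 beta ∨ t ∈ Ioo beta (π / 2 - beta) ∨ t ∈ Ioo (π / 2 - beta) (π / 2) :=
  off_finset_cases ht.1 (by simpa using ht.2)

lemma gam_eventually {t : ℝ} (ht : t ∈ Ioo (0 : ℝ) (π / 2) \ {beta, π / 2 - beta}) :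
    ∀ᶠ s in 𝓝 t, Gam ambiPath s = Gam ambiPath t := by
  rcases three_phases ht with h | h | h
  · filter_upwards [Ioo_mem_nhds h.1 h.2] with s hs
    rw [gam_phase_one hs, gam_phase_one h]
  · filter_upwards [Ioo_mem_nhds h.1 h.2] with s hs
    rw [gam_phase_two (Ioo_subset_Icc_self hs), gam_phase_two (Ioo_subset_Icc_self h)]
  · filter_upwards [Ioo_mem_nhds h.1 h.2] with s hs
    rw [gam_phase_three hs, gam_phase_three h]

lemma wellBehaved_ambi {t : ℝ} (ht : t ∈ Ioo (0 : ℝ) (π / 2) \ {beta, π / 2 - beta}) :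
    WellBehaved ambiPath t := by
  have hG := gam_eventually ht
  rcases three_phases ht with h | h | h
  · have hd := hasDerivAt_one_phase h.2
    have hG1 := gam_phase_one h
    refine (framed_ambiPath.wellBehaved_iff ht.1 hd.1 hd.2 hG).2
      ⟨?_, by simp [hG1], fun _ => by linarith, by simp [hG1], fun _ => by linarith,
        fun _ => by linarith⟩
    refine contDiff_x1.contDiffAt.congr_of_eventuallyEq ?_
    filter_upwards [Iio_mem_nhds h.2] with s hs using ambiPath_of_lt hs
  · have hd := hasDerivAt_two_phase h
    have hm := Ioo_subset_Icc_self h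
    have b1 := ambiU_mid_nonpos hm
    have b2 := ambiU_mid_gt hm
    have b3 := ambiV_mid_nonneg hm
    have b4 := ambiV_mid_lt hm
    refine (framed_ambiPath.wellBehaved_iff ht.1 hd.1 hd.2 hG).2
      ⟨?_, fun _ => ⟨b3, b1⟩, fun _ => by linarith, fun _ => by linarith, fun _ => by linarith,
        fun _ => by linarith⟩
    refine contDiff_x6.contDiffAt.congr_of_eventuallyEq ?_
    filter_upwards [Ioo_mem_nhds h.1 h.2] with s hs
      using ambiPath_of_mem (Ioo_subset_Icc_self hs)
  · have hd := hasDerivAt_three_phase h.1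
    have hG1 := gam_phase_three h
    refine (framed_ambiPath.wellBehaved_iff ht.1 hd.1 hd.2 hG).2
      ⟨?_, by simp [hG1], fun _ => by linarith, fun _ => by linarith, fun _ => by linarith,
        by simp [hG1]⟩
    refine contDiff_x5.contDiffAt.congr_of_eventuallyEq ?_
    filter_upwards [Ioi_mem_nhds h.1] with s hs
    rw [ambiPath, if_neg (not_lt.2 (by linarith [beta_lt, (show π / 2 - beta < s from hs)])),
      if_neg (not_le.2 hs)]

lemma gam_ne {x : ℝ → Plane} {t : ℝ} {s s' : Set Contact} (k : Contact)
    (hs : Gam x t = s) (hk : ¬(k ∈ s ↔ k ∈ s')) : ¬∀ᶠ r in 𝓝 t, Gam x r = s' := fun h =>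
  hk (by rw [← hs, h.self_of_nhds])

lemma necessaryConditions_ambi {t : ℝ}
    (ht : t ∈ Ioo (0 : ℝ) (π / 2) \ {beta, π / 2 - beta}) : NecessaryConditions ambiPath t := by
  have hG := gam_eventually ht
  have hev : ∀ k ∈ Gam ambiPath t, ∀ᶠ s in 𝓝 t, k ∈ Gam ambiPath s := fun k hk =>
    hG.mono fun s hs => hs ▸ hk
  rcases three_phases ht with h | h | h
  · have hd := hasDerivAt_one_phase h.2
    have hG1 := gam_phase_one h
    refine ⟨fun _ => ⟨(framed_ambiPath.odeAt_iff ht.1 hd.1 hd.2).2 ⟨by ring, by ring⟩, ?_⟩,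
      fun h' => absurd h' (gam_ne .x hG1 (by simp)), fun h' => absurd h' (gam_ne .x hG1 (by simp)),
      fun h' => absurd h' (gam_ne .x hG1 (by simp)), fun h' => absurd h' (gam_ne .D hG1 (by simp)),
      fun h' => absurd h' (gam_ne .x hG1 (by simp))⟩
    refine ((framed_ambiPath.hasDerivAt_touch_A ht.1 hd.1).congr_of_eventuallyEq
      (framed_ambiPath.contactPath_eventuallyEq (hev _ (by simp [hG1])))).congr_deriv ?_
    rw [show 1 + (-1 - ambiV t) + ambiV t = 0 by ring, zero_smul]
  · have hd := hasDerivAt_two_phase h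
    have hG1 := gam_phase_two (Ioo_subset_Icc_self h)
    exact ⟨fun h' => absurd h' (gam_ne .x hG1 (by simp)),
      fun h' => absurd h' (gam_ne .B hG1 (by simp)), fun h' => absurd h' (gam_ne .B hG1 (by simp)),
      fun h' => absurd h' (gam_ne .D hG1 (by simp)), fun h' => absurd h' (gam_ne .x hG1 (by simp)),
      fun _ => (framed_ambiPath.odeAt_iff ht.1 hd.1 hd.2).2 ⟨by ring, by ring⟩⟩
  · have hd := hasDerivAt_three_phase h.1
    have hG1 := gam_phase_three h
    refine ⟨fun h' => absurd h' (gam_ne .D hG1 (by simp)),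
      fun h' => absurd h' (gam_ne .x hG1 (by simp)), fun h' => absurd h' (gam_ne .x hG1 (by simp)),
      fun h' => absurd h' (gam_ne .x hG1 (by simp)),
      fun _ => ⟨(framed_ambiPath.odeAt_iff ht.1 hd.1 hd.2).2 ⟨by ring, by ring⟩, ?_⟩,
      fun h' => absurd h' (gam_ne .x hG1 (by simp))⟩
    refine ((framed_ambiPath.hasDerivAt_touch_C ht.1 hd.2).congr_of_eventuallyEq
      (framed_ambiPath.contactPath_eventuallyEq (hev _ (by simp [hG1])))).congr_deriv ?_
    rw [show ambiU t - 1 - (-1 + ambiU t) = 0 by ring, zero_smul]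

lemma ambiAssumptions_ambi : AmbiAssumptions ambiPath beta where
  rotationPath := ⟨framed_ambiPath.cont, ambiPath_start⟩
  angle_pos := beta_pos
  angle_lt := beta_lt
  contDiff := contDiff_ambiPath.contDiffOn
  symmetric := by
    have e := ambiPath_reflect (π / 4)
    have h4 : 2 * ambiPath (π / 4) 0 = axis2 := by
      have := congrArg (fun p : Plane => p 0) e
      simp only [mirror_zero] at this
      rw [show π / 2 - π / 4 = π / 4 by ring] at this
      linarith
    intro t _
    rw [ambiPath_reflect, mirror_zero, mirror_one, h4]
    exact ⟨rfl, rfl⟩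
  startA := by
    refine Subset.antisymm (fun p hp => ?_) ?_
    · rw [mem_singleton_iff, (framed_ambiPath.contactSet_spec hp).2.1]; exact touch_A_zero
    · rw [singleton_subset_iff, ← touch_A_zero]
      refine framed_ambiPath.touch_mem_contactSet zero_mem_I (T := Ioo 0 (π / 2)) ?_
        Subset.rfl fun s hs => ⟨touch_A_mem (Ioo_subset_Icc_self hs), mem_wall.2
          ⟨Kmu_touch _ _, by
            rw [Knu_touch]; exact (ambiU_lt_one (Ioo_subset_Icc_self hs)).le⟩⟩
      rw [closure_Ioo (by positivity)]
      exact zero_mem_I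
  unique_contact := fun t _ k => framed_ambiPath.contactSet_subsingleton k t
  phase_one := fun t h1 h2 => gam_phase_one ⟨h1, h2⟩
  phase_two := fun t h1 h2 => gam_phase_two ⟨h1, h2⟩
  phase_three := fun t h1 h2 => gam_phase_three ⟨h1, h2⟩
  wellBehaved := fun t ht => wellBehaved_ambi ht

lemma ambi_unique (y : ℝ → Plane) (b : ℝ) (h : AmbiAssumptions y b)
    (hn : ∀ t ∈ Ioo (0 : ℝ) (π / 2) \ {b, π / 2 - b}, NecessaryConditions y t) :
    b = beta ∧ EqOn y ambiPath (Icc 0 (π / 2)) := by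
  have hb : b = beta :=
    h.angle_unique hn ambiAssumptions_ambi fun t ht => necessaryConditions_ambi ht
  subst hb
  exact ⟨rfl, h.path_unique hn ambiAssumptions_ambi fun t ht => necessaryConditions_ambi ht⟩

end

/-! ### The reflection across the horizontal axis -/

lemma rho_zero (p : Plane) : rho p 0 = p 0 := by simp [rho]

lemma rho_one (p : Plane) : rho p 1 = 1 - p 1 := by simp [rho]

lemma rho_rho (p : Plane) : rho (rho p) = p := by
  apply plane_ext <;> simp [rho]

lemma continuous_rho : Continuous rho := by
  unfold rho; fun_prop

lemma rho_image (S : Set Plane) : rho '' S = rho ⁻¹' S :=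
  congrFun (image_eq_preimage_of_inverse rho_rho rho_rho) S

lemma mem_ambiShape {p : Plane} :
    p ∈ ambiShape ↔ p ∈ shape ambiPath ∧ rho p ∈ shape ambiPath := by
  rw [ambiShape, rho_image]; rfl

lemma rho_mem_ambiShape {p : Plane} (hp : p ∈ ambiShape) : rho p ∈ ambiShape := by
  rw [mem_ambiShape] at hp ⊢
  rw [rho_rho]; exact hp.symm

lemma mirror_mem_ambiShape {p : Plane} (hp : p ∈ ambiShape) : mirror p ∈ ambiShape := by
  rw [mem_ambiShape] at hp ⊢
  refine ⟨mirror_mem_shape hp.1, ?_⟩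
  have : rho (mirror p) = mirror (rho p) := by apply plane_ext <;> simp [rho, mirror]
  rw [this]
  exact mirror_mem_shape hp.2

/-! ### Motions around the corner -/

/-- In the frame of the placed hallway the hallway stands still and a point of the shape moves with
its frame coordinates. -/
lemma Framed.movesAroundRight {x : ℝ → Plane} {u v : ℝ → ℝ} (h : Framed x u v) :
    MovesAroundRight (shape x) := by
  have hpi := pi_pos
  have hmaps : MapsTo (fun s : ℝ => π / 2 * s) (Icc 0 1) (Icc 0 (π / 2)) := fun s hs =>
    ⟨by have := hs.1; positivity, by nlinarith [hs.2]⟩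
  have key : ∀ p s, -rot (-s) (x s) + rot (-1 * s) p = !₂[Kmu x p s, Knu x p s] := by
    intro p s
    apply plane_ext <;> simp [rot, Kmu, Knu] <;> ring
  refine ⟨fun s => π / 2 * s, fun s => -rot (-(π / 2 * s)) (x (π / 2 * s)), by fun_prop, ?_,
    fun a _ b _ hab => by dsimp only; gcongr, by simp, by simp, fun p hp => ?_, fun p hp => ?_,
    fun s hs p hp => ?_⟩
  · have h0 := h.cont0.comp (by fun_prop) hmaps
    have h1 := h.cont1.comp (by fun_prop) hmaps
    simp only [Function.comp_def] at h0 h1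
    apply continuousOn_plane
    · simp only [rot, PiLp.neg_apply, Matrix.cons_val_zero]; fun_prop
    · simp only [rot, PiLp.neg_apply, Matrix.cons_val_one]; fun_prop
  · dsimp only
    rw [mul_zero, key]
    have e : !₂[Kmu x p 0, Knu x p 0] = p := by
      apply plane_ext <;> simp [Kmu, Knu, h.start]
    rw [e]
    exact hp.1.1
  · dsimp only
    rw [mul_one, key]
    exact mem_placed.1 hp.2
  · rw [key]
    exact mem_placed.1 (mem_iInter₂.1 hp.1.2 _ (hmaps hs))

lemma MovesAround.mono {ε : ℝ} {H₁ H₂ S T : Set Plane} (h : MovesAround ε H₁ H₂ T)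
    (hST : S ⊆ T) : MovesAround ε H₁ H₂ S := by
  obtain ⟨θ, c, h1, h2, h3, h4, h5, h6, h7, h8⟩ := h
  exact ⟨θ, c, h1, h2, h3, h4, h5, fun p hp => h6 p (hST hp), fun p hp => h7 p (hST hp),
    fun s hs p hp => h8 s hs p (hST hp)⟩

lemma MovesAroundRight.rho_image {S : Set Plane} (h : MovesAroundRight S) :
    MovesAroundLeft (rho '' S) := by
  obtain ⟨θ, c, h1, h2, h3, h4, h5, h6, h7, h8⟩ := h
  -- Conjugation by a reflection reverses the sense of rotation. The extra sin and 1 - cos arise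
  -- because the axis y = 1/2 does not pass through the origin.
  have key : ∀ s q, (!₂[c s 0 + sin (θ s), 1 - c s 1 - cos (θ s)] : Plane) +
      rot (1 * θ s) (rho q) = rho (c s + rot (-1 * θ s) q) := by
    intro s q
    apply plane_ext <;> simp [rot, rho] <;> ring
  refine ⟨θ, fun s => !₂[c s 0 + sin (θ s), 1 - c s 1 - cos (θ s)], h1, ?_, h3, h4, h5, ?_, ?_, ?_⟩
  · have c0 := continuousOn_coord h2 0
    have c1 := continuousOn_coord h2 1
    apply continuousOn_plane
    · simp only [Matrix.cons_val_zero]; fun_prop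
    · simp only [Matrix.cons_val_one]; fun_prop
  · rintro _ ⟨q, hq, rfl⟩
    rw [key]
    exact mem_image_of_mem _ (h6 q hq)
  · rintro _ ⟨q, hq, rfl⟩
    rw [key]
    exact mem_image_of_mem _ (h7 q hq)
  · rintro s hs _ ⟨q, hq, rfl⟩
    rw [key, ← image_union]
    exact mem_image_of_mem _ (h8 s hs q hq)

lemma movesAroundRight_ambiShape : MovesAroundRight ambiShape :=
  MovesAround.mono framed_ambiPath.movesAroundRight inter_subset_left

lemma movesAroundLeft_ambiShape : MovesAroundLeft ambiShape :=
  MovesAround.mono framed_ambiPath.movesAroundRight.rho_image inter_subset_right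

/-! ### Compactness -/

lemma bounds_of_mem_shape {p : Plane} (hp : p ∈ shape ambiPath) :
    axis2 - 1 ≤ p 0 ∧ p 0 ≤ 1 ∧ 0 ≤ p 1 ∧ p 1 ≤ 1 := by
  have left_le : ∀ q ∈ shape ambiPath, q 0 ≤ 1 := fun q hq => by
    simpa [Kmu, ambiPath_start] using ((mem_ambi.1 hq).2 0 zero_mem_I).1
  have h1 := left_le _ (mirror_mem_shape hp)
  rw [mirror_zero] at h1
  refine ⟨by linarith, left_le p hp, (mem_ambi.1 hp).1, ?_⟩
  simpa [Knu, ambiPath_start] using ((mem_ambi.1 hp).2 0 zero_mem_I).2.1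

lemma isCompact_ambiShape : IsCompact ambiShape := by
  refine Metric.isCompact_of_isClosed_isBounded ?_ ?_
  · refine (isClosed_shape ambiPath_start).inter ?_
    rw [rho_image]
    exact (isClosed_shape ambiPath_start).preimage continuous_rho
  · refine (Metric.isBounded_closedBall (x := (0 : Plane)) (r := 4)).subset fun p hp => ?_
    obtain ⟨h1, h2, h3, h4⟩ := bounds_of_mem_shape hp.1
    rw [mem_closedBall_zero_iff, EuclideanSpace.norm_eq, sqrt_le_left (by norm_num),
      Fin.sum_univ_two, norm_eq_abs, norm_eq_abs, sq_abs, sq_abs]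
    have : -2 ≤ p 0 := by
      have := a1_lt
      unfold axis2 at h1
      linarith
    nlinarith

/-! ### Connectedness -/

/-- Moving down preserves the outer bounds and moving up preserves the inner ones, since mu and nu
have nonnegative second coordinate. -/
lemma mem_shape_of_between {p q r : Plane} (hp : p ∈ shape ambiPath) (hq : q ∈ shape ambiPath)
    (h0 : p 0 = r 0) (h0' : q 0 = r 0) (h1 : p 1 ≤ r 1) (h2 : r 1 ≤ q 1) :
    r ∈ shape ambiPath := by
  rw [mem_ambi] at *
  refine ⟨hp.1.trans h1, fun s hs => ⟨(Kmu_mono h0'.ge h2 hs).trans (hq.2 s hs).1,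
    (Knu_mono h0'.le h2 hs).trans (hq.2 s hs).2.1, ?_⟩⟩
  rcases (hp.2 s hs).2.2 with h | h
  · exact Or.inl (h.trans (Kmu_mono h0.le h1 hs))
  · exact Or.inr (h.trans (Knu_mono h0.ge h1 hs))

lemma mem_ambiShape_of_between {p r : Plane} (hp : p ∈ ambiShape) (h0 : p 0 = r 0)
    (h : (p 1 ≤ r 1 ∧ r 1 ≤ 1 - p 1) ∨ (1 - p 1 ≤ r 1 ∧ r 1 ≤ p 1)) : r ∈ ambiShape := by
  rw [mem_ambiShape] at *
  obtain ⟨h1, h2⟩ := hp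
  have e0 : rho p 0 = r 0 := by rw [rho_zero, h0]
  have e0' : rho p 0 = rho r 0 := by rw [rho_zero, rho_zero, h0]
  have e0'' : p 0 = rho r 0 := by rw [rho_zero, h0]
  rcases h with ⟨h3, h4⟩ | ⟨h3, h4⟩
  · exact ⟨mem_shape_of_between h1 h2 h0 e0 h3 (by rw [rho_one]; linarith),
      mem_shape_of_between h1 h2 e0'' e0' (by rw [rho_one]; linarith)
        (by rw [rho_one, rho_one]; linarith)⟩
  · exact ⟨mem_shape_of_between h2 h1 e0 h0 (by rw [rho_one]; linarith) h4,
      mem_shape_of_between h2 h1 e0' e0'' (by rw [rho_one, rho_one]; linarith)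
        (by rw [rho_one]; linarith)⟩

lemma touch_C_end : ambiTouch .C (π / 2) = !₂[axis2 - 1, 1 / 2] := by
  have := ambiTouch_reflect .A 0
  rw [sub_zero, touch_A_zero] at this
  rw [show Contact.C = swap .A from rfl, this]
  apply plane_ext <;> simp [mirror]

/-- The outer bounds are inherited from A(0) and C(π/2), the ends of this segment. The corner is
never above it, so the inner condition holds through `Knu` to the left of the corner and through
`Kmu` to the right. -/
lemma center_mem {p : Plane} (h0 : axis2 - 1 ≤ p 0) (h0' : p 0 ≤ 1) (h1 : p 1 = 1 / 2) :
    p ∈ ambiShape := by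
  have hS : p ∈ shape ambiPath := by
    refine mem_ambi.2 ⟨by rw [h1]; norm_num, fun s hs => ⟨?_, ?_, ?_⟩⟩
    · refine le_trans (Kmu_mono ?_ ?_ hs)
        (framed_ambiPath.Kmu_touch_A_le outerConvex_ambi zero_mem_I hs)
      · change p 0 ≤ ambiTouch .A 0 0
        rw [touch_A_zero]; simpa using h0'
      · change p 1 ≤ ambiTouch .A 0 1
        rw [touch_A_zero]; simpa using h1.le
    · refine le_trans (Knu_mono ?_ ?_ hs)
        (framed_ambiPath.Knu_touch_C_le outerConvex_ambi half_mem_I hs)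
      · change ambiTouch .C (π / 2) 0 ≤ p 0
        rw [touch_C_end]; simpa using h0
      · change p 1 ≤ ambiTouch .C (π / 2) 1
        rw [touch_C_end]; simpa using h1.le
    · have h2 := ambiPath_height hs
      have hsin : 0 ≤ sin s := sin_nonneg_of_nonneg_of_le_pi hs.1 (by linarith [hs.2, pi_pos])
      have hcos : 0 ≤ cos s := cos_nonneg_of_mem_Icc ⟨by linarith [hs.1, pi_pos], hs.2⟩
      unfold Kmu Knu
      rcases le_total (p 0) (ambiPath s 0) with h3 | h3
      · right; nlinarith
      · left; nlinarith
  refine mem_ambiShape.2 ⟨hS, ?_⟩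
  have : rho p = p := by
    apply plane_ext
    · rw [rho_zero]
    · rw [rho_one, h1]; norm_num
  rwa [this]

lemma axis2_le : axis2 - 1 ≤ 1 := by unfold axis2; linarith [a1_pos]

lemma right_end_mem : (!₂[1, 1 / 2] : Plane) ∈ ambiShape :=
  center_mem (by simpa using axis2_le) (by simp) (by simp)

lemma left_end_mem : (!₂[axis2 - 1, 1 / 2] : Plane) ∈ ambiShape :=
  center_mem (by simp) (by simpa using axis2_le) (by simp)

/-- Each point is joined vertically to the midline and along it to the right end. -/
lemma isConnected_ambiShape : IsConnected ambiShape := by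
  refine ⟨⟨_, right_end_mem⟩, isPreconnected_of_forall !₂[1, 1 / 2] fun p hp => ?_⟩
  obtain ⟨b1, b2, b3, b4⟩ := bounds_of_mem_shape hp.1
  set m : Plane := !₂[p 0, 1 / 2] with hm
  have m0 : m 0 = p 0 := by simp [hm]
  have m1 : m 1 = 1 / 2 := by simp [hm]
  refine ⟨segment ℝ !₂[1, 1 / 2] m ∪ segment ℝ m p, ?_, Or.inl (left_mem_segment ℝ _ _),
    Or.inr (right_mem_segment ℝ _ _), ?_⟩
  · rintro q (hq | hq)
    · obtain ⟨a, b, ha, hb, hab, rfl⟩ := hq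
      apply center_mem
      · simp [m0]; nlinarith
      · simp [m0]; nlinarith
      · simp [m1]; linarith
    · obtain ⟨a, b, ha, hb, hab, rfl⟩ := hq
      refine mem_ambiShape_of_between hp ?_ ?_
      · simp [m0]; linear_combination -(p 0) * hab
      · simp only [PiLp.add_apply, PiLp.smul_apply, m1, smul_eq_mul]
        rcases le_total (p 1) (1 / 2) with h | h
        · left; constructor <;> nlinarith
        · right; constructor <;> nlinarith
  · exact (convex_segment _ _).isPreconnected.union m (right_mem_segment ℝ _ _)
      (left_mem_segment ℝ _ _) (convex_segment _ _).isPreconnected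

/-! ### The end points -/

/-- During the first phase the wall of A turns about the fixed point (1, 1/2). Once tilted, it cuts
off the part of the line x = 1 above that point; β/2 is an arbitrary time in (0, β). -/
lemma le_half_of_right_end {p : Plane} (hp : p ∈ shape ambiPath) (h0 : p 0 = 1) :
    p 1 ≤ 1 / 2 := by
  have hb := beta_pos
  have hb' := beta_lt
  have hpi := pi_pos
  have hs : 0 < sin (beta / 2) := sin_pos_of_pos_of_lt_pi (by linarith) (by linarith)
  have h := ((mem_ambi.1 hp).2 (beta / 2) ⟨by linarith, by linarith⟩).1
  rw [Kmu, ambiPath_of_lt (by linarith), x1_zero, x1_one, h0] at h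
  have h2 := sin_sq_add_cos_sq (beta / 2)
  have h3 : (p 1 - 1 / 2) * sin (beta / 2) ≤ 0 := by
    have e : (1 - (cos (beta / 2) * (a1 * cos (beta / 2) - 1) -
        sin (beta / 2) * (a1 * sin (beta / 2) - 1 / 2) + (1 - a1))) * cos (beta / 2) +
        (p 1 - (sin (beta / 2) * (a1 * cos (beta / 2) - 1) +
        cos (beta / 2) * (a1 * sin (beta / 2) - 1 / 2) + 1 / 2)) * sin (beta / 2) =
        1 + (p 1 - 1 / 2) * sin (beta / 2) := by
      linear_combination (1 - a1 * cos (beta / 2)) * h2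
    linarith
  by_contra! hlt
  have := mul_pos (sub_pos.2 hlt) hs
  linarith

lemma lt_right_end {p : Plane} (hp : p ∈ ambiShape) (hne : p ≠ !₂[1, 1 / 2]) : p 0 < 1 := by
  rw [mem_ambiShape] at hp
  refine lt_of_le_of_ne (bounds_of_mem_shape hp.1).2.1 fun h0 => hne ?_
  have h1 := le_half_of_right_end hp.1 h0
  have h2 := le_half_of_right_end hp.2 (by rw [rho_zero, h0])
  rw [rho_one] at h2
  apply plane_ext
  · simpa using h0
  · simp; linarith

lemma left_end_lt {p : Plane} (hp : p ∈ ambiShape) (hne : p ≠ !₂[axis2 - 1, 1 / 2]) :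
    axis2 - 1 < p 0 := by
  have := lt_right_end (mirror_mem_ambiShape hp) fun h => hne ?_
  · rw [mirror_zero] at this; linarith
  · rw [← mirror_mirror p, h]
    apply plane_ext <;> simp [mirror]

lemma dist_ends : dist (!₂[axis2 - 1, 1 / 2] : Plane) !₂[1, 1 / 2] = 2 / 3 * rad := by
  have h : a1 = 1 / 4 * rad := rfl
  have h1 := a1_pos
  have e : (axis2 - 1 - 1) ^ 2 = (2 / 3 * rad) ^ 2 := by unfold axis2; rw [h]; ring
  rw [EuclideanSpace.dist_eq, Fin.sum_univ_two, dist_eq, dist_eq, sq_abs, sq_abs]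
  simp only [Matrix.cons_val_zero, Matrix.cons_val_one, sub_self]
  rw [e, zero_pow two_ne_zero, add_zero, sqrt_sq (by linarith)]

/-! ### Areas as integrals over slices -/

lemma volume_eq_lintegral_slice {S : Set Plane} (hS : MeasurableSet S) :
    volume S = ∫⁻ X : ℝ, volume {y : ℝ | (!₂[X, y] : Plane) ∈ S} := by
  have h1 := (PiLp.volume_preserving_toLp (Fin 2)).comp
    ((volume_preserving_finTwoArrow ℝ).symm MeasurableEquiv.finTwoArrow)
  rw [← h1.measure_preimage hS.nullMeasurableSet, Measure.volume_eq_prod,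
    Measure.prod_apply (h1.measurable hS)]
  refine lintegral_congr fun X => congrArg _ ?_
  ext y
  simp only [mem_preimage, mem_ofPred_eq, Function.comp_apply]
  exact Iff.of_eq (congrArg (· ∈ S) (by apply plane_ext <;> rfl))

lemma lintegral_eq_two_mul_of_symm {F : ℝ → ENNReal} {c : ℝ} (h : ∀ X, F (c - X) = F X) :
    ∫⁻ X, F X = 2 * ∫⁻ X in Ioi (c / 2), F X := by
  have h1 : ∫⁻ X in Iio (c / 2), F X = ∫⁻ X in Ioi (c / 2), F X := by
    rw [← lintegral_indicator measurableSet_Iio, ← lintegral_indicator measurableSet_Ioi,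
      ← lintegral_sub_left_eq_self _ c]
    refine lintegral_congr fun X => ?_
    by_cases hX : c / 2 < X
    · rw [indicator_of_mem (show c - X ∈ Iio (c / 2) by rw [mem_Iio]; linarith),
        indicator_of_mem (mem_Ioi.2 hX), h]
    · rw [indicator_of_notMem (show c - X ∉ Iio (c / 2) by rw [mem_Iio]; linarith),
        indicator_of_notMem (by simpa using hX)]
  rw [← lintegral_add_compl F (measurableSet_Ioi (a := c / 2)), compl_Ioi,
    setLIntegral_congr Iio_ae_eq_Iic.symm, h1, two_mul]

lemma setLIntegral_Ioi_split {F : ℝ → ENNReal} {a b : ℝ} (hab : a ≤ b) :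
    ∫⁻ X in Ioi a, F X = (∫⁻ X in Ioo a b, F X) + ∫⁻ X in Ioi b, F X := by
  rw [← Ioc_union_Ioi_eq_Ioi hab, lintegral_union measurableSet_Ioi
    (Ioc_disjoint_Ioi le_rfl), setLIntegral_congr Ioo_ae_eq_Ioc.symm]

/-- The contact time t replaces the abscissa X = f t as integration variable; on open intervals the
slice formula is not needed at break points. -/
lemma setLIntegral_of_deriv_neg {F : ℝ → ENNReal} {f f' h : ℝ → ℝ} {a b : ℝ} (hab : a ≤ b)
    (hc : ContinuousOn f (Icc a b)) (hd : ∀ t ∈ Ioo a b, HasDerivAt f (f' t) t)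
    (hneg : ∀ t ∈ Ioo a b, f' t < 0) (hF : ∀ t ∈ Ioo a b, F (f t) = ENNReal.ofReal (h t)) :
    ∫⁻ X in Ioo (f b) (f a), F X = ∫⁻ t in Ioo a b, ENNReal.ofReal (-f' t * h t) := by
  have hanti : StrictAntiOn f (Icc a b) :=
    strictAntiOn_of_deriv_neg (convex_Icc a b) hc fun t ht => by
      rw [interior_Icc] at ht
      rw [(hd t ht).deriv]; exact hneg t ht
  have himg : f '' Ioo a b = Ioo (f b) (f a) := by
    refine subset_antisymm ?_ (intermediate_value_Ioo' hab hc)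
    rintro _ ⟨t, ht, rfl⟩
    exact ⟨hanti (Ioo_subset_Icc_self ht) (right_mem_Icc.2 hab) ht.2,
      hanti (left_mem_Icc.2 hab) (Ioo_subset_Icc_self ht) ht.1⟩
  rw [← himg, lintegral_image_eq_lintegral_abs_deriv_mul measurableSet_Ioo
    (fun t ht => (hd t ht).hasDerivWithinAt) (hanti.injOn.mono Ioo_subset_Icc_self)]
  refine setLIntegral_congr_fun measurableSet_Ioo fun t ht => ?_
  rw [hF t ht, ← ENNReal.ofReal_mul (abs_nonneg _), abs_of_neg (hneg t ht)]

lemma setLIntegral_of_deriv_pos {F : ℝ → ENNReal} {f f' h : ℝ → ℝ} {a b : ℝ} (hab : a ≤ b)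
    (hc : ContinuousOn f (Icc a b)) (hd : ∀ t ∈ Ioo a b, HasDerivAt f (f' t) t)
    (hpos : ∀ t ∈ Ioo a b, 0 < f' t) (hF : ∀ t ∈ Ioo a b, F (f t) = ENNReal.ofReal (h t)) :
    ∫⁻ X in Ioo (f a) (f b), F X = ∫⁻ t in Ioo a b, ENNReal.ofReal (f' t * h t) := by
  have hmono : StrictMonoOn f (Icc a b) :=
    strictMonoOn_of_deriv_pos (convex_Icc a b) hc fun t ht => by
      rw [interior_Icc] at ht
      rw [(hd t ht).deriv]; exact hpos t ht
  have himg : f '' Ioo a b = Ioo (f a) (f b) := by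
    refine subset_antisymm ?_ (intermediate_value_Ioo hab hc)
    rintro _ ⟨t, ht, rfl⟩
    exact ⟨hmono (left_mem_Icc.2 hab) (Ioo_subset_Icc_self ht) ht.1,
      hmono (Ioo_subset_Icc_self ht) (right_mem_Icc.2 hab) ht.2⟩
  rw [← himg, lintegral_image_eq_lintegral_abs_deriv_mul measurableSet_Ioo
    (fun t ht => (hd t ht).hasDerivWithinAt) (hmono.injOn.mono Ioo_subset_Icc_self)]
  refine setLIntegral_congr_fun measurableSet_Ioo fun t ht => ?_
  rw [hF t ht, ← ENNReal.ofReal_mul (abs_nonneg _), abs_of_pos (hpos t ht)]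

/-- Nonnegativity of the derivative already implies its integrability. -/
lemma lintegral_Ioo_eq_sub {g g' : ℝ → ℝ} {a b : ℝ} (hab : a ≤ b) (hc : ContinuousOn g (Icc a b))
    (hd : ∀ t ∈ Ioo a b, HasDerivAt g (g' t) t) (hpos : ∀ t ∈ Ioo a b, 0 ≤ g' t) :
    0 ≤ g b - g a ∧ ∫⁻ t in Ioo a b, ENNReal.ofReal (g' t) = ENNReal.ofReal (g b - g a) := by
  have hi : IntervalIntegrable g' volume a b := by
    rw [intervalIntegrable_iff_integrableOn_Ioc_of_le hab]
    exact intervalIntegral.integrableOn_deriv_of_nonneg hc hd hpos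
  have h1 := intervalIntegral.integral_eq_sub_of_hasDerivAt_of_le hab hc hd hi
  rw [intervalIntegral.integral_of_le hab, integral_Ioc_eq_integral_Ioo] at h1
  have hae : 0 ≤ᵐ[volume.restrict (Ioo a b)] g' :=
    (ae_restrict_iff' measurableSet_Ioo).2 (Eventually.of_forall hpos)
  rw [← h1]
  refine ⟨integral_nonneg_of_ae hae, (ofReal_integral_eq_lintegral_ofReal ?_ hae).symm⟩
  exact ((intervalIntegrable_iff_integrableOn_Ioc_of_le hab).1 hi).mono_set Ioo_subset_Ioc_self

/-! ### Vertical slices of the shape -/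

/-- The length of the vertical slice of the shape. -/
def sliceLen (X : ℝ) : ENNReal := volume {y : ℝ | (!₂[X, y] : Plane) ∈ ambiShape}

lemma sliceLen_symm (X : ℝ) : sliceLen (axis2 - X) = sliceLen X := by
  unfold sliceLen
  congr 1
  ext y
  simp only [mem_ofPred_eq]
  constructor <;> intro h <;> have := mirror_mem_ambiShape h
  · rwa [show mirror !₂[axis2 - X, y] = !₂[X, y] by apply plane_ext <;> simp [mirror]] at this
  · rwa [show mirror !₂[X, y] = !₂[axis2 - X, y] by apply plane_ext <;> simp [mirror]] at this

lemma sliceLen_of_gt {X : ℝ} (hX : 1 < X) : sliceLen X = 0 := by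
  have : {y : ℝ | (!₂[X, y] : Plane) ∈ ambiShape} = ∅ := by
    refine eq_empty_of_forall_notMem fun y hy => ?_
    have := (bounds_of_mem_shape hy.1).2.1
    simp at this
    linarith
  rw [sliceLen, this, measure_empty]

lemma setLIntegral_sliceLen_Ioi_one : ∫⁻ X in Ioi (1 : ℝ), sliceLen X = 0 :=
  setLIntegral_eq_zero measurableSet_Ioi fun _ hX => sliceLen_of_gt hX

lemma volume_ambiShape_eq_lintegral :
    volume ambiShape = 2 * ∫⁻ X in Ioi (axis2 / 2), sliceLen X := by
  rw [volume_eq_lintegral_slice isCompact_ambiShape.measurableSet]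
  exact lintegral_eq_two_mul_of_symm sliceLen_symm

/-- A slice is symmetric about 1/2 and vertically convex, hence determined by its lowest point. -/
lemma sliceLen_of_boundary {p : Plane} (hp : p ∈ ambiShape)
    (hout : ∀ y < p 1, (!₂[p 0, y] : Plane) ∉ ambiShape) :
    sliceLen (p 0) = ENNReal.ofReal (1 - 2 * p 1) := by
  have : {y : ℝ | (!₂[p 0, y] : Plane) ∈ ambiShape} = Icc (p 1) (1 - p 1) := by
    ext y
    constructor
    · intro hy
      rw [mem_ofPred_eq] at hy
      refine ⟨le_of_not_gt fun h => hout y h hy, le_of_not_gt fun h => ?_⟩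
      refine hout (1 - y) (by linarith) ?_
      convert rho_mem_ambiShape hy using 1
      apply plane_ext <;> simp [rho]
    · rintro ⟨h1, h2⟩
      exact mem_ambiShape_of_between hp (by simp) (Or.inl ⟨by simpa using h1, by simpa using h2⟩)
  rw [sliceLen, this, Real.volume_Icc]
  congr 1; ring

lemma mem_shape_of_upper {p : Plane} (hl : flatL ≤ p 0) (hr : p 0 ≤ flatR) (h1 : 1 / 2 ≤ p 1)
    (h2 : p 1 ≤ 1) : p ∈ shape ambiPath := by
  refine mem_ambi.2 ⟨by linarith, fun s hs => ⟨Kmu_le_one_of_le_flatR hr h2 hs,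
    Knu_le_one_of_flatL_le hl h2 hs, ?_⟩⟩
  have h3 := ambiPath_height hs
  have hsin : 0 ≤ sin s := sin_nonneg_of_nonneg_of_le_pi hs.1 (by linarith [hs.2, pi_pos])
  have hcos : 0 ≤ cos s := cos_nonneg_of_mem_Icc ⟨by linarith [hs.1, pi_pos], hs.2⟩
  unfold Kmu Knu
  rcases le_total (p 0) (ambiPath s 0) with h4 | h4
  · right; nlinarith
  · left; nlinarith

/-- Directly below the corner both frame coordinates at time t are negative. -/
lemma sliceLen_corner {t : ℝ} (ht : t ∈ Icc beta (π / 2 - beta)) :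
    sliceLen (ambiPath t 0) = ENNReal.ofReal (1 - 2 * ambiPath t 1) := by
  have hb := beta_pos
  have ht' : t ∈ Icc 0 (π / 2) := ⟨hb.le.trans ht.1, by linarith [ht.2]⟩
  have hh := ambiPath_height ht'
  have hm := corner_mem ht
  refine sliceLen_of_boundary (mem_ambiShape.2 ⟨hm, ?_⟩) fun y hy hmem => ?_
  · refine mem_shape_of_upper ?_ ?_ ?_ ?_
    · rw [rho_zero]; exact ambiPath_mid_flatL_le ht
    · rw [rho_zero]; exact ambiPath_mid_le_flatR ht
    · rw [rho_one]; linarith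
    · rw [rho_one]; linarith [(mem_ambi.1 hm).1]
  · have hsin : 0 < sin t := sin_pos_of_pos_of_lt_pi (hb.trans_le ht.1) (by linarith [ht.2, pi_pos])
    have hcos : 0 < cos t := cos_pos_of_mem_Ioo ⟨by linarith [ht.1, pi_pos], by linarith [ht.2]⟩
    have h := ((mem_ambi.1 hmem.1).2 t ht').2.2
    simp only [Kmu, Knu, Matrix.cons_val_zero, Matrix.cons_val_one, sub_self, zero_mul, zero_add,
      neg_zero] at h
    rcases h with h | h <;> nlinarith

lemma sliceLen_touch_B {t : ℝ} (ht : t ∈ Ioo beta (π / 2)) :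
    sliceLen (ambiTouch .B t 0) = ENNReal.ofReal (1 - 2 * ambiTouch .B t 1) := by
  have hb := beta_pos
  have ht1 : t ∈ Icc beta (π / 2) := Ioo_subset_Icc_self ht
  have ht' : t ∈ Icc 0 (π / 2) := ⟨hb.le.trans ht.1.le, ht.2.le⟩
  obtain ⟨h1, h2⟩ := touch_B_bounds ht'
  obtain ⟨h3, h4⟩ := touch_B_bounds' ht1
  refine sliceLen_of_boundary (mem_ambiShape.2 ⟨touch_B_mem ht1, ?_⟩) fun y hy hmem => ?_
  · refine mem_shape_of_upper ?_ ?_ ?_ ?_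
    · rwa [rho_zero]
    · rwa [rho_zero]
    · rw [rho_one]; linarith
    · rw [rho_one]; linarith
  · have hsin : 0 < sin t := sin_pos_of_pos_of_lt_pi (hb.trans ht.1) (by linarith [ht.2, pi_pos])
    have hcos : 0 < cos t := cos_pos_of_mem_Ioo ⟨by linarith [ht.1, pi_pos], by linarith [ht.2]⟩
    have h := ((mem_ambi.1 hmem.1).2 t ht').2.2
    have e1 : Kmu ambiPath (ambiTouch .B t) t = 0 := Kmu_touch .B t
    have e2 : Knu ambiPath (ambiTouch .B t) t = ambiU t := Knu_touch .B t
    have hu := ambiU_neg ⟨ht.1, ht.2.le⟩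
    generalize ambiTouch .B t = q at *
    simp only [Kmu, Knu, Matrix.cons_val_zero, Matrix.cons_val_one] at h e1 e2
    rcases h with h | h <;> nlinarith

/-- A(t) is the top of its slice, so the lowest point is its reflection; anything lower would
reflect to a point beyond the outer wall. -/
lemma sliceLen_touch_A {t : ℝ} (ht : t ∈ Ioo 0 (π / 2)) :
    sliceLen (ambiTouch .A t 0) = ENNReal.ofReal (2 * ambiTouch .A t 1 - 1) := by
  have ht' : t ∈ Icc 0 (π / 2) := Ioo_subset_Icc_self ht
  obtain ⟨h1, h2, h3, h4⟩ := touch_A_bounds ht'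
  have hA := touch_A_mem ht'
  have hr : rho (ambiTouch .A t) ∈ shape ambiPath := by
    have e0 : rho (ambiTouch .A t) 0 ≤ ambiTouch .A t 0 := (rho_zero _).le
    have e1 : rho (ambiTouch .A t) 1 ≤ ambiTouch .A t 1 := by rw [rho_one]; linarith
    refine mem_ambi.2 ⟨by rw [rho_one]; linarith, fun s hs => ⟨(Kmu_mono e0 e1 hs).trans
      ((mem_ambi.1 hA).2 s hs).1, Knu_le_one_of_flatL_le ?_ (by rw [rho_one]; linarith) hs,
      Or.inl (Kmu_nonneg_of_flatR_le ?_ (by rw [rho_one]; linarith) hs)⟩⟩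
    · rw [rho_zero]; exact flatL_le_flatR.trans h1
    · rwa [rho_zero]
  have hmem : rho (ambiTouch .A t) ∈ ambiShape := mem_ambiShape.2 ⟨hr, by rwa [rho_rho]⟩
  have e : 1 - 2 * rho (ambiTouch .A t) 1 = 2 * ambiTouch .A t 1 - 1 := by rw [rho_one]; ring
  rw [← e, ← rho_zero (ambiTouch .A t)]
  refine sliceLen_of_boundary hmem fun y hy hy' => ?_
  have hsin : 0 < sin t := sin_pos_of_pos_of_lt_pi ht.1 (by linarith [ht.2, pi_pos])
  have e1 : Kmu ambiPath (ambiTouch .A t) t = 1 := Kmu_touch .A t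
  have h := ((mem_ambi.1 (mem_ambiShape.1 hy').2).2 t ht').1
  generalize ambiTouch .A t = q at *
  simp only [Kmu, rho, Matrix.cons_val_zero, Matrix.cons_val_one] at h e1 hy
  nlinarith

/-! ### The area -/

lemma hasDerivAt_touch_A_zero {t du : ℝ} (ht : t ∈ Ioo 0 (π / 2)) (hu : HasDerivAt ambiU du t) :
    HasDerivAt (fun s => ambiTouch .A s 0) ((1 + du + ambiV t) * -sin t) t := by
  simpa [nu] using (hasDerivAt_plane.1 (framed_ambiPath.hasDerivAt_touch_A ht hu)).1

lemma hasDerivAt_touch_B_zero {t du : ℝ} (ht : t ∈ Ioo 0 (π / 2)) (hu : HasDerivAt ambiU du t) :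
    HasDerivAt (fun s => ambiTouch .B s 0) ((du + ambiV t) * -sin t) t := by
  simpa [nu] using (hasDerivAt_plane.1 (framed_ambiPath.hasDerivAt_touch_B ht hu)).1

lemma hasDerivAt_half_sub_sin_mul_cos (t : ℝ) :
    HasDerivAt (fun t => t / 2 - sin t * cos t / 2) (sin t * sin t) t := by
  refine (((hasDerivAt_id t).div_const 2).sub
    (((hasDerivAt_sin t).mul (hasDerivAt_cos t)).div_const 2)).congr_deriv ?_
  linear_combination (-1 / 2 : ℝ) * sin_sq_add_cos_sq t

lemma sin_sq_half (t : ℝ) :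
    sin (t / 2 + π / 8) * cos (t / 2 + π / 8) = √2 / 4 * (sin t + cos t) := by
  have h : sin (t + π / 4) = 2 * sin (t / 2 + π / 8) * cos (t / 2 + π / 8) := by
    rw [← sin_two_mul]; ring_nf
  rw [sin_add, sin_pi_div_four, cos_pi_div_four] at h
  linarith

lemma cos_sq_half (t : ℝ) :
    cos (t / 2 + π / 8) ^ 2 = 1 / 2 + √2 / 4 * (cos t - sin t) := by
  have h : cos (t + π / 4) = 2 * cos (t / 2 + π / 8) ^ 2 - 1 := by
    rw [← cos_two_mul]; ring_nf
  rw [cos_add, sin_pi_div_four, cos_pi_div_four] at h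
  linarith

/-- An antiderivative for the part of the area below the path of the inner corner. -/
def cornerPrim (t : ℝ) : ℝ :=
  10 / 3 * amp * (4 / 5 * ((sin (t / 2 + π / 8) * cos t + cos (t / 2 + π / 8) * sin t) *
      (cos t - sin t)) -
    6 / 5 * ((cos (t / 2 + π / 8) * cos t - sin (t / 2 + π / 8) * sin t) * (sin t + cos t))) -
  2 * (t + sin t ^ 2) - 4 / 3 * amp ^ 2 * (t / 2 -
    (sin (t / 2 + π / 8) * cos t + cos (t / 2 + π / 8) * sin t) *
      (cos (t / 2 + π / 8) * cos t - sin (t / 2 + π / 8) * sin t) / 3)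

/-- With Q = sin(3t/2 + π/8) and R = sin t + cos t the integrand is (10/3) amp Q R - 2 R^2 - (4/3)
amp^2 Q^2; the three terms are integrated separately. -/
lemma hasDerivAt_cornerPrim (t : ℝ) : HasDerivAt cornerPrim
    ((2 * (sin t + cos t) - 4 / 3 * amp *
      (sin (t / 2 + π / 8) * cos t + cos (t / 2 + π / 8) * sin t)) *
     (amp * (sin (t / 2 + π / 8) * cos t + cos (t / 2 + π / 8) * sin t) - (sin t + cos t))) t := by
  have hs := hasDerivAt_sin t
  have hc := hasDerivAt_cos t
  have hS := hasDerivAt_sin_half t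
  have hC := hasDerivAt_cos_half t
  have hQ := (hS.mul hc).add (hC.mul hs)
  have hQ' := (hC.mul hc).sub (hS.mul hs)
  have hR := hs.add hc
  have hR' := hc.sub hs
  have h := (((((hQ.mul hR').const_mul (4 / 5)).sub ((hQ'.mul hR).const_mul (6 / 5))).const_mul
    (10 / 3 * amp)).sub (((hasDerivAt_id t).add (hs.pow 2)).const_mul 2)).sub
    ((((hasDerivAt_id t).div_const 2).sub ((hQ.mul hQ').div_const 3)).const_mul (4 / 3 * amp ^ 2))
  refine h.congr_deriv ?_
  have h1 := sin_sq_add_cos_sq t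
  have h2 := sin_sq_add_cos_sq (t / 2 + π / 8)
  simp only [Pi.add_apply, Pi.sub_apply, Pi.mul_apply]
  generalize sin t = s at *
  generalize cos t = c at *
  generalize sin (t / 2 + π / 8) = S at *
  generalize cos (t / 2 + π / 8) = C at *
  push_cast
  linear_combination (2 : ℝ) * h1 + 2 / 3 * amp ^ 2 * (s ^ 2 + c ^ 2) * h2 +
    2 / 3 * amp ^ 2 * h1

/-- An antiderivative for the sum of the parts of the area below the inner and the outer
tangency points. -/
def tangentPrim (t : ℝ) : ℝ :=
  t - sin t * cos t + amp * (-(1 / 3) * (sin (t / 2 + π / 8) * (cos t ^ 2 - sin t ^ 2)) +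
    4 / 3 * (cos (t / 2 + π / 8) * (sin t * cos t)) - 7 / 3 * sin (t / 2 + π / 8)) +
  amp ^ 2 * ((t - sin t * cos t) / 3 +
    √2 / 6 * (sin t ^ 3 / 3 + 2 * cos t - cos t ^ 3 / 3))

/-- The identities for products of half-angle functions turn the amp^2 part into polynomials in sin
t and cos t, which is where √2 comes from. -/
lemma hasDerivAt_tangentPrim (t : ℝ) : HasDerivAt tangentPrim
    (sin t * (sin t * amp * cos (t / 2 + π / 8) - (amp * cos (t / 2 + π / 8) - 1) *
      (2 * sin t + 2 / 3 * amp * sin (t / 2 + π / 8) * cos t -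
        4 / 3 * amp * cos (t / 2 + π / 8) * sin t))) t := by
  have hs := hasDerivAt_sin t
  have hc := hasDerivAt_cos t
  have hS := hasDerivAt_sin_half t
  have hC := hasDerivAt_cos_half t
  have hT := (hasDerivAt_id t).sub (hs.mul hc)
  have h := (hT.add (((((hS.mul ((hc.pow 2).sub (hs.pow 2))).const_mul (-(1 / 3))).add
    ((hC.mul (hs.mul hc)).const_mul (4 / 3))).sub (hS.const_mul (7 / 3))).const_mul amp)).add
    (((hT.div_const 3).add (((((hs.pow 3).div_const 3).add (hc.const_mul 2)).sub
      ((hc.pow 3).div_const 3)).const_mul (√2 / 6))).const_mul (amp ^ 2))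
  refine h.congr_deriv ?_
  have h1 := sin_sq_add_cos_sq t
  have h2 := sin_sq_half t
  have h3 := cos_sq_half t
  simp only [Pi.sub_apply, Pi.mul_apply, Pi.pow_apply]
  generalize sin t = s at *
  generalize cos t = c at *
  generalize sin (t / 2 + π / 8) = S at *
  generalize cos (t / 2 + π / 8) = C at *
  push_cast
  linear_combination (-1 + 7 / 6 * amp * C - amp ^ 2 / 3 + √2 / 3 * amp ^ 2 * s) * h1 +
    2 / 3 * amp ^ 2 * s * c * h2 - 4 / 3 * amp ^ 2 * s ^ 2 * h3

lemma amp_sq : amp ^ 2 = 1 + (2 * a1 * cos beta) ^ 2 := by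
  rw [← amp_mul_cos_tau]
  linear_combination -amp ^ 2 * sin_sq_add_cos_sq tau + (amp * sin tau + 1) * amp_mul_sin_tau

lemma cornerPrim_beta {k : ℝ} (hk : amp * cos tau = k) : cornerPrim beta =
    8 / 3 * ((cos beta + k * sin beta) * (cos beta - sin beta)) -
      4 * ((k * cos beta - sin beta) * (sin beta + cos beta)) - 2 * (beta + sin beta ^ 2) -
      2 / 3 * amp ^ 2 * beta +
      4 / 9 * ((cos beta + k * sin beta) * (k * cos beta - sin beta)) := by
  have aux : ∀ p, amp * sin tau = p → cornerPrim beta =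
    8 / 3 * ((p * cos beta + k * sin beta) * (cos beta - sin beta)) -
      4 * ((k * cos beta - p * sin beta) * (sin beta + cos beta)) - 2 * (beta + sin beta ^ 2) -
      2 / 3 * amp ^ 2 * beta +
      4 / 9 * ((p * cos beta + k * sin beta) * (k * cos beta - p * sin beta)) := by
    rintro _ rfl
    rw [← hk, cornerPrim, tau]
    ring
  rw [aux 1 amp_mul_sin_tau, one_mul, one_mul]

lemma cornerPrim_mid :
    cornerPrim (π / 4) = -2 * (π / 4 + 1 / 2) - 4 / 3 * amp ^ 2 * (π / 8) := by
  rw [cornerPrim, show π / 4 / 2 + π / 8 = π / 4 by ring, sin_pi_div_four, cos_pi_div_four]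
  linear_combination -(1 / 2 : ℝ) * sqrt_two_sq

lemma tangentPrim_beta {k : ℝ} (hk : amp * cos tau = k) : tangentPrim beta =
    beta - sin beta * cos beta + (-(1 / 3) * (cos beta ^ 2 - sin beta ^ 2) +
      4 / 3 * (k * (sin beta * cos beta)) - 7 / 3) +
      amp ^ 2 * ((beta - sin beta * cos beta) / 3 +
        √2 / 6 * (sin beta ^ 3 / 3 + 2 * cos beta - cos beta ^ 3 / 3)) := by
  rw [← hk, tangentPrim]
  have h := amp_mul_sin_tau
  rw [tau] at *
  linear_combination (-(1 / 3) * (cos beta ^ 2 - sin beta ^ 2) - 7 / 3) * h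

lemma tangentPrim_reflect_beta {k : ℝ} (hk : amp * cos tau = k) : tangentPrim (π / 2 - beta) =
    π / 2 - beta - cos beta * sin beta + (-(1 / 3) * (k * (sin beta ^ 2 - cos beta ^ 2)) +
      4 / 3 * (cos beta * sin beta) - 7 / 3 * k) +
      amp ^ 2 * ((π / 2 - beta - cos beta * sin beta) / 3 +
        √2 / 6 * (cos beta ^ 3 / 3 + 2 * sin beta - sin beta ^ 3 / 3)) := by
  rw [← hk, tangentPrim, sin_half_reflect, cos_half_reflect, sin_pi_div_two_sub,
    cos_pi_div_two_sub]
  have h := amp_mul_sin_tau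
  rw [tau] at *
  linear_combination (4 / 3 * (cos beta * sin beta)) * h

/-- The terms linear in π and β cancel. The factor √2 survives only through the combination `hL`,
and the rest is a polynomial in T = tan β that vanishes modulo 4 T^3 + 3 T - 1. -/
lemma area_pieces_sum : cornerPrim (π / 4) - cornerPrim beta +
    (tangentPrim (π / 2 - beta) - tangentPrim beta) + sin beta * cos beta / 2 =
      1 / 2 + 2 * tan beta ^ 2 := by
  have hT := tan_beta_cubic
  have hC := amp_mul_cos_tau
  have ha := amp_sq
  have hk0 : 2 * a1 * cos beta * tan beta = 1 / 2 := by linarith [a1_cos_beta_mul]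
  have h1 := sin_sq_add_cos_sq beta
  have hq := cos_beta_sq
  have hs := sin_beta
  have h2 : cos tau ^ 2 = _ := cos_sq_half beta
  rw [cornerPrim_mid, cornerPrim_beta hC, tangentPrim_reflect_beta hC, tangentPrim_beta hC]
  generalize 2 * a1 * cos beta = k at *
  generalize tan beta = T at *
  generalize cos tau = C at *
  generalize sin beta = s at *
  generalize cos beta = c at *
  -- By the cubic 1/T = 4 T^2 + 3, and k = 1/(2T). The next line inverts 1 + T^2 modulo the cubic in
  -- the same way.
  have hk : k = 2 * T ^ 2 + 3 / 2 := by linear_combination (4 * T ^ 2 + 3) * hk0 - k * hT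
  have hc2 : c ^ 2 = (1 + 4 * T - 4 * T ^ 2) / 2 := by
    linear_combination (1 + 4 * T - 4 * T ^ 2) / 2 * hq - c ^ 2 * (1 - T) / 2 * hT
  have hsc : s * c = T * ((1 + 4 * T - 4 * T ^ 2) / 2) := by rw [hs, ← hc2]; ring
  have hs2 : s ^ 2 = T ^ 2 * ((1 + 4 * T - 4 * T ^ 2) / 2) := by rw [hs, ← hc2]; ring
  have hL : amp ^ 2 * (√2 / 2 * (c - s)) = k ^ 2 - 1 := by
    linear_combination -2 * amp ^ 2 * h2 + 2 * (amp * C + k) * hC - ha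
  have hM : amp ^ 2 * (√2 / 6 * (c ^ 3 / 3 + 2 * s - s ^ 3 / 3)) -
      amp ^ 2 * (√2 / 6 * (s ^ 3 / 3 + 2 * c - c ^ 3 / 3)) =
      1 / 3 * (k ^ 2 - 1) * (2 / 3 * (1 + s * c) - 2) := by
    linear_combination 1 / 3 * (2 / 3 * (1 + s * c) - 2) * hL +
      amp ^ 2 * (√2 / 9 * (c - s)) * h1
  have hN : -2 * (1 / 2 : ℝ) - (8 / 3 * (c ^ 2 - s * c + k * (s * c - s ^ 2)) -
      4 * (k * (s * c + c ^ 2) - s ^ 2 - s * c) - 2 * s ^ 2 +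
      4 / 9 * (k * (c ^ 2 - s ^ 2) + (k ^ 2 - 1) * (s * c))) +
      (-(1 / 3) * (k * (s ^ 2 - c ^ 2)) + 4 / 3 * (s * c) - 7 / 3 * k) -
      (-(1 / 3) * (c ^ 2 - s ^ 2) + 4 / 3 * (k * (s * c)) - 7 / 3) +
      1 / 3 * (k ^ 2 - 1) * (2 / 3 * (1 + s * c) - 2) + s * c / 2 = 1 / 2 + 2 * T ^ 2 := by
    rw [hsc, hs2, hc2, hk]
    linear_combination (53 / 36 - 97 / 36 * T + 3 * T ^ 2 - 29 / 9 * T ^ 3 + 4 / 9 * T ^ 4) * hT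
  linear_combination hM + hN

/-! ### Integration of the slices over the ranges of the corner, B and A. -/

lemma sin_pos_of_mem {t : ℝ} (ht : t ∈ Ioo 0 (π / 2)) : 0 < sin t :=
  sin_pos_of_pos_of_lt_pi ht.1 (by linarith [ht.2, pi_pos])

lemma cos_pos_of_mem {t : ℝ} (ht : t ∈ Ioo 0 (π / 2)) : 0 < cos t :=
  cos_pos_of_mem_Ioo ⟨by linarith [ht.1, pi_pos], ht.2⟩

lemma continuousOn_ambiTouch_zero (k : Contact) {a b : ℝ} (ha : 0 ≤ a) (hb : b ≤ π / 2) :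
    ContinuousOn (fun t => ambiTouch k t 0) (Icc a b) :=
  continuousOn_coord ((framed_ambiPath.continuousOn_touch k).mono (Icc_subset_Icc ha hb)) 0

lemma touch_A_one (t : ℝ) : ambiTouch .A t 1 = ambiPath t 1 + sin t + ambiU t * cos t := by
  simp [touch, offMu, offNu]

lemma touch_B_one (t : ℝ) : ambiTouch .B t 1 = ambiPath t 1 + ambiU t * cos t := by
  simp [touch, offMu, offNu]

lemma ambiPath_of_gt {t : ℝ} (ht : π / 2 - beta < t) : ambiPath t = x5 t := by
  rw [ambiPath, if_neg (not_lt.2 (by linarith [beta_lt])), if_neg (not_le.2 ht)]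

lemma touch_B_one_last {t : ℝ} (ht : π / 2 - beta < t) :
    ambiTouch .B t 1 = 1 / 2 - sin t / 2 := by
  rw [touch_B_one, ambiPath_of_gt ht, x5_one, ambiU_of_gt ht]; ring

lemma touch_A_one_last {t : ℝ} (ht : π / 2 - beta < t) :
    ambiTouch .A t 1 = 1 / 2 + sin t / 2 := by
  rw [touch_A_one, ambiPath_of_gt ht, x5_one, ambiU_of_gt ht]; ring

/-- A rests at the right end throughout the first phase, so times before β sweep out no area. -/
lemma touch_A_beta_zero : ambiTouch .A beta 0 = 1 := by
  have h := a1_mul_sin_beta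
  have h1 := sin_sq_add_cos_sq beta
  have : ambiTouch .A beta 0 = ambiPath beta 0 + cos beta := by
    simp [touch, offMu, offNu, ambiU_beta]
  rw [this, ambiPath_of_le le_rfl, x1_zero]
  linear_combination a1 * h1 - sin beta / 2 * h

lemma lintegral_corner : 0 ≤ cornerPrim (π / 4) - cornerPrim beta ∧
    ∫⁻ X in Ioo (axis2 / 2) (ambiTouch .B beta 0), sliceLen X =
      ENNReal.ofReal (cornerPrim (π / 4) - cornerPrim beta) := by
  have hb := beta_pos
  have hb' := beta_lt
  have hpi := pi_pos
  have hm : ∀ t ∈ Ioo beta (π / 4), t ∈ Ioo beta (π / 2 - beta) := fun t ht =>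
    ⟨ht.1, by linarith [ht.2]⟩
  have hmid : ambiPath (π / 4) 0 = axis2 / 2 := by
    have := congrArg (fun p : Plane => p 0) (ambiPath_reflect (π / 4))
    rw [show π / 2 - π / 4 = π / 4 by ring, mirror_zero] at this
    linarith
  have key := setLIntegral_of_deriv_neg (F := sliceLen) (f := fun t => ambiPath t 0)
    (h := fun t => 1 - 2 * ambiPath t 1) hb'.le
    (fun t _ => (hasDerivAt_ambiPath_zero t).continuousAt.continuousWithinAt)
    (fun t _ => hasDerivAt_ambiPath_zero t)
    (fun t ht => by
      have h1 := ambiU_mid_nonpos (Ioo_subset_Icc_self (hm t ht))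
      have h2 := ambiV_mid_pos (Ioo_subset_Ico_self (hm t ht))
      have h0 : t ∈ Ioo 0 (π / 2) := ⟨hb.trans ht.1, by linarith [ht.2]⟩
      nlinarith [mul_pos h2 (sin_pos_of_mem h0),
        mul_nonneg (neg_nonneg.2 h1) (cos_pos_of_mem h0).le])
    (fun t ht => sliceLen_corner (Ioo_subset_Icc_self (hm t ht)))
  have hval : ∀ t ∈ Ioo beta (π / 4), -(ambiU t * cos t - ambiV t * sin t) *
      (1 - 2 * ambiPath t 1) = (2 * (sin t + cos t) - 4 / 3 * amp *
      (sin (t / 2 + π / 8) * cos t + cos (t / 2 + π / 8) * sin t)) *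
      (amp * (sin (t / 2 + π / 8) * cos t + cos (t / 2 + π / 8) * sin t) - (sin t + cos t)) := by
    intro t ht
    have ht' := Ioo_subset_Icc_self (hm t ht)
    rw [ambiU_of_mem ht', ambiV_of_mem ht', ambiPath_of_mem ht', x6_one]
    ring
  have hprim := lintegral_Ioo_eq_sub hb'.le
    (fun t _ => (hasDerivAt_cornerPrim t).continuousAt.continuousWithinAt)
    (fun t _ => hasDerivAt_cornerPrim t) (fun t ht => by
      rw [← hval t ht]
      have h1 := ambiU_mid_nonpos (Ioo_subset_Icc_self (hm t ht))
      have h2 := ambiV_mid_pos (Ioo_subset_Ico_self (hm t ht))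
      have h0 : t ∈ Ioo 0 (π / 2) := ⟨hb.trans ht.1, by linarith [ht.2]⟩
      refine mul_nonneg ?_ (by linarith [ambiPath_height (Ioo_subset_Icc_self h0)])
      nlinarith [mul_pos h2 (sin_pos_of_mem h0), mul_nonneg (neg_nonneg.2 h1)
        (cos_pos_of_mem h0).le])
  refine ⟨hprim.1, ?_⟩
  rw [← hprim.2, touch_B_beta, ← hmid, key]
  exact setLIntegral_congr_fun measurableSet_Ioo fun t ht => by rw [hval t ht]

lemma lintegral_tangent : 0 ≤ tangentPrim (π / 2 - beta) - tangentPrim beta ∧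
    (∫⁻ X in Ioo (ambiTouch .B beta 0) (ambiTouch .B (π / 2 - beta) 0), sliceLen X) +
      (∫⁻ X in Ioo (ambiTouch .A (π / 2 - beta) 0) 1, sliceLen X) =
      ENNReal.ofReal (tangentPrim (π / 2 - beta) - tangentPrim beta) := by
  have hb := beta_pos
  have hpi := pi_pos
  have hle := beta_mem.2
  have hI : ∀ t ∈ Ioo beta (π / 2 - beta), t ∈ Ioo 0 (π / 2) := fun t ht =>
    ⟨hb.trans ht.1, by linarith [ht.2]⟩
  have kB := setLIntegral_of_deriv_pos (F := sliceLen) (h := fun t => 1 - 2 * ambiTouch .B t 1) hle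
    (continuousOn_ambiTouch_zero .B hb.le (by linarith))
    (fun t ht => hasDerivAt_touch_B_zero (hI t ht) (hasDerivAt_two_phase ht).1)
    (fun t ht => by
      have h1 := ambiV_mid_lt (Ioo_subset_Icc_self ht)
      nlinarith [sin_pos_of_mem (hI t ht)])
    (fun t ht => sliceLen_touch_B ⟨ht.1, (hI t ht).2⟩)
  have kA := setLIntegral_of_deriv_neg (F := sliceLen) (h := fun t => 2 * ambiTouch .A t 1 - 1) hle
    (continuousOn_ambiTouch_zero .A hb.le (by linarith))
    (fun t ht => hasDerivAt_touch_A_zero (hI t ht) (hasDerivAt_two_phase ht).1)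
    (fun t ht => by
      have h1 := ambiV_mid_nonneg (Ioo_subset_Icc_self ht)
      nlinarith [sin_pos_of_mem (hI t ht)])
    (fun t ht => sliceLen_touch_A (hI t ht))
  have pB : ∀ t ∈ Ioo beta (π / 2 - beta), 0 ≤ (-(1 + ambiV t) / 2 + ambiV t) * -sin t *
      (1 - 2 * ambiTouch .B t 1) := fun t ht => by
    have h1 := ambiV_mid_lt (Ioo_subset_Icc_self ht)
    have h2 := (touch_B_bounds' ⟨ht.1.le, (hI t ht).2.le⟩).2
    exact mul_nonneg (by nlinarith [sin_pos_of_mem (hI t ht)]) (by linarith)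
  have pA : ∀ t ∈ Ioo beta (π / 2 - beta), 0 ≤ -((1 + -(1 + ambiV t) / 2 + ambiV t) * -sin t) *
      (2 * ambiTouch .A t 1 - 1) := fun t ht => by
    have h1 := ambiV_mid_nonneg (Ioo_subset_Icc_self ht)
    have h2 := (touch_A_bounds (Ioo_subset_Icc_self (hI t ht))).2.2.1
    exact mul_nonneg (by nlinarith [sin_pos_of_mem (hI t ht)]) (by linarith)
  have hval : ∀ t ∈ Ioo beta (π / 2 - beta), (-(1 + ambiV t) / 2 + ambiV t) * -sin t *
      (1 - 2 * ambiTouch .B t 1) + -((1 + -(1 + ambiV t) / 2 + ambiV t) * -sin t) *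
      (2 * ambiTouch .A t 1 - 1) =
      sin t * (sin t * amp * cos (t / 2 + π / 8) - (amp * cos (t / 2 + π / 8) - 1) *
      (2 * sin t + 2 / 3 * amp * sin (t / 2 + π / 8) * cos t -
        4 / 3 * amp * cos (t / 2 + π / 8) * sin t)) := by
    intro t ht
    have ht' := Ioo_subset_Icc_self ht
    rw [touch_A_one, touch_B_one, ambiU_of_mem ht', ambiV_of_mem ht', ambiPath_of_mem ht', x6_one]
    ring
  have hprim := lintegral_Ioo_eq_sub hle
    (fun t _ => (hasDerivAt_tangentPrim t).continuousAt.continuousWithinAt)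
    (fun t _ => hasDerivAt_tangentPrim t)
    (fun t ht => by rw [← hval t ht]; exact add_nonneg (pB t ht) (pA t ht))
  refine ⟨hprim.1, ?_⟩
  rw [touch_A_beta_zero] at kA
  rw [← hprim.2, kB, kA, ← lintegral_add_left' ?_]
  · refine setLIntegral_congr_fun measurableSet_Ioo fun t ht => ?_
    rw [← hval t ht, ENNReal.ofReal_add (pB t ht) (pA t ht)]
  · have hcont : ContinuousOn (fun t => ambiTouch .B t 1) (Ioo beta (π / 2 - beta)) :=
      continuousOn_coord ((framed_ambiPath.continuousOn_touch .B).mono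
        fun t ht => Ioo_subset_Icc_self (hI t ht)) 1
    have := continuous_ambiV
    refine (ContinuousOn.aemeasurable ?_ measurableSet_Ioo).ennreal_ofReal
    exact (by fun_prop : Continuous fun t => (-(1 + ambiV t) / 2 + ambiV t) * -sin t).continuousOn.mul
      (continuousOn_const.sub (continuousOn_const.mul hcont))

/-- In the last phase the slices at A and at B both have length sin t, and both abscissae move with
speed sin t / 2; the integrands add up to sin^2 t. -/
lemma lintegral_last : 0 ≤ beta / 2 + sin beta * cos beta / 2 ∧
    (∫⁻ X in Ioo (ambiTouch .B (π / 2 - beta) 0) flatR, sliceLen X) +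
      (∫⁻ X in Ioo flatR (ambiTouch .A (π / 2 - beta) 0), sliceLen X) =
      ENNReal.ofReal (beta / 2 + sin beta * cos beta / 2) := by
  have hb := beta_pos
  have hb' := beta_lt
  have hpi := pi_pos
  have hle : π / 2 - beta ≤ π / 2 := by linarith
  have hI : ∀ t ∈ Ioo (π / 2 - beta) (π / 2), t ∈ Ioo 0 (π / 2) := fun t ht =>
    ⟨by linarith [ht.1], ht.2⟩
  have kB := setLIntegral_of_deriv_pos (F := sliceLen) (h := sin) hle
    (continuousOn_ambiTouch_zero .B (by linarith) le_rfl)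
    (fun t ht => hasDerivAt_touch_B_zero (hI t ht) (hasDerivAt_three_phase ht.1).1)
    (fun t ht => by nlinarith [sin_pos_of_mem (hI t ht)])
    (fun t ht => by
      rw [sliceLen_touch_B ⟨by linarith [ht.1], ht.2⟩, touch_B_one_last ht.1]
      congr 1; ring)
  have kA := setLIntegral_of_deriv_neg (F := sliceLen) (h := sin) hle
    (continuousOn_ambiTouch_zero .A (by linarith) le_rfl)
    (fun t ht => hasDerivAt_touch_A_zero (hI t ht) (hasDerivAt_three_phase ht.1).1)
    (fun t ht => by nlinarith [sin_pos_of_mem (hI t ht)])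
    (fun t ht => by
      rw [sliceLen_touch_A (hI t ht), touch_A_one_last ht.1]
      congr 1; ring)
  have hprim := lintegral_Ioo_eq_sub hle
    (fun t _ => (hasDerivAt_half_sub_sin_mul_cos t).continuousAt.continuousWithinAt)
    (fun t _ => hasDerivAt_half_sub_sin_mul_cos t) (fun t _ => mul_self_nonneg _)
  have e : π / 2 / 2 - sin (π / 2) * cos (π / 2) / 2 - ((π / 2 - beta) / 2 -
      sin (π / 2 - beta) * cos (π / 2 - beta) / 2) = beta / 2 + sin beta * cos beta / 2 := by
    rw [cos_pi_div_two, sin_pi_div_two_sub, cos_pi_div_two_sub]; ring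
  rw [e] at hprim
  refine ⟨hprim.1, ?_⟩
  have endB : ambiTouch .B (π / 2) 0 = flatR := by rw [touch_B_end]; simp
  have endA : ambiTouch .A (π / 2) 0 = flatR := by rw [touch_A_end]; simp
  rw [endB] at kB
  rw [endA] at kA
  rw [← hprim.2, kB, kA, ← lintegral_add_left' ?_]
  · refine setLIntegral_congr_fun measurableSet_Ioo fun t ht => ?_
    have hs := sin_pos_of_mem (hI t ht)
    rw [← ENNReal.ofReal_add (by nlinarith) (by nlinarith)]
    congr 1; ring
  · have := continuous_ambiV.measurable
    fun_prop

/-- Since 3 ± 2√2 = (√2 ± 1)^2, the cube roots are the squares of those in tan β, whose product is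
1. -/
lemma area_closed_form :
    (3 + 2 * √2) ^ (1 / 3 : ℝ) + (3 - 2 * √2) ^ (1 / 3 : ℝ) - 1 = 1 + 4 * tan beta ^ 2 := by
  have h2 := sqrt_two_sq
  have hgt := sqrt_two_gt
  have hlt := sqrt_two_lt
  have hp := rpow_third_pow (r := √2 + 1) (by linarith)
  have hq := rpow_third_pow (r := √2 - 1) (by linarith)
  have hpq := rpow_third_mul_self
  have e1 := rpow_third_eq (r := 3 + 2 * √2) (y := ((√2 + 1) ^ (1 / 3 : ℝ)) ^ 2) (by positivity)
    (by rw [pow_right_comm, hp]; linear_combination h2)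
  have e2 := rpow_third_eq (r := 3 - 2 * √2) (y := ((√2 - 1) ^ (1 / 3 : ℝ)) ^ 2) (by positivity)
    (by rw [pow_right_comm, hq]; linear_combination h2)
  rw [tan_beta_eq, e1, e2]
  linear_combination 2 * hpq

lemma volume_ambiShape : volume ambiShape = ENNReal.ofReal
    ((3 + 2 * √2) ^ (1 / 3 : ℝ) + (3 - 2 * √2) ^ (1 / 3 : ℝ) - 1 + beta) := by
  have hb := beta_pos
  have hb' := beta_lt
  have hpi := pi_pos
  obtain ⟨h1, e1⟩ := lintegral_corner
  obtain ⟨h2, e2⟩ := lintegral_tangent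
  obtain ⟨h3, e3⟩ := lintegral_last
  have hg : π / 2 - beta ∈ Icc 0 (π / 2) := reflect_Icc beta_mem_I
  have l1 : axis2 / 2 ≤ ambiTouch .B beta 0 := by
    have r1 := ambiPath_zero_antitone le_rfl beta_mem.2 le_rfl
    rw [ambiPath_reflect, mirror_zero, ← touch_B_beta] at r1
    linarith
  have l2 : ambiTouch .B beta 0 ≤ ambiTouch .B (π / 2 - beta) 0 :=
    (framed_ambiPath.touch_B_monotone innerConvex_ambi hb.le beta_mem.2 hg.2).1
  have l3 := (touch_B_bounds hg).1
  have l4 := (touch_A_bounds hg).1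
  have l5 := (touch_A_bounds hg).2.1
  rw [volume_ambiShape_eq_lintegral, setLIntegral_Ioi_split l1, setLIntegral_Ioi_split l2,
    setLIntegral_Ioi_split l3, setLIntegral_Ioi_split l4, setLIntegral_Ioi_split l5,
    setLIntegral_sliceLen_Ioi_one, area_closed_form]
  -- From left to right the pieces are the corner, B middle, B last, A last, A middle; they are
  -- regrouped so that B and A share a time interval.
  have e : ∀ a b c d e : ENNReal, a + (b + (c + (d + (e + 0)))) = a + (b + e) + (c + d) := by
    intros; rw [add_zero]; ring
  rw [e, e1, e2, e3, ← ENNReal.ofReal_add h1 h2, ← ENNReal.ofReal_add (by linarith) h3,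
    show (2 : ENNReal) = ENNReal.ofReal 2 by simp, ← ENNReal.ofReal_mul (by norm_num)]
  congr 1
  linear_combination 2 * area_pieces_sum

end Sofa

end

theorem theorem5 :
    -- `Σ` is a shape that can move around corners both to the right and to the left
    (IsCompact ambiShape ∧ IsConnected ambiShape ∧
      MovesAroundRight ambiShape ∧ MovesAroundLeft ambiShape) ∧
    -- the rotation path satisfies the assumptions and the necessary conditions ...
    (AmbiAssumptions ambiPath beta ∧
      ∀ t ∈ Ioo (0 : ℝ) (π / 2) \ {beta, π / 2 - beta}, NecessaryConditions ambiPath t) ∧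
    -- ... and is the only rotation path that does
    (∀ (y : ℝ → Plane) (b : ℝ), AmbiAssumptions y b →
      (∀ t ∈ Ioo (0 : ℝ) (π / 2) \ {b, π / 2 - b}, NecessaryConditions y t) →
      b = beta ∧ EqOn y ambiPath (Icc 0 (π / 2))) ∧
    -- the area of `Σ`
    volume ambiShape = ENNReal.ofReal
      ((3 + 2 * √2) ^ (1 / 3 : ℝ) + (3 - 2 * √2) ^ (1 / 3 : ℝ) - 1 + beta) ∧
    -- the distance between the left and right end points of `Σ`
    (∃ l ∈ ambiShape, ∃ r ∈ ambiShape,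
      (∀ p ∈ ambiShape, p ≠ l → l 0 < p 0) ∧ (∀ p ∈ ambiShape, p ≠ r → p 0 < r 0) ∧
      dist l r =
        2 / 3 * √(4 + (71 + 8 * √2) ^ (1 / 3 : ℝ) + (71 - 8 * √2) ^ (1 / 3 : ℝ))) := by
  exact ⟨⟨isCompact_ambiShape, isConnected_ambiShape, movesAroundRight_ambiShape,
      movesAroundLeft_ambiShape⟩,
    ⟨ambiAssumptions_ambi, fun t ht => necessaryConditions_ambi ht⟩, ambi_unique, volume_ambiShape,
    _, left_end_mem, _, right_end_mem, fun p hp hne => by simpa using left_end_lt hp hne,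
    fun p hp hne => by simpa using lt_right_end hp hne, dist_ends⟩
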